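/- Let $N$ be a simply connected nilpotent Lie group of dimension $n\ge 1$ and let $\Lambda\subset N$ be a discrete subgroup such that $M=N/\Lambda$ is compact. Equip $N$ with a right invariant Riemannian metric and $M$ with the induced Riemannian metric. Let $\bar N=N/[N,N]$, which is isomorphic to some $\mathbb R^k$ as a Lie group. An endomorphism of $M$ is a map $\rho:M\to M$, $\rho(x\Lambda)=R(x)\Lambda$, induced by an automorphism $R$ of $N$ with $R(\Lambda)\subset\Lambda$; write $\bar R:\bar N\to\bar N$ for the induced automorphism of $\bar N\cong\mathbb R^k$, which is linear. Let $\mathcal C$ be the set of all surjective endomorphisms $\rho$ of $M$ for which the linear map $\bar R$ (the one that corresponds to the endomorphism of the torus $N/([N,N]\Lambda)$ induced by $\rho$) is semisimple and has no complex eigenvalue of absolute value $1$. Schmidt's game on a complete metric space $X$ with parameters $\alpha,\beta\in(0,1)$ is played as follows. Player $\mathcal B$ chooses $r>0$ and a closed ball $B_0$ of radius $r$; inductively, for $k\ge 0$, player $\mathcal A$ chooses a closed ball $A_{k+1}\subset B_k$ of radius $\alpha(\alpha\beta)^k r$, and then $\mathcal B$ chooses a closed ball $B_{k+1}\subset A_{k+1}$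 of radius $(\alpha\beta)^{k+1}r$. A set $S\subset X$ is $\alpha$-winning if for every $\beta\in(0,1)$ player $\mathcal A$ has a strategy which guarantees that the unique point of $\bigcap_{k\ge 1}A_k$ belongs to $S$. Then there exist a real number $\mu$ with $0<\mu\le 1/2$ and a nonempty set $S\subset M$ such that 1. for every $\rho\in\mathcal C$ and every $x\in S$, the closure of the orbit $\{\rho^k(x)\mid k\ge 0\}$ contains no $\rho$-periodic point; 2. $S$ is $\alpha$-winning for every $\alpha\in(0,\mu]$; 3. $S\cap U$ has Hausdorff dimension $n$ for every nonempty open set $U\subset M$. -/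

import Mathlib

open scoped Manifold ContDiff Bundle

noncomputable section

namespace Nilmanifold

section QuotientMetric

variable {N : Type*} [MetricSpace N] [Group N]

/-- The distance between two cosets `a, b ∈ N ⧸ Λ`: the infimum of `dist x y` over all
representatives `x` of `a` and `y` of `b`.  When `N` is a Riemannian manifold whose distance is
right invariant and `Λ` is discrete, `N → N ⧸ Λ` is a Riemannian covering and this is the
Riemannian distance of the induced Riemannian metric on `N ⧸ Λ` (every path in `N ⧸ Λ` lifts to a
path of the same length in `N`). -/
def cosetDist (Λ : Subgroup N) (a b : N ⧸ Λ) : ℝ :=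
  sInf {d : ℝ | ∃ x y : N, (x : N ⧸ Λ) = a ∧ (y : N ⧸ Λ) = b ∧ dist x y = d}

lemma cosetDist_bddBelow (Λ : Subgroup N) (a b : N ⧸ Λ) :
    BddBelow {d : ℝ | ∃ x y : N, (x : N ⧸ Λ) = a ∧ (y : N ⧸ Λ) = b ∧ dist x y = d} :=
  ⟨0, by rintro d ⟨x, y, -, -, rfl⟩; exact dist_nonneg⟩

lemma cosetDist_nonneg (Λ : Subgroup N) (a b : N ⧸ Λ) : 0 ≤ cosetDist Λ a b :=
  Real.sInf_nonneg (by rintro d ⟨x, y, -, -, rfl⟩; exact dist_nonneg)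

lemma cosetDist_mk_le (Λ : Subgroup N) (x y : N) :
    cosetDist Λ (x : N ⧸ Λ) (y : N ⧸ Λ) ≤ dist x y :=
  csInf_le (cosetDist_bddBelow Λ _ _) ⟨x, y, rfl, rfl, rfl⟩

lemma cosetDist_comm (Λ : Subgroup N) (a b : N ⧸ Λ) : cosetDist Λ a b = cosetDist Λ b a := by
  unfold cosetDist
  congr 1
  ext d
  constructor
  · rintro ⟨x, y, hx, hy, rfl⟩
    exact ⟨y, x, hy, hx, dist_comm _ _⟩
  · rintro ⟨x, y, hx, hy, rfl⟩
    exact ⟨y, x, hy, hx, dist_comm _ _⟩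

variable [IsIsometricSMul Nᵐᵒᵖ N]

lemma exists_of_cosetDist_lt (Λ : Subgroup N) {x : N} {b : N ⧸ Λ} {ε : ℝ}
    (h : cosetDist Λ (x : N ⧸ Λ) b < ε) : ∃ y : N, (y : N ⧸ Λ) = b ∧ dist x y < ε := by
  obtain ⟨y₀, rfl⟩ := QuotientGroup.mk_surjective b
  have hne : {d : ℝ | ∃ x' y' : N, (x' : N ⧸ Λ) = x ∧ (y' : N ⧸ Λ) = y₀ ∧
      dist x' y' = d}.Nonempty := ⟨_, x, y₀, rfl, rfl, rfl⟩
  obtain ⟨d, ⟨x', y', hx, hy, rfl⟩, hd⟩ := exists_lt_of_csInf_lt hne h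
  refine ⟨y' * (x'⁻¹ * x), ?_, ?_⟩
  · rw [← hy]
    exact QuotientGroup.mk_mul_of_mem _ (QuotientGroup.eq.1 hx)
  · have : dist (x' * (x'⁻¹ * x)) (y' * (x'⁻¹ * x)) = dist x' y' := dist_mul_right _ _ _
    rw [mul_inv_cancel_left] at this
    rwa [this]

lemma cosetDist_triangle (Λ : Subgroup N) (a b c : N ⧸ Λ) :
    cosetDist Λ a c ≤ cosetDist Λ a b + cosetDist Λ b c := by
  obtain ⟨x, rfl⟩ := QuotientGroup.mk_surjective a
  refine le_of_forall_pos_le_add fun ε hε => ?_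
  obtain ⟨y, rfl, hy⟩ := exists_of_cosetDist_lt Λ
    (lt_add_of_pos_right (cosetDist Λ (x : N ⧸ Λ) b) (half_pos hε))
  obtain ⟨z, rfl, hz⟩ := exists_of_cosetDist_lt Λ
    (lt_add_of_pos_right (cosetDist Λ (y : N ⧸ Λ) c) (half_pos hε))
  have h1 := cosetDist_mk_le Λ x z
  have h2 := dist_triangle x y z
  linarith

lemma eq_of_cosetDist_eq_zero [IsTopologicalGroup N] (Λ : Subgroup N) [DiscreteTopology Λ]
    {a b : N ⧸ Λ} (h : cosetDist Λ a b = 0) : a = b := by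
  obtain ⟨x, rfl⟩ := QuotientGroup.mk_surjective a
  obtain ⟨y, rfl⟩ := QuotientGroup.mk_surjective b
  have hcl : IsClosed {z : N | y⁻¹ * z ∈ Λ} :=
    (Subgroup.isClosed_of_discrete (H := Λ)).preimage (continuous_const_mul y⁻¹)
  have hx : x ∈ closure {z : N | y⁻¹ * z ∈ Λ} := by
    refine Metric.mem_closure_iff.2 fun ε hε => ?_
    obtain ⟨z, hz, hd⟩ := exists_of_cosetDist_lt Λ (h.trans_lt hε)
    exact ⟨z, QuotientGroup.eq.1 hz.symm, hd⟩
  rw [hcl.closure_eq] at hx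
  exact (QuotientGroup.eq.2 hx).symm

/-- The quotient pseudometric, before its topology is identified with the quotient topology. -/
abbrev cosetPseudoMetric (Λ : Subgroup N) : PseudoMetricSpace (N ⧸ Λ) where
  dist := cosetDist Λ
  dist_self a := by
    obtain ⟨x, rfl⟩ := QuotientGroup.mk_surjective a
    exact le_antisymm ((cosetDist_mk_le Λ x x).trans_eq (dist_self x)) (cosetDist_nonneg Λ _ _)
  dist_comm := cosetDist_comm Λ
  dist_triangle := cosetDist_triangle Λ

lemma cosetTopology_eq (Λ : Subgroup N) :
    QuotientGroup.instTopologicalSpace Λ =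
      (cosetPseudoMetric Λ).toUniformSpace.toTopologicalSpace := by
  let _ := cosetPseudoMetric Λ
  refine TopologicalSpace.ext_iff.2 fun U => ?_
  rw [← isQuotientMap_quotient_mk'.isOpen_preimage, Metric.isOpen_iff, Metric.isOpen_iff]
  constructor
  · intro h a ha
    obtain ⟨x, rfl⟩ := QuotientGroup.mk_surjective a
    obtain ⟨ε, hε, hb⟩ := h x ha
    refine ⟨ε, hε, fun b hb' => ?_⟩
    obtain ⟨y, rfl, hy⟩ := exists_of_cosetDist_lt Λ (Metric.mem_ball'.1 hb')
    exact hb (Metric.mem_ball'.2 hy)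
  · intro h x hx
    obtain ⟨ε, hε, hb⟩ := h _ hx
    refine ⟨ε, hε, fun y hy => hb ?_⟩
    exact Metric.mem_ball.2 ((cosetDist_mk_le Λ y x).trans_lt (Metric.mem_ball.1 hy))

/-- The metric on `N ⧸ Λ` induced by a right invariant metric on `N`.  Its topology is the quotient
topology. -/
instance quotientMetricSpace [IsTopologicalGroup N] (Λ : Subgroup N) [DiscreteTopology Λ] :
    MetricSpace (N ⧸ Λ) where
  toPseudoMetricSpace := (cosetPseudoMetric Λ).replaceTopology (cosetTopology_eq Λ)
  eq_of_dist_eq_zero := eq_of_cosetDist_eq_zero Λ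

end QuotientMetric

section Schmidt

variable {X : Type*} [MetricSpace X]

/-- `S` is `(α, β)`-winning: the first player has a strategy `σ` winning Schmidt's game.

The second player chooses `r > 0` and the balls `B_k = closedBall (b k) ((α * β) ^ k * r)`; the
first player answers `B_0, …, B_k` by `A_{k+1} = closedBall (a k) (α * ((α * β) ^ k * r))`, where
the centre `a k` is computed by `σ` from `r` and `b 0, …, b k`.  The second player has to respect
`B_{k+1} ⊆ A_{k+1}`, the first player `A_{k+1} ⊆ B_k`.  The strategy has to produce a legal answer
as long as the second player has played legally, and at the end of every play in which the second
player has always played legally the point common to all the balls has to lie in `S`. -/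
def IsWinning (α β : ℝ) (S : Set X) : Prop :=
  ∃ σ : ℝ → (k : ℕ) → (Fin (k + 1) → X) → X, ∀ r : ℝ, 0 < r → ∀ b : ℕ → X,
    let B : ℕ → Set X := fun k => Metric.closedBall (b k) ((α * β) ^ k * r)
    let A : ℕ → Set X := fun k =>
      Metric.closedBall (σ r k fun i => b i) (α * ((α * β) ^ k * r))
    (∀ m : ℕ, (∀ k < m, B (k + 1) ⊆ A k) → A m ⊆ B m) ∧
      ((∀ k : ℕ, B (k + 1) ⊆ A k) → ∃ x ∈ S, ⋂ k, A k = {x})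

/-- `S` is `α`-winning: it is `(α, β)`-winning for every `β ∈ (0, 1)`. -/
def IsAlphaWinning (α : ℝ) (S : Set X) : Prop :=
  ∀ β ∈ Set.Ioo (0 : ℝ) 1, IsWinning α β S

end Schmidt

/-- A nonempty set `S` is exceptional relative to a collection `C` of self-maps of `X` if for all
`f ∈ C` and `x ∈ S` the closure of the forward `f`-orbit of `x` has no `f`-periodic point. -/
def IsExceptional {X : Type*} [TopologicalSpace X] (C : Set (X → X)) (S : Set X) : Prop :=
  S.Nonempty ∧ ∀ f ∈ C, ∀ x ∈ S,
    ∀ y ∈ closure (Set.range fun k : ℕ => f^[k] x), y ∉ Function.periodicPts f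

section Endomorphisms

variable {N : Type*} [Group N] [TopologicalSpace N]

/-- The endomorphism of the abelianization `N ⧸ [N, N]` induced by an automorphism `R` of `N`. -/
def abelianizedMap (R : N ≃ₜ* N) : N ⧸ commutator N →* N ⧸ commutator N :=
  QuotientGroup.map (commutator N) (commutator N) (R : N →* N)
    (Subgroup.map_le_iff_le_comap.1 (by
      rw [commutator_def, Subgroup.map_commutator]
      exact Subgroup.commutator_mono le_top le_top))

/-- The automorphism of `N ⧸ [N, N]` induced by `R` is, in linear coordinates, a semisimple linear
map without complex eigenvalues of absolute value one.  For a simply connected nilpotent Lie group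
`N` the abelianization is a vector group, so that an isomorphism `φ` of topological groups with
some `ℝᵏ` exists; any two choices differ by a linear automorphism. -/
def IsHyperbolicSemisimple (R : N ≃ₜ* N) : Prop :=
  ∃ (k : ℕ) (φ : (N ⧸ commutator N) ≃ₜ* Multiplicative (Fin k → ℝ))
    (A : Module.End ℝ (Fin k → ℝ)),
    (∀ v : N ⧸ commutator N, (φ (abelianizedMap R v)).toAdd = A (φ v).toAdd) ∧
      A.IsSemisimple ∧
      ∀ z : ℂ, (A.charpoly.map (algebraMap ℝ ℂ)).IsRoot z → ‖z‖ ≠ 1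

/-- The surjective endomorphisms `ρ` of `N ⧸ Λ`, i.e. the surjective self-maps induced by
automorphisms `R` of `N` with `R(Λ) ⊆ Λ`, such that the linear map corresponding to the induced
endomorphism of the torus `N ⧸ [N, N]Λ` is semisimple with no eigenvalue on the unit circle. -/
def hyperbolicEndomorphisms (Λ : Subgroup N) : Set (N ⧸ Λ → N ⧸ Λ) :=
  {ρ | Function.Surjective ρ ∧ ∃ R : N ≃ₜ* N, (∀ x ∈ Λ, R x ∈ Λ) ∧
    (∀ x : N, ρ (x : N ⧸ Λ) = (R x : N ⧸ Λ)) ∧ IsHyperbolicSemisimple R}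

end Endomorphisms

end Nilmanifold

end

/-! Everything is read in the abelianization. Let `f : N → ℝᵏ` be the quotient map, `A` the linear
map induced by `R`, and `Γ = f(Λ)`. If the orbit closure of `aΛ` contains a periodic point `bΛ`,
then `p = f b` satisfies `Aᵐ p - p ∈ Γ` for some `m > 0`, and `Aʲ (f a)` comes arbitrarily close to
`p + Γ` for infinitely many `j`. So it suffices that for each such `p` the vectors `Aʲ (f a)`
finally keep some distance from `p + Γ` (`avoidingSet`). As `Γ` is countable and `Aᵐ - 1` is
injective, only countably many `p` occur. An induced map of the abelianization is determined by its
values in `Γ` on finitely many lattice elements, so there are countably many of these too. By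
`IsAlphaWinning.iInter` it remains to win for one `A` and one `p`.

For this, semisimplicity gives exact growth (`exists_dominant_functional`): if `z` is an eigenvalue
of largest modulus, then `‖Aʲ v‖ ≤ C ‖z‖ʲ ‖v‖`, and some nonzero functional `l` satisfies `‖z‖ʲ |l
v| ≤ C ‖Aʲ v‖`. Moreover `‖z‖ > 1`, since the powers of `A` cannot contract a nonzero vector of the
discrete group `Γ`. In a ball of radius at most a constant times `‖z‖⁻ʲ`, the points that `Aʲ ∘ f`
sends very close to `p + Γ` are all close to the same `p + γ`, hence have nearly the same value of
`l ∘ f`: each `j` forbids essentially one number. In a block of `t` rounds fewer than `2 ^ t`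
exponents `j` become relevant. By moving each time away from the larger part of the numbers still
forbidden, the first player is rid of all of them within `t` rounds. Such moves exist because `l ∘
f` almost attains its Lipschitz constant at every scale (`exists_lipschitz_constant_attained`).

That `Γ` is discrete is proved by induction on the nilpotency class (`discrete_in_abelianization`),
dividing by a closed central subgroup generated by commutators with lattice elements.

For the dimension (`le_dimH_of_isAlphaWinning`), a second player with `β` of order `1 / q` has `q ^
n` well separated answers in each round. Hence the winning set contains Cantor sets whose dimension
tends to `n` as `q` grows. -/

noncomputable section

namespace Nilmanifold

/-! ### Riemannian distance: bilipschitz charts and fine chains -/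

section RiemannianDistance

open Set Metric
open scoped NNReal ENNReal Topology

variable {E : Type*} [NormedAddCommGroup E] [NormedSpace ℝ E] {H : Type*} [TopologicalSpace H]
  {I : ModelWithCorners ℝ E H} {M : Type*} [MetricSpace M] [ChartedSpace H M] [IsManifold I 1 M]
  [Bundle.RiemannianBundle (fun x : M => TangentSpace I x)]
  [IsContinuousRiemannianBundle E (fun x : M => TangentSpace I x)] [IsRiemannianManifold I M]

attribute [local instance] normedAddCommGroupTangentSpaceVectorSpace
attribute [local instance] normedSpaceTangentSpaceVectorSpace

variable (I) in
-- The inverse chart maps the segment from `u` to `v` to a path whose length is at most `C` times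
-- the length of the segment, `C` bounding the derivative near the centre.
lemma exists_edist_le_extChartAt [I.Boundaryless] (x : M) :
    ∃ C > (0 : ℝ≥0), ∃ r > 0, ball (extChartAt I x x) r ⊆ (extChartAt I x).target ∧
      ∀ u ∈ ball (extChartAt I x x) r, ∀ v ∈ ball (extChartAt I x x) r,
        edist ((extChartAt I x).symm u) ((extChartAt I x).symm v) ≤ C * edist u v := by
  rcases eventually_enorm_mfderivWithin_symm_extChartAt_lt I x with ⟨C, C_pos, hC⟩
  refine ⟨C, C_pos, ?_⟩
  obtain ⟨r, r_pos, hr⟩ := mem_nhdsWithin_iff.1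
    (Filter.inter_mem (extChartAt_target_mem_nhdsWithin x) hC)
  have hrange : range I = univ := I.range_eq_univ
  have hr : ∀ u ∈ ball (extChartAt I x x) r, _ := fun u hu =>
    hr ⟨hu, by rw [hrange]; trivial⟩
  refine ⟨r, r_pos, fun u hu => (hr u hu).1, fun u hu v hv => ?_⟩
  let η := ContinuousAffineMap.lineMap (R := ℝ) u v
  set γ := (extChartAt I x).symm ∘ η
  have hη : ∀ t ∈ Icc (0 : ℝ) 1, η t ∈ ball (extChartAt I x x) r := by
    intro t ht
    refine (convex_ball _ _).segment_subset hu hv ?_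
    rw [segment_eq_image_lineMap]
    exact ⟨t, ht, by simp [η, ContinuousAffineMap.coe_lineMap_eq]⟩
  have η_smooth : CMDiff[Icc 0 1] 1 η := by
    apply ContMDiff.contMDiffOn
    rw [contMDiff_iff_contDiff]
    exact ContinuousAffineMap.contDiff _
  rw [IsRiemannianManifold.out (I := I)]
  have : Manifold.riemannianEDist I ((extChartAt I x).symm u)
      ((extChartAt I x).symm v) ≤ Manifold.pathELength I γ 0 1 := by
    apply Manifold.riemannianEDist_le_pathELength _ _ _ zero_le_one
    · exact (contMDiffOn_extChartAt_symm x).comp η_smooth fun t ht => (hr _ (hη t ht)).1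
    · simp [γ, η, ContinuousAffineMap.coe_lineMap_eq]
    · simp [γ, η, ContinuousAffineMap.coe_lineMap_eq]
  apply this.trans
  rw [← lintegral_fderiv_lineMap_eq_edist, Manifold.pathELength_eq_lintegral_mfderivWithin_Icc,
    ← MeasureTheory.lintegral_const_mul' _ _ ENNReal.coe_ne_top]
  apply MeasureTheory.setLIntegral_mono' measurableSet_Icc (fun t ht ↦ ?_)
  have : mfderiv[Icc 0 1] γ t =
      (mfderiv[range I] (extChartAt I x).symm (η t)) ∘L (mfderiv[Icc 0 1] η t) := by
    apply mfderivWithin_comp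
    · exact mdifferentiableWithinAt_extChartAt_symm (hr _ (hη t ht)).1
    · exact η_smooth.mdifferentiableOn one_ne_zero t ht
    · exact fun _ _ => by rw [hrange]; trivial
    · rw [uniqueMDiffWithinAt_iff_uniqueDiffWithinAt]
      exact uniqueDiffOn_Icc zero_lt_one t ht
  have : mfderiv[Icc 0 1] γ t 1 =
      (mfderiv[range I] (extChartAt I x).symm (η t)) (mfderiv[Icc 0 1] η t 1) :=
    DFunLike.congr_fun this 1
  rw [this]
  apply (ContinuousLinearMap.le_opENorm _ _).trans
  gcongr
  · exact (hr _ (hη t ht)).2.le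
  · simp only [mfderivWithin_eq_fderivWithin]
    exact le_of_eq rfl

variable (I) in
-- An almost shortest path from `y` to `z` stays where the derivative of the chart is bounded by
-- `C`, so its image is at most `C` times longer.
lemma exists_edist_extChartAt_le (x : M) :
    ∃ C > (0 : ℝ≥0), ∃ r > 0, ball x r ⊆ (extChartAt I x).source ∧
      ∀ y ∈ ball x r, ∀ z ∈ ball x r,
        edist (extChartAt I x y) (extChartAt I x z) ≤ C * edist y z := by
  rcases eventually_enorm_mfderiv_extChartAt_lt I x with ⟨C, C_pos, hC⟩
  refine ⟨C, C_pos, ?_⟩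
  obtain ⟨r, r_pos, hr⟩ := Metric.mem_nhds_iff.1
    (Filter.inter_mem hC (extChartAt_source_mem_nhds (I := I) x))
  have hsrc : ball x r ⊆ (extChartAt I x).source := fun y hy => (hr hy).2
  -- Points of the ball of radius `r / 3` are less than `2 * r / 3` apart, so a path between them of
  -- at most that length stays in `ball x r`. The distance being an infimum, `key` works with any
  -- `R` strictly above it.
  refine ⟨r / 3, by positivity, (ball_subset_ball (by linarith)).trans hsrc, fun y hy z hz => ?_⟩
  have key : ∀ R : ℝ≥0∞, R ≤ ENNReal.ofReal (2 * r / 3) → edist y z < R →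
      edist (extChartAt I x y) (extChartAt I x z) ≤ C * R := by
    intro R hR hyz
    rw [IsRiemannianManifold.out (I := I)] at hyz
    obtain ⟨γ, γ0, γ1, γ_smooth, hγ, -⟩ :=
      Manifold.exists_lt_locally_constant_of_riemannianEDist_lt hyz zero_lt_one
    have hmem : ∀ t ∈ Icc (0 : ℝ) 1, γ t ∈ ball x r := by
      intro t ht
      have h1 : edist y (γ t) < ENNReal.ofReal (2 * r / 3) := by
        rw [IsRiemannianManifold.out (I := I)]
        calc _ ≤ Manifold.pathELength I γ 0 t :=
              Manifold.riemannianEDist_le_pathELength γ_smooth.contMDiffOn γ0 rfl ht.1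
          _ ≤ Manifold.pathELength I γ 0 1 := Manifold.pathELength_mono le_rfl ht.2
          _ < R := hγ
          _ ≤ _ := hR
      rw [edist_dist, ENNReal.ofReal_lt_ofReal_iff (by positivity)] at h1
      have := dist_triangle (γ t) y x
      rw [dist_comm (γ t) y] at this
      rw [mem_ball] at hy ⊢
      linarith
    let γ' := extChartAt I x ∘ γ
    have uc' : ∀ t ∈ Icc (0 : ℝ) 1, γ t ∈ (chartAt H x).source :=
      fun t ht => by simpa [extChartAt_source I x] using hsrc (hmem t ht)
    have hC' : CMDiff[Icc 0 1] 1 γ' :=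
      contMDiffOn_extChartAt.comp (I' := I)
        (t := (chartAt H x).source) γ_smooth.contMDiffOn uc'
    calc edist (extChartAt I x y) (extChartAt I x z)
      _ = ‖γ' 1 - γ' 0‖ₑ := by
        rw [edist_comm, edist_eq_enorm_sub]; simp only [γ', Function.comp_apply, γ0, γ1]
      _ ≤ ∫⁻ t' in Icc 0 1, ‖derivWithin γ' (Icc 0 1) t'‖ₑ := by
        apply enorm_sub_le_lintegral_derivWithin_Icc_of_contDiffOn_Icc _ zero_le_one
        rwa [← contMDiffOn_iff_contDiffOn]
      _ = ∫⁻ t' in Icc 0 1, ‖mfderiv[Icc 0 1] γ' t' 1‖ₑ := by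
        simp_rw [← fderivWithin_derivWithin, mfderivWithin_eq_fderivWithin]
        rfl
      _ ≤ ∫⁻ t' in Icc 0 1, C * ‖mfderiv[Icc 0 1] γ t' 1‖ₑ := by
        apply MeasureTheory.setLIntegral_mono' measurableSet_Icc (fun t' ht' ↦ ?_)
        have : mfderiv[Icc 0 1] γ' t' =
            (mfderiv% (extChartAt I x) (γ t')) ∘L (mfderiv[Icc 0 1] γ t') := by
          apply mfderiv_comp_mfderivWithin
          · exact mdifferentiableAt_extChartAt (uc' _ ht')
          · exact (γ_smooth.mdifferentiable one_ne_zero).mdifferentiableOn _ ht'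
          · rw [uniqueMDiffWithinAt_iff_uniqueDiffWithinAt]
            exact uniqueDiffOn_Icc zero_lt_one _ ht'
        have : mfderiv[Icc 0 1] γ' t' 1 =
            (mfderiv% (extChartAt I x) (γ t')) (mfderiv[Icc 0 1] γ t' 1) :=
          DFunLike.congr_fun this 1
        rw [this]
        apply (ContinuousLinearMap.le_opENorm _ _).trans
        gcongr
        exact (hr (hmem _ ht')).1.le
      _ = C * Manifold.pathELength I γ 0 1 := by
        rw [MeasureTheory.lintegral_const_mul' _ _ ENNReal.coe_ne_top,
          Manifold.pathELength_eq_lintegral_mfderivWithin_Icc]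
      _ ≤ C * R := by gcongr
  have hlt : edist y z < ENNReal.ofReal (2 * r / 3) := by
    rw [edist_dist, ENNReal.ofReal_lt_ofReal_iff (by positivity)]
    have := dist_triangle_right y z x
    rw [mem_ball] at hy hz
    linarith
  refine le_of_forall_gt fun c hc => ?_
  have hC0 : (C : ℝ≥0∞) ≠ 0 := by exact_mod_cast C_pos.ne'
  have h1 : edist y z < min (c / C) (ENNReal.ofReal (2 * r / 3)) := by
    refine lt_min ?_ hlt
    rw [ENNReal.lt_div_iff_mul_lt (Or.inl hC0) (Or.inl ENNReal.coe_ne_top), mul_comm]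
    exact hc
  obtain ⟨R, hR1, hR2⟩ := exists_between h1
  refine (key R (hR2.le.trans (min_le_right _ _)) hR1).trans_lt ?_
  have := hR2.trans_le (min_le_left _ _)
  rw [ENNReal.lt_div_iff_mul_lt (Or.inl hC0) (Or.inl ENNReal.coe_ne_top), mul_comm] at this
  exact this

/-- Cut a path of length less than `2 * dist x y` into equal parameter intervals: uniform continuity
makes the steps small, and each step is at most the length of its piece. -/
lemma exists_chain {E : Type*} [NormedAddCommGroup E] [NormedSpace ℝ E] {H : Type*}
    [TopologicalSpace H] (I : ModelWithCorners ℝ E H) {M : Type*} [MetricSpace M]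
    [ChartedSpace H M] [Bundle.RiemannianBundle (fun x : M => TangentSpace I x)]
    [IsRiemannianManifold I M] (x y : M) (hxy : x ≠ y) (η : ℝ) (hη : 0 < η) :
    ∃ (q : ℕ) (p : ℕ → M), p 0 = x ∧ p q = y ∧ (∀ i < q, dist (p i) (p (i + 1)) ≤ η) ∧
      ∑ i ∈ Finset.range q, dist (p i) (p (i + 1)) ≤ 2 * dist x y := by
  have hd : 0 < dist x y := dist_pos.2 hxy
  have hlt : Manifold.riemannianEDist I x y < ENNReal.ofReal (2 * dist x y) := by
    rw [← IsRiemannianManifold.out (I := I), edist_dist,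
      ENNReal.ofReal_lt_ofReal_iff (by positivity)]
    linarith
  obtain ⟨γ, γ0, γ1, γ_smooth, hγ, -⟩ :=
    Manifold.exists_lt_locally_constant_of_riemannianEDist_lt hlt zero_lt_one
  have huc := isCompact_Icc.uniformContinuousOn_of_continuous
    (γ_smooth.continuous.continuousOn (s := Icc (0 : ℝ) 1))
  obtain ⟨δ, hδ, hδ'⟩ := Metric.uniformContinuousOn_iff.1 huc η hη
  obtain ⟨q, hq⟩ := exists_nat_gt (1 / δ)
  have hq0 : (0 : ℝ) < q := lt_trans (by positivity) hq
  have hmem : ∀ i ≤ q, (i / q : ℝ) ∈ Icc (0 : ℝ) 1 := fun i hi =>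
    ⟨by positivity, (div_le_one hq0).2 (by exact_mod_cast hi)⟩
  refine ⟨q, fun i => γ (i / q), by simp [γ0], by simp [hq0.ne', γ1], fun i hi => ?_, ?_⟩
  · refine (hδ' _ (hmem i hi.le) _ (hmem (i + 1) hi) ?_).le
    rw [Real.dist_eq, ← sub_div, abs_div]
    push_cast
    rw [sub_add_cancel_left, abs_neg, abs_one, abs_of_pos hq0, div_lt_iff₀ hq0, mul_comm]
    rwa [div_lt_iff₀ hδ] at hq
  · have hsum : ∀ m ≤ q, ∑ i ∈ Finset.range m,
        ENNReal.ofReal (dist (γ (i / q)) (γ ((i + 1 : ℕ) / q)))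
          ≤ Manifold.pathELength I γ 0 (m / q) := by
      intro m
      induction m with
      | zero => simp
      | succ m ih =>
        intro hm
        have hle : (m / q : ℝ) ≤ (m + 1 : ℕ) / q := by gcongr; simp
        rw [Finset.sum_range_succ, ← Manifold.pathELength_add (by positivity : (0 : ℝ) ≤ m / q) hle]
        gcongr
        · exact ih (by omega)
        · rw [← edist_dist, IsRiemannianManifold.out (I := I)]
          exact Manifold.riemannianEDist_le_pathELength γ_smooth.contMDiffOn rfl rfl hle
    have h := hsum q le_rfl
    rw [div_self hq0.ne', ← ENNReal.ofReal_sum_of_nonneg (fun _ _ => dist_nonneg)] at h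
    exact (ENNReal.ofReal_le_ofReal_iff (by positivity)).1 (h.trans hγ.le)

end RiemannianDistance

/-! ### Discreteness of the lattice in the abelianization -/

section Discreteness

open Set Filter
open scoped Topology Pointwise commutatorElement IsMulCommutative

/-- The `n`-th term of the lower central series of the whole group. -/
abbrev lcs (G : Type*) [Group G] (n : ℕ) : Subgroup G := (⊤ : Subgroup G).lowerCentralSeries n

/-- The abelianization of `G` is divisible, and the elements of `G` with a power in the subgroup
generated by `s` and the commutators are dense. -/
def HasDenseRoots {G : Type*} [Group G] [TopologicalSpace G] (s : Set G) : Prop :=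
  (∀ (g : G) (q : ℕ), 0 < q → ∃ h : G, ∃ c ∈ commutator G, g = h ^ q * c) ∧
    Dense {x : G | ∃ q : ℕ, 0 < q ∧ x ^ q ∈ Subgroup.closure s ⊔ commutator G}

lemma commutator_map_le {G G' : Type*} [Group G] [Group G'] (f : G →* G') :
    (commutator G).map f ≤ commutator G' := by
  rw [commutator_def, Subgroup.map_commutator]
  exact Subgroup.commutator_mono le_top le_top

lemma HasDenseRoots.image {G G' : Type*} [Group G] [TopologicalSpace G] [Group G']
    [TopologicalSpace G'] {s : Set G} (h : HasDenseRoots s) (f : G →* G') (hf : Continuous f)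
    (hs : Function.Surjective f) : HasDenseRoots (f '' s) := by
  refine ⟨fun g q hq => ?_, ?_⟩
  · obtain ⟨g, rfl⟩ := hs g
    obtain ⟨k, c, hc, rfl⟩ := h.1 g q hq
    exact ⟨f k, f c, commutator_map_le f ⟨c, hc, rfl⟩, by simp⟩
  · refine (hs.denseRange.dense_image hf h.2).mono ?_
    rintro _ ⟨x, ⟨q, hq, hx⟩, rfl⟩
    refine ⟨q, hq, ?_⟩
    rw [← map_pow, ← MonoidHom.map_closure]
    have := Subgroup.mem_map_of_mem f hx
    rw [Subgroup.map_sup] at this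
    exact sup_le_sup_left (commutator_map_le f) _ this

/-- If `x ^ q` lies in the kernel of `b` and `g = k ^ q * c` with `c` a product of commutators, then
`b x g = b x (k ^ q) = b (x ^ q) k = 1`. Such `x` are dense. -/
lemma HasDenseRoots.bihom_eq_one {G A : Type*} [Group G] [TopologicalSpace G] [CommGroup A]
    [TopologicalSpace A] [T2Space A] {s : Set G} (h : HasDenseRoots s) (b : G →* G →* A)
    (hc : ∀ g, Continuous fun x => b x g) (hs : ∀ g ∈ s, b g = 1) (x g : G) : b x g = 1 := by
  have hker : Subgroup.closure s ⊔ commutator G ≤ b.ker :=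
    sup_le ((Subgroup.closure_le _).2 hs) (Abelianization.commutator_subset_ker b)
  have hcl : IsClosed {x : G | b x g = 1} := isClosed_eq (hc g) continuous_const
  have hd : {x : G | ∃ q : ℕ, 0 < q ∧ x ^ q ∈ Subgroup.closure s ⊔ commutator G} ⊆
      {x : G | b x g = 1} := by
    rintro x ⟨q, hq, hx⟩
    obtain ⟨k, c, hc, rfl⟩ := h.1 g q hq
    have h1 : b x c = 1 := Abelianization.commutator_subset_ker (b x) hc
    have h2 : b (x ^ q) k = 1 := by rw [MonoidHom.mem_ker.1 (hker hx)]; rfl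
    rw [mem_ofPred_eq, map_mul, h1, mul_one, map_pow, ← h2, map_pow]
    rfl
  exact hcl.closure_subset_iff.2 hd (h.2 x)

section Algebra

variable {G : Type*} [Group G]

lemma commutatorElement_mem_lcs {m : ℕ} {u : G} (hu : u ∈ lcs G m) (x : G) :
    ⁅u, x⁆ ∈ lcs G (m + 1) :=
  Subgroup.commutator_mem_commutator hu (Subgroup.mem_top x)

lemma lcs_le_center {m : ℕ} (h : lcs G (m + 1) = ⊥) : lcs G m ≤ Subgroup.center G := by
  intro z hz
  rw [Subgroup.mem_center_iff]
  intro g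
  have := commutatorElement_mem_lcs hz g
  rw [h, Subgroup.mem_bot, commutatorElement_eq_one_iff_mul_comm] at this
  exact this.symm

lemma lcs_succ_eq_bot {m : ℕ} (h : lcs G m ≤ Subgroup.center G) : lcs G (m + 1) = ⊥ := by
  rw [eq_bot_iff]
  refine Subgroup.commutator_le.2 fun z hz g _ => ?_
  rw [Subgroup.mem_bot, commutatorElement_eq_one_iff_mul_comm]
  exact (Subgroup.mem_center_iff.1 (h hz) g).symm

lemma commutator_mul_right_of_central {y g k : G} (h : ⁅y, k⁆ ∈ Subgroup.center G) :
    ⁅y, g * k⁆ = ⁅y, g⁆ * ⁅y, k⁆ := by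
  rw [commutatorElement_mul_right_eq_mul_conj, mul_assoc, mul_assoc,
    ← Subgroup.mem_center_iff.1 h g⁻¹]
  simp

lemma commutator_mul_left_of_central {y z g : G} (h : ⁅z, g⁆ ∈ Subgroup.center G) :
    ⁅y * z, g⁆ = ⁅y, g⁆ * ⁅z, g⁆ := by
  rw [commutatorElement_mul_left_eq_conj_mul, Subgroup.mem_center_iff.1 h y, mul_assoc, mul_assoc,
    Subgroup.mem_center_iff.1 h]
  simp

lemma commutator_mem_center_left {z : G} (h : z ∈ Subgroup.center G) (g : G) : ⁅z, g⁆ = 1 := by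
  rw [commutatorElement_eq_one_iff_mul_comm, Subgroup.mem_center_iff.1 h g]

/-- For `u` three steps above the end of the lower central series, `(x, g) ↦ ⁅⁅u, x⁆, g⁆` is
bimultiplicative. -/
def doubleCommutatorHom {m : ℕ} (h : lcs G (m + 3) = ⊥) {u : G} (hu : u ∈ lcs G m) :
    G →* G →* Subgroup.center G :=
  have hc : ∀ y ∈ lcs G (m + 1), ∀ g, ⁅y, g⁆ ∈ Subgroup.center G := fun y hy g =>
    lcs_le_center h (commutatorElement_mem_lcs hy g)
  have hux : ∀ x, ⁅u, x⁆ ∈ lcs G (m + 1) := commutatorElement_mem_lcs hu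
  MonoidHom.mk' (fun x => MonoidHom.mk' (fun g => ⟨⁅⁅u, x⁆, g⁆, hc _ (hux x) g⟩)
    fun g k => Subtype.ext (commutator_mul_right_of_central (hc _ (hux x) k)))
    fun x y => by
      ext g
      change ⁅⁅u, x * y⁆, g⁆ = ⁅⁅u, x⁆, g⁆ * ⁅⁅u, y⁆, g⁆
      have hz : ⁅x, ⁅u, y⁆⁆ ∈ Subgroup.center G := by
        rw [← commutatorElement_inv]
        exact inv_mem (hc _ (hux y) x)
      -- The middle factor is central, so it disappears from the outer commutator.
      have : ⁅u, x * y⁆ = ⁅u, x⁆ * (⁅x, ⁅u, y⁆⁆ * ⁅u, y⁆) := by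
        simp [commutatorElement_def, mul_assoc]
      rw [this, commutator_mul_left_of_central (z := ⁅x, ⁅u, y⁆⁆ * ⁅u, y⁆),
        commutator_mul_left_of_central (hc _ (hux y) g), commutator_mem_center_left hz,
        one_mul]
      rw [commutator_mul_left_of_central (hc _ (hux y) g), commutator_mem_center_left hz,
        one_mul]
      exact hc _ (hux y) g

/-- In a group with `lcs G 2 = ⊥` the commutator is bimultiplicative. -/
def commutatorHom (h : lcs G 2 = ⊥) : G →* G →* Subgroup.center G :=
  have hc : ∀ y g : G, ⁅y, g⁆ ∈ Subgroup.center G := fun y g =>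
    lcs_le_center h (commutatorElement_mem_lcs (Subgroup.mem_top y) g)
  MonoidHom.mk' (fun x => MonoidHom.mk' (fun g => ⟨⁅x, g⁆, hc x g⟩)
    fun g k => Subtype.ext (commutator_mul_right_of_central (hc x k)))
    fun x y => by ext g; exact commutator_mul_left_of_central (hc y g)

/-- Left-normed commutators of `m + 1` elements of `s`. -/
def iteratedCommutators (s : Set G) : ℕ → Set G
  | 0 => s
  | m + 1 => Set.image2 (fun y g => ⁅y, g⁆) (iteratedCommutators s m) s

lemma iteratedCommutators_subset_lcs (s : Set G) (m : ℕ) :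
    iteratedCommutators s m ⊆ lcs G m := by
  induction m with
  | zero => exact fun x _ => Subgroup.mem_top x
  | succ m ih =>
    rintro _ ⟨y, hy, g, -, rfl⟩
    exact commutatorElement_mem_lcs (ih hy) g

lemma iteratedCommutators_subset {s : Set G} {Λ : Subgroup G} (hs : s ⊆ Λ) (m : ℕ) :
    iteratedCommutators s m ⊆ Λ := by
  induction m with
  | zero => exact hs
  | succ m ih =>
    rintro _ ⟨y, hy, g, hg, rfl⟩
    change y * g * y⁻¹ * g⁻¹ ∈ Λ
    exact mul_mem (mul_mem (mul_mem (ih hy) (hs hg)) (inv_mem (ih hy))) (inv_mem (hs hg))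

lemma iteratedCommutators_finite {s : Set G} (hs : s.Finite) (m : ℕ) :
    (iteratedCommutators s m).Finite := by
  induction m with
  | zero => exact hs
  | succ m ih => exact ih.image2 _ hs

lemma iteratedCommutators_image {G' : Type*} [Group G'] (f : G →* G') (s : Set G) (m : ℕ) :
    iteratedCommutators (f '' s) m = f '' iteratedCommutators s m := by
  induction m with
  | zero => rfl
  | succ m ih =>
    rw [iteratedCommutators, iteratedCommutators, ih, Set.image_image2, Set.image2_image_left,
      Set.image2_image_right]
    simp

lemma map_lcs {G' : Type*} [Group G'] {f : G →* G'} (hf : Function.Surjective f) (m : ℕ) :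
    (lcs G m).map f = lcs G' m := by
  rw [lcs, Subgroup.map_lowerCentralSeries, Subgroup.map_top_of_surjective f hf]

/-- The subgroup generated by the commutators with the elements of `F`. -/
def commutatorsWith (F : Set G) : Subgroup G :=
  Subgroup.closure {z | ∃ x : G, ∃ y ∈ F, z = ⁅x, y⁆}

lemma commutatorsWith_le_lcs {F : Set G} {m : ℕ} (hF : F ⊆ lcs G m) :
    commutatorsWith F ≤ lcs G (m + 1) := by
  refine (Subgroup.closure_le _).2 ?_
  rintro _ ⟨x, y, hy, rfl⟩
  rw [SetLike.mem_coe, ← commutatorElement_inv]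
  exact inv_mem (commutatorElement_mem_lcs (hF hy) x)

end Algebra

variable {G : Type*} [Group G] [TopologicalSpace G] [IsTopologicalGroup G]

lemma continuous_commutatorElement_left (g : G) : Continuous fun x : G => ⁅x, g⁆ := by
  simp only [commutatorElement_def]; fun_prop

lemma isClosed_center [T2Space G] : IsClosed (Subgroup.center G : Set G) := by
  rw [Subgroup.coe_center, ← Set.centralizer_univ]
  exact Set.isClosed_centralizer _

lemma isClosed_of_subset_discrete [T2Space G] {Λ : Subgroup G}
    (hΛ : ∃ U ∈ 𝓝 (1 : G), ∀ x ∈ Λ, x ∈ U → x = 1) {t : Set G} (ht : t ⊆ Λ) : IsClosed t := by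
  obtain ⟨U, hU, h⟩ := hΛ
  have : DiscreteTopology Λ := by
    refine discreteTopology_of_isOpen_singleton_one ?_
    rw [isOpen_singleton_iff_nhds_eq_pure, nhds_subtype_eq_comap]
    refine le_antisymm ?_ (by rw [← nhds_subtype_eq_comap]; exact pure_le_nhds _)
    rw [le_pure_iff]
    exact ⟨U, hU, fun x hx => Subtype.ext (h x x.2 hx)⟩
  have hcl : IsClosed (Λ : Set G) := Subgroup.isClosed_of_discrete
  have := hcl.isClosedEmbedding_subtypeVal.isClosedMap (Subtype.val ⁻¹' t) (isClosed_discrete _)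
  rwa [Subtype.image_preimage_coe, inter_eq_right.2 ht] at this

/-- The bimultiplicative map `(x, g) ↦ ⁅⁅u, x⁆, g⁆` is trivial for `x ∈ s`, hence everywhere. -/
lemma commutator_mem_center_of_dense {s : Set G} [T2Space G] (hs : HasDenseRoots s) {m : ℕ}
    (h : lcs G (m + 3) = ⊥) {u : G} (hu : u ∈ lcs G m)
    (hus : ∀ g ∈ s, ⁅u, g⁆ ∈ Subgroup.center G) (x : G) : ⁅u, x⁆ ∈ Subgroup.center G := by
  rw [Subgroup.mem_center_iff]
  intro g
  have hc : ∀ g, Continuous fun x => doubleCommutatorHom h hu x g := fun g => by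
    refine Continuous.subtype_mk ?_ _
    simp only [commutatorElement_def]
    fun_prop
  have := hs.bihom_eq_one (doubleCommutatorHom h hu) hc
    (fun k hk => by
      ext y
      exact commutator_mem_center_left (hus k hk) y) x g
  have h2 : ⁅⁅u, x⁆, g⁆ = 1 := congrArg Subtype.val this
  rw [commutatorElement_eq_one_iff_mul_comm] at h2
  exact h2.symm

/-- The class of `G` can be tested on commutators of elements of `s` alone. Induction through `G ⧸
center G`: if the commutators of `u` with `s` are central in `G`, then so are those with all of `G`,
which makes the image of `u` central. -/
theorem lcs_eq_bot_of_iteratedCommutators.{u} (m : ℕ) : ∀ (G : Type u) [Group G]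
    [TopologicalSpace G] [IsTopologicalGroup G] [T2Space G] {s : Set G}, HasDenseRoots s →
    lcs G (m + 2) = ⊥ → (∀ y ∈ iteratedCommutators s m, y ∈ Subgroup.center G) →
    lcs G (m + 1) = ⊥ := by
  induction m with
  | zero =>
    intro G _ _ _ _ s hs h hsc
    refine lcs_succ_eq_bot fun x _ => ?_
    rw [Subgroup.mem_center_iff]
    intro g
    have hc : ∀ g, Continuous fun x => commutatorHom h x g := fun g =>
      Continuous.subtype_mk (continuous_commutatorElement_left g) _
    have := hs.bihom_eq_one (commutatorHom h) hc
      (fun k hk => by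
        ext y
        exact commutator_mem_center_left (hsc k hk) y) x g
    have h2 : ⁅x, g⁆ = 1 := congrArg Subtype.val this
    rw [commutatorElement_eq_one_iff_mul_comm] at h2
    exact h2.symm
  | succ m ih =>
    intro G _ _ _ _ s hs h hsc
    have hcl : IsClosed (Subgroup.center G : Set G) := isClosed_center
    have hsurj := QuotientGroup.mk'_surjective (Subgroup.center G)
    have h1 : lcs (G ⧸ Subgroup.center G) (m + 1) = ⊥ := by
      refine ih _ (hs.image (QuotientGroup.mk' (Subgroup.center G)) continuous_quot_mk hsurj)
        ?_ ?_
      · rw [← map_lcs hsurj, Subgroup.map_eq_bot_iff, QuotientGroup.ker_mk']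
        exact lcs_le_center h
      · rw [iteratedCommutators_image]
        rintro _ ⟨u, hu, rfl⟩
        rw [Subgroup.mem_center_iff]
        intro g
        obtain ⟨g, rfl⟩ := hsurj g
        have := commutator_mem_center_of_dense hs h (iteratedCommutators_subset_lcs s m hu)
          (fun k hk => hsc _ ⟨u, hu, k, hk, rfl⟩) g
        rw [← QuotientGroup.ker_mk' (Subgroup.center G), MonoidHom.mem_ker,
          map_commutatorElement, commutatorElement_eq_one_iff_mul_comm] at this
        exact this.symm
    rw [← map_lcs hsurj, Subgroup.map_eq_bot_iff, QuotientGroup.ker_mk'] at h1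
    exact lcs_succ_eq_bot h1

/-- For `y ∈ F` the map `x ↦ ⁅x, y⁆` is a homomorphism into the center; it maps `Λ` into `Λ` and the
compact set `C` to a compact set. The subgroup is the product of the images of these maps, so `Λ` is
cocompact in it. -/
lemma commutatorsWith_cocompact {Λ : Subgroup G} {C : Set G} (hC : IsCompact C)
    (hCΛ : ∀ g : G, ∃ c ∈ C, ∃ l ∈ Λ, g = c * l) {F : Set G} (hF : F.Finite) (hFΛ : F ⊆ Λ)
    (hcen : ∀ x : G, ∀ y ∈ F, ⁅x, y⁆ ∈ Subgroup.center G) :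
    ∃ K : Set G, IsCompact K ∧ K ⊆ commutatorsWith F ∧
      ∀ h ∈ commutatorsWith F, ∃ k ∈ K, ∃ l ∈ Λ, h = k * l := by
  induction F, hF using Set.Finite.induction_on with
  | empty =>
    refine ⟨{1}, isCompact_singleton, by simp [one_mem], fun h hh => ⟨1, rfl, 1, one_mem _, ?_⟩⟩
    simpa [commutatorsWith] using hh
  | @insert y F hyF hF ih =>
    obtain ⟨K, hK, hKH, hcov⟩ := ih ((subset_insert _ _).trans hFΛ)
      (fun x z hz => hcen x z (mem_insert_of_mem _ hz))
    have hyc : ∀ x, ⁅x, y⁆ ∈ Subgroup.center G := fun x => hcen x y (mem_insert _ _)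
    let φ : G →* G := MonoidHom.mk' (fun x => ⁅x, y⁆)
      fun x z => commutator_mul_left_of_central (hyc z)
    have hφ : ∀ x, φ x ∈ Subgroup.center G := hyc
    have hyΛ : y ∈ Λ := hFΛ (mem_insert _ _)
    have hle : commutatorsWith F ≤ commutatorsWith (insert y F) :=
      Subgroup.closure_mono fun z ⟨x, w, hw, h⟩ => ⟨x, w, mem_insert_of_mem _ hw, h⟩
    have hsup : commutatorsWith (insert y F) ≤ φ.range ⊔ commutatorsWith F := by
      refine (Subgroup.closure_le _).2 ?_
      rintro _ ⟨x, w, hw, rfl⟩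
      rcases mem_insert_iff.1 hw with rfl | hw
      · exact Subgroup.mem_sup_left ⟨x, rfl⟩
      · exact Subgroup.mem_sup_right (Subgroup.subset_closure ⟨x, w, hw, rfl⟩)
    have hnorm : φ.range.Normal := ⟨by
      rintro _ ⟨x, rfl⟩ g
      refine ⟨x, ?_⟩
      rw [Subgroup.mem_center_iff.1 (hφ x) g, mul_inv_cancel_right]⟩
    refine ⟨φ '' C * K, (hC.image (continuous_commutatorElement_left y)).mul hK, ?_, ?_⟩
    · rintro _ ⟨_, ⟨c, -, rfl⟩, k, hk, rfl⟩
      exact mul_mem (Subgroup.subset_closure ⟨c, y, mem_insert _ _, rfl⟩) (hle (hKH hk))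
    · intro h hh
      obtain ⟨_, ⟨x, rfl⟩, b, hb, rfl⟩ := Subgroup.mem_sup_of_normal_left.1 (hsup hh)
      obtain ⟨k, hk, l, hl, rfl⟩ := hcov b hb
      obtain ⟨c, hc, l', hl', rfl⟩ := hCΛ x
      refine ⟨φ c * k, mul_mem_mul ⟨c, hc, rfl⟩ hk, φ l' * l, mul_mem ?_ hl, ?_⟩
      · change l' * y * l'⁻¹ * y⁻¹ ∈ Λ
        exact mul_mem (mul_mem (mul_mem hl' hyΛ) (inv_mem hl')) (inv_mem hyΛ)
      · rw [map_mul, mul_assoc, mul_assoc, ← mul_assoc (φ l') k l,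
          ← Subgroup.mem_center_iff.1 (hφ l') k, mul_assoc]

/-- If `Λ` is a discrete cocompact subgroup of a nilpotent topological group `G` with enough roots,
then the image of `Λ` in the abelianization of `G` is discrete. -/
theorem discrete_in_abelianization.{u} (m : ℕ) : ∀ (G : Type u) [Group G]
    [TopologicalSpace G] [IsTopologicalGroup G] [T2Space G] (Λ : Subgroup G) {s C : Set G},
    HasDenseRoots s → s.Finite → s ⊆ Λ → IsCompact C →
    (∀ g : G, ∃ c ∈ C, ∃ l ∈ Λ, g = c * l) → (∃ U ∈ 𝓝 (1 : G), ∀ x ∈ Λ, x ∈ U → x = 1) →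
    lcs G (m + 1) = ⊥ →
    ∃ U ∈ 𝓝 (1 : G), ∀ u ∈ U, ∀ c ∈ commutator G, u * c ∈ Λ → u * c ∈ commutator G := by
  induction m with
  | zero =>
    intro G _ _ _ _ Λ s C _ _ _ _ _ ⟨U, hU, hd⟩ h
    refine ⟨U, hU, fun u hu c hc hΛ => ?_⟩
    have hbot : commutator G = ⊥ := h
    rw [hbot, Subgroup.mem_bot] at hc
    subst hc
    rw [mul_one] at hΛ ⊢
    rw [hd u hΛ hu]
    exact one_mem _
  | succ m ih =>
    intro G _ _ _ _ Λ s C hs hsf hsΛ hC hCΛ hd h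
    -- Dividing by `H`, which is central, makes the elements of `F` central and so lowers the class
    -- by one. It remains to see that `H` is closed and that the image of `Λ` in `G ⧸ H` is still
    -- discrete.
    set F := iteratedCommutators s m with hF
    set H := commutatorsWith F with hH
    have hFl : F ⊆ lcs G m := iteratedCommutators_subset_lcs s m
    have hHl : H ≤ lcs G (m + 1) := commutatorsWith_le_lcs hFl
    have hHc : H ≤ Subgroup.center G := hHl.trans (lcs_le_center h)
    have hcen : ∀ x : G, ∀ y ∈ F, ⁅x, y⁆ ∈ Subgroup.center G := fun x y hy =>
      hHc (Subgroup.subset_closure ⟨x, y, hy, rfl⟩)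
    obtain ⟨K, hK, hKH, hcov⟩ := commutatorsWith_cocompact hC hCΛ
      (iteratedCommutators_finite hsf m) (iteratedCommutators_subset hsΛ m) hcen
    have hnorm : H.Normal := ⟨fun x hx g => by
      rwa [Subgroup.mem_center_iff.1 (hHc hx) g, mul_inv_cancel_right]⟩
    -- This displays `H` as compact times closed.
    have hHeq : (H : Set G) = K * ((Λ : Set G) ∩ H) := by
      refine Subset.antisymm (fun x hx => ?_) ?_
      · obtain ⟨k, hk, l, hl, rfl⟩ := hcov x hx
        exact mul_mem_mul hk ⟨hl, (mul_mem_cancel_left (hKH hk)).1 hx⟩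
      · rintro _ ⟨k, hk, l, hl, rfl⟩
        exact mul_mem (hKH hk) hl.2
    have hcl : IsClosed (H : Set G) := by
      rw [hHeq]
      exact (isClosed_of_subset_discrete hd inter_subset_left).mul_left_of_isCompact hK
    have hsurj := QuotientGroup.mk'_surjective H
    have hcont : Continuous (QuotientGroup.mk' H) := continuous_quot_mk
    have hroots := hs.image (QuotientGroup.mk' H) hcont hsurj
    have h1 : lcs (G ⧸ H) (m + 1) = ⊥ := by
      refine lcs_eq_bot_of_iteratedCommutators m _ hroots ?_ ?_
      · rw [← map_lcs hsurj, h, Subgroup.map_bot]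
      · rw [iteratedCommutators_image]
        rintro _ ⟨y, hy, rfl⟩
        rw [Subgroup.mem_center_iff]
        intro g
        obtain ⟨g, rfl⟩ := hsurj g
        have : ⁅g, y⁆ ∈ H := Subgroup.subset_closure ⟨g, y, hy, rfl⟩
        rwa [← QuotientGroup.ker_mk' H, MonoidHom.mem_ker,
          map_commutatorElement, commutatorElement_eq_one_iff_mul_comm] at this
    -- A neighbourhood `V` of `1` with `V * K` disjoint from `Λ \ H` works: if `l ∈ Λ` lies in `v *
    -- H`, then `v * k ∈ Λ` for some `k ∈ K`, hence `v * k ∈ H` and finally `l ∈ H`.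
    have hdisc : ∃ U ∈ 𝓝 (1 : G ⧸ H), ∀ x ∈ Λ.map (QuotientGroup.mk' H), x ∈ U → x = 1 := by
      have hopen : IsOpen ((Λ : Set G) \ H)ᶜ :=
        (isClosed_of_subset_discrete hd sdiff_subset).isOpen_compl
      obtain ⟨V, hV, hVK⟩ := compact_open_separated_mul_left hK hopen
        (fun k hk hk' => hk'.2 (hKH hk))
      refine ⟨QuotientGroup.mk' H '' V, ?_, ?_⟩
      · have := (QuotientGroup.isOpenMap_coe (N := H)).image_mem_nhds hV
        exact this
      · rintro _ ⟨l, hl, rfl⟩ ⟨v, hv, hvl⟩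
        have hvl' : v⁻¹ * l ∈ H := QuotientGroup.eq.1 hvl
        obtain ⟨k, hk, l', hl', hkl⟩ := hcov _ hvl'
        have e1 : v * k = l * l'⁻¹ := by
          rw [eq_mul_inv_iff_mul_eq, mul_assoc, ← hkl, mul_inv_cancel_left]
        have h3 : v * k ∈ H := by
          by_contra hcon
          exact hVK (mul_mem_mul hv hk) ⟨e1 ▸ mul_mem hl (inv_mem hl'), hcon⟩
        have h4 : v ∈ H := (mul_mem_cancel_right (hKH hk)).1 h3
        rw [← MonoidHom.mem_ker, QuotientGroup.ker_mk']
        exact (mul_mem_cancel_left (inv_mem h4)).1 hvl'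
    obtain ⟨U, hU, hUc⟩ := ih (G ⧸ H) (Λ.map (QuotientGroup.mk' H)) hroots (hsf.image _)
      (by rintro _ ⟨x, hx, rfl⟩; exact ⟨x, hsΛ hx, rfl⟩) (hC.image hcont)
      (fun g => by
        obtain ⟨g, rfl⟩ := hsurj g
        obtain ⟨c, hc, l, hl, rfl⟩ := hCΛ g
        exact ⟨_, ⟨c, hc, rfl⟩, _, ⟨l, hl, rfl⟩, map_mul _ _ _⟩) hdisc h1
    refine ⟨QuotientGroup.mk' H ⁻¹' U, hcont.continuousAt.preimage_mem_nhds (by simpa using hU), ?_⟩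
    intro u hu c hc huc
    have h5 := hUc _ hu _ (commutator_map_le _ ⟨c, hc, rfl⟩)
      (by rw [← map_mul]; exact ⟨_, huc, rfl⟩)
    have h6 : commutator (G ⧸ H) = (commutator G).map (QuotientGroup.mk' H) :=
      (map_lcs hsurj 1).symm
    rw [← map_mul, h6] at h5
    obtain ⟨d, hd', hde⟩ := h5
    have h7 : d⁻¹ * (u * c) ∈ H := QuotientGroup.eq.1 hde
    have h8 : H ≤ commutator G :=
      hHl.trans (Subgroup.lowerCentralSeries_antitone _ (by omega : 1 ≤ m + 1))
    exact (mul_mem_cancel_left (inv_mem hd')).1 (h8 h7)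

end Discreteness

/-! ### Countable intersections of winning sets -/

section Game

open Set Filter Metric
open scoped Topology

variable {X : Type*} [MetricSpace X]

/-- Every positive integer is an odd multiple of a power of two: `k + 1 = 2 ^ i * (2 * l + 1)`. -/
lemma exists_two_pow_mul_odd (k : ℕ) : ∃ i l : ℕ, k = 2 ^ i - 1 + l * 2 ^ (i + 1) := by
  obtain ⟨i, m, hm, h⟩ := Nat.exists_eq_two_pow_mul_odd (Nat.succ_ne_zero k)
  obtain ⟨l, rfl⟩ := hm
  refine ⟨i, l, ?_⟩
  have h1 : 0 < 2 ^ i := by positivity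
  have : k + 1 = 2 ^ i + l * 2 ^ (i + 1) := by rw [← Nat.succ_eq_add_one, h]; ring
  omega

lemma two_pow_mul_odd_unique {i l i' l' : ℕ}
    (h : 2 ^ i - 1 + l * 2 ^ (i + 1) = 2 ^ i' - 1 + l' * 2 ^ (i' + 1)) : i = i' ∧ l = l' := by
  have h1 : 0 < 2 ^ i := by positivity
  have h2 : 0 < 2 ^ i' := by positivity
  have h3 : 2 ^ i * (2 * l + 1) = 2 ^ i' * (2 * l' + 1) := by
    have e1 : 2 ^ i * (2 * l + 1) = 2 ^ i + l * 2 ^ (i + 1) := by ring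
    have e2 : 2 ^ i' * (2 * l' + 1) = 2 ^ i' + l' * 2 ^ (i' + 1) := by ring
    omega
  have h4 : i = i' := by
    have key : ∀ {a b x y : ℕ}, 2 ^ a * (2 * x + 1) = 2 ^ b * (2 * y + 1) → a ≤ b := by
      intro a b x y h
      by_contra hlt
      obtain ⟨d, rfl⟩ := Nat.exists_eq_add_of_lt (not_le.1 hlt)
      rw [pow_add, pow_add, mul_assoc, mul_assoc] at h
      have h' := Nat.eq_of_mul_eq_mul_left (by positivity) h
      have e : 2 ^ d * (2 ^ 1 * (2 * x + 1)) = 2 * (2 ^ d * (2 * x + 1)) := by ring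
      omega
    exact le_antisymm (key h3) (key h3.symm)
  subst h4
  have := Nat.eq_of_mul_eq_mul_left h1 h3
  exact ⟨rfl, by omega⟩

/-- A countable intersection of `α`-winning sets is `α`-winning. -/
theorem IsAlphaWinning.iInter {α : ℝ} (hα : α ∈ Ioo (0 : ℝ) 1) {S : ℕ → Set X}
    (h : ∀ i, IsAlphaWinning α (S i)) : IsAlphaWinning α (⋂ i, S i) := by
  intro β hβ
  have hθ0 : 0 < α * β := mul_pos hα.1 hβ.1
  have hθα : α * β < α := mul_lt_of_lt_one_right hα.1 hβ.2
  have hθ1 : α * β < 1 := hθα.trans hα.2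
  -- The `i`-th target is served at the times `2 ^ i - 1 + l * 2 ^ (i + 1)`. Between two of them the
  -- radius shrinks by `(α * β) ^ 2 ^ (i + 1)`, so it is a game with this number divided by `α` in
  -- place of `β`.
  have hβ' : ∀ i : ℕ, (α * β) ^ 2 ^ (i + 1) / α ∈ Ioo (0 : ℝ) 1 := fun i => by
    refine ⟨by have := hα.1; positivity, (div_lt_one hα.1).2 ?_⟩
    exact (pow_le_of_le_one hθ0.le hθ1.le (by positivity)).trans_lt hθα
  have hαβ' : ∀ i : ℕ, α * ((α * β) ^ 2 ^ (i + 1) / α) = (α * β) ^ 2 ^ (i + 1) :=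
    fun i => mul_div_cancel₀ _ hα.1.ne'
  choose σ hσ using fun i => h i _ (hβ' i)
  choose I L hIL using exists_two_pow_mul_odd
  have hI : ∀ i l, I (2 ^ i - 1 + l * 2 ^ (i + 1)) = i := fun i l =>
    (two_pow_mul_odd_unique (hIL (2 ^ i - 1 + l * 2 ^ (i + 1)))).1.symm
  have hL : ∀ i l, L (2 ^ i - 1 + l * 2 ^ (i + 1)) = l := fun i l =>
    (two_pow_mul_odd_unique (hIL (2 ^ i - 1 + l * 2 ^ (i + 1)))).2.symm
  let τ : ℝ → (k : ℕ) → (Fin (k + 1) → X) → X := fun r k b =>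
    σ (I k) ((α * β) ^ (2 ^ I k - 1) * r) (L k) fun j =>
      b (Fin.ofNat (k + 1) (2 ^ I k - 1 + j * 2 ^ (I k + 1)))
  have hτ : ∀ (r : ℝ) (b : ℕ → X) (i l : ℕ),
      τ r (2 ^ i - 1 + l * 2 ^ (i + 1)) (fun j => b j) =
        σ i ((α * β) ^ (2 ^ i - 1) * r) l fun j => b (2 ^ i - 1 + j * 2 ^ (i + 1)) := by
    intro r b i l
    simp only [τ]
    generalize hk : 2 ^ i - 1 + l * 2 ^ (i + 1) = k
    obtain rfl : I k = i := hk ▸ hI i l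
    obtain rfl : L k = l := hk ▸ hL (I k) l
    congr 1
    funext j
    congr 1
    rw [Fin.val_ofNat]
    refine Nat.mod_eq_of_lt ?_
    have := Nat.mul_le_mul_right (2 ^ (I k + 1)) (Nat.lt_succ_iff.1 j.2)
    omega
  refine ⟨τ, fun r hr b => ?_⟩
  intro B A
  let B' : ℕ → ℕ → Set X := fun i l =>
    closedBall (b (2 ^ i - 1 + l * 2 ^ (i + 1)))
      ((α * ((α * β) ^ 2 ^ (i + 1) / α)) ^ l * ((α * β) ^ (2 ^ i - 1) * r))
  let A' : ℕ → ℕ → Set X := fun i l =>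
    closedBall (σ i ((α * β) ^ (2 ^ i - 1) * r) l fun j => b (2 ^ i - 1 + j * 2 ^ (i + 1)))
      (α * ((α * ((α * β) ^ 2 ^ (i + 1) / α)) ^ l * ((α * β) ^ (2 ^ i - 1) * r)))
  have hrad : ∀ i l : ℕ, (α * ((α * β) ^ 2 ^ (i + 1) / α)) ^ l * ((α * β) ^ (2 ^ i - 1) * r) =
      (α * β) ^ (2 ^ i - 1 + l * 2 ^ (i + 1)) * r := fun i l => by
    rw [hαβ', ← pow_mul, pow_add, mul_comm l]; ring
  have hB' : ∀ i l, B' i l = B (2 ^ i - 1 + l * 2 ^ (i + 1)) := fun i l => by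
    simp only [B', B, hrad]
  have hA' : ∀ i l, A' i l = A (2 ^ i - 1 + l * 2 ^ (i + 1)) := fun i l => by
    simp only [A', A, hrad, hτ r b i l]
  have hgame := fun i => hσ i ((α * β) ^ (2 ^ i - 1) * r) (mul_pos (pow_pos hθ0 _) hr)
    fun l => b (2 ^ i - 1 + l * 2 ^ (i + 1))
  have hlegal : ∀ i m, (∀ k < m, B' i (k + 1) ⊆ A' i k) → A' i m ⊆ B' i m :=
    fun i => (hgame i).1
  have hwin : ∀ i, (∀ k, B' i (k + 1) ⊆ A' i k) → ∃ x ∈ S i, ⋂ k, A' i k = {x} :=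
    fun i => (hgame i).2
  -- nested balls
  have hchain : ∀ m, (∀ k < m, B (k + 1) ⊆ A k) → (∀ k < m, A k ⊆ B k) →
      ∀ d k, k + d + 1 ≤ m → B (k + d + 1) ⊆ A k := by
    intro m h1 h2 d
    induction d with
    | zero => exact fun k hk => h1 k hk
    | succ d ih =>
      intro k hk
      exact ((h1 (k + (d + 1)) hk).trans (h2 _ hk)).trans (ih k (by omega))
  -- Strategy `i` only promises a legal answer if its own subgame has been legal, and that subgame
  -- contains answers of the other strategies; hence strong induction over all rounds.
  have hleg : ∀ m, (∀ k < m, B (k + 1) ⊆ A k) → A m ⊆ B m := by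
    intro m
    induction m using Nat.strong_induction_on with
    | _ m ih =>
      intro hm
      have h2 : ∀ k < m, A k ⊆ B k := fun k hk => ih k hk fun j hj => hm j (hj.trans hk)
      have hk := hIL m
      rw [hk, ← hA', ← hB']
      refine hlegal _ _ fun l hl => ?_
      rw [hA', hB']
      have hpos : 0 < 2 ^ (I m + 1) := by positivity
      have e : 2 ^ I m - 1 + (l + 1) * 2 ^ (I m + 1) =
          2 ^ I m - 1 + l * 2 ^ (I m + 1) + (2 ^ (I m + 1) - 1) + 1 := by
        rw [add_mul]; omega
      rw [e]
      refine hchain m hm h2 _ _ ?_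
      rw [← e]
      conv_rhs => rw [hk]
      exact Nat.add_le_add_left (Nat.mul_le_mul_right _ hl) _
  refine ⟨hleg, fun hb => ?_⟩
  have hAB : ∀ k, A k ⊆ B k := fun k => hleg k fun j _ => hb j
  have hBA : ∀ d k, B (k + d + 1) ⊆ A k := fun d k =>
    hchain (k + d + 1) (fun j _ => hb j) (fun j _ => hAB j) d k le_rfl
  have hanti : Antitone A := antitone_nat_of_succ_le fun k => (hAB (k + 1)).trans (hb k)
  have hinter : ∀ i, ⋂ l, A' i l = ⋂ k, A k := by
    intro i
    refine Subset.antisymm (subset_iInter fun k => ?_) (subset_iInter fun l => ?_)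
    · refine (iInter_subset _ k).trans ?_
      rw [hA']
      refine hanti ?_
      have hpos : 0 < 2 ^ (i + 1) := by positivity
      calc k ≤ k * 2 ^ (i + 1) := Nat.le_mul_of_pos_right k hpos
        _ ≤ _ := Nat.le_add_left _ _
    · rw [hA']
      exact iInter_subset _ _
  have hx : ∀ i, ∃ x ∈ S i, ⋂ k, A k = {x} := fun i => by
    rw [← hinter i]
    refine hwin i fun l => ?_
    rw [hA', hB']
    have hpos : 0 < 2 ^ (i + 1) := by positivity
    have e : 2 ^ i - 1 + (l + 1) * 2 ^ (i + 1) =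
        2 ^ i - 1 + l * 2 ^ (i + 1) + (2 ^ (i + 1) - 1) + 1 := by
      rw [add_mul]; omega
    rw [e]
    exact hBA _ _
  obtain ⟨x, -, hx0⟩ := hx 0
  refine ⟨x, mem_iInter.2 fun i => ?_, hx0⟩
  obtain ⟨y, hy, hyi⟩ := hx i
  rw [hx0] at hyi
  rwa [singleton_injective hyi]

end Game

/-! ### Growth of powers of a semisimple map -/

section LinearAlgebra

open Polynomial

variable {k : ℕ}

/-- The complexification of an endomorphism of `ℝᵏ`. -/
def complexify (A : Module.End ℝ (Fin k → ℝ)) : Module.End ℂ (Fin k → ℂ) :=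
  Matrix.toLin' ((LinearMap.toMatrix' A).map (algebraMap ℝ ℂ))

lemma complexify_ofReal (A : Module.End ℝ (Fin k → ℝ)) (v : Fin k → ℝ) :
    complexify A (fun i => (v i : ℂ)) = fun i => ((A v i : ℝ) : ℂ) := by
  ext i
  have h : A v i = ∑ j, LinearMap.toMatrix' A i j * v j := by
    conv_lhs => rw [← Matrix.toLin'_toMatrix' A]
    rfl
  rw [h, Complex.ofReal_sum]
  simp only [Complex.ofReal_mul]
  rfl

lemma complexify_pow_ofReal (A : Module.End ℝ (Fin k → ℝ)) (j : ℕ) (v : Fin k → ℝ) :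
    (complexify A ^ j) (fun i => (v i : ℂ)) = fun i => (((A ^ j) v i : ℝ) : ℂ) := by
  induction j with
  | zero => rfl
  | succ j ih => rw [pow_succ', Module.End.mul_apply, ih, complexify_ofReal, pow_succ']; rfl

lemma charpoly_complexify (A : Module.End ℝ (Fin k → ℝ)) :
    (complexify A).charpoly = A.charpoly.map (algebraMap ℝ ℂ) := by
  rw [← LinearMap.charpoly_toMatrix A (Pi.basisFun ℝ (Fin k)),
    ← LinearMap.charpoly_toMatrix (complexify A) (Pi.basisFun ℂ (Fin k)),
    LinearMap.toMatrix_eq_toMatrix', LinearMap.toMatrix_eq_toMatrix', complexify,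
    LinearMap.toMatrix'_toLin', Matrix.charpoly_map]

/-- The minimal polynomial over `ℝ` is squarefree, hence separable, so it remains squarefree over
`ℂ`; it annihilates the complexification. -/
lemma isSemisimple_complexify {A : Module.End ℝ (Fin k → ℝ)} (hA : A.IsSemisimple) :
    (complexify A).IsSemisimple := by
  have hsep : (minpoly ℝ A).Separable :=
    PerfectField.separable_iff_squarefree.2 hA.minpoly_squarefree
  refine Module.End.isSemisimple_of_squarefree_aeval_eq_zero
    (p := (minpoly ℝ A).map (algebraMap ℝ ℂ)) (hsep.map).squarefree ?_
  have h1 : aeval (LinearMap.toMatrix' A) (minpoly ℝ A) = 0 := by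
    have := minpoly.aeval ℝ A
    have h2 := congrArg (LinearMap.toMatrixAlgEquiv' (R := ℝ) (n := Fin k)) this
    rw [← aeval_algHom_apply, map_zero] at h2
    exact h2
  have h3 : aeval ((LinearMap.toMatrix' A).map (algebraMap ℝ ℂ)) (minpoly ℝ A) = 0 := by
    have := congrArg ((Algebra.ofId ℝ ℂ).mapMatrix (m := Fin k)) h1
    rw [← aeval_algHom_apply, map_zero] at this
    exact this
  rw [aeval_map_algebraMap]
  have h4 := congrArg ((Matrix.toLinAlgEquiv' (R := ℂ) (n := Fin k)).toAlgHom.restrictScalars ℝ) h3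
  rw [← aeval_algHom_apply, map_zero] at h4
  exact h4

lemma norm_ofReal_pi (v : Fin k → ℝ) : ‖(fun i => (v i : ℂ))‖ = ‖v‖ := by
  simp [Pi.norm_def]

/-- The growth of the powers of a semisimple endomorphism is the exact exponential growth given by
the spectral radius `R`, and it is seen by a linear functional. -/
theorem exists_dominant_functional (hk : 0 < k) {A : Module.End ℝ (Fin k → ℝ)}
    (hA : A.IsSemisimple) :
    ∃ z : ℂ, (A.charpoly.map (algebraMap ℝ ℂ)).IsRoot z ∧
      ∃ C > 0, (∀ (j : ℕ) (v : Fin k → ℝ), ‖(A ^ j) v‖ ≤ C * ‖z‖ ^ j * ‖v‖) ∧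
        ∃ l : (Fin k → ℝ) →L[ℝ] ℝ, l ≠ 0 ∧
          ∀ (j : ℕ) (v : Fin k → ℝ), ‖z‖ ^ j * |l v| ≤ C * ‖(A ^ j) v‖ := by
  set B := complexify A with hB
  set p := A.charpoly.map (algebraMap ℝ ℂ) with hp
  have hcp : B.charpoly = p := charpoly_complexify A
  have hp0 : p ≠ 0 := by rw [← hcp]; exact (LinearMap.charpoly_monic B).ne_zero
  have hdeg : p.degree ≠ 0 := by
    rw [← hcp, degree_eq_natDegree (LinearMap.charpoly_monic B).ne_zero,
      LinearMap.charpoly_natDegree, Module.finrank_fin_fun]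
    exact_mod_cast hk.ne'
  obtain ⟨z0, hz0⟩ := IsAlgClosed.exists_root p hdeg
  obtain ⟨z, hz, hmax⟩ := Finset.exists_max_image p.roots.toFinset (fun z => ‖z‖)
    ⟨z0, by simpa using ⟨hp0, hz0⟩⟩
  have hzroot : p.IsRoot z := by simp at hz; exact hz.2
  have hmax' : ∀ w, p.IsRoot w → ‖w‖ ≤ ‖z‖ := fun w hw =>
    hmax w (by simpa using ⟨hp0, hw⟩)
  refine ⟨z, hzroot, ?_⟩
  -- upper bound
  have hbd : ∀ v : Fin k → ℂ, ∃ C : ℝ, 0 ≤ C ∧ ∀ j : ℕ, ‖(B ^ j) v‖ ≤ C * ‖z‖ ^ j := by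
    intro v
    -- Without nilpotent part every vector is a sum of eigenvectors, so no polynomial factor in `j`
    -- appears.
    have hv : v ∈ ⨆ μ, B.eigenspace μ := by
      rw [(isSemisimple_complexify hA).iSup_eigenspace_eq_top]; trivial
    induction hv using Submodule.iSup_induction' with
    | mem μ v hv =>
      by_cases hv0 : v = 0
      · exact ⟨0, le_rfl, fun j => by simp [hv0]⟩
      · have hμ : ‖μ‖ ≤ ‖z‖ := by
          refine hmax' μ ?_
          rw [← hcp, ← Module.End.hasEigenvalue_iff_isRoot_charpoly]
          exact Module.End.hasEigenvalue_of_hasEigenvector ⟨hv, hv0⟩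
        refine ⟨‖v‖, norm_nonneg _, fun j => ?_⟩
        have : (B ^ j) v = μ ^ j • v := by
          exact (Module.End.HasEigenvector.pow_apply ⟨hv, hv0⟩ j)
        rw [this, norm_smul, norm_pow, mul_comm]
        gcongr
    | zero => exact ⟨0, le_rfl, fun j => by simp⟩
    | add v w _ _ hv hw =>
      obtain ⟨C, hC, h1⟩ := hv
      obtain ⟨D, hD, h2⟩ := hw
      refine ⟨C + D, by positivity, fun j => ?_⟩
      rw [map_add, add_mul]
      exact (norm_add_le _ _).trans (add_le_add (h1 j) (h2 j))
  choose c hc0 hc using hbd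
  set C1 := ∑ i : Fin k, c (fun l => ((Pi.single i 1 : Fin k → ℝ) l : ℂ)) with hC1
  have hC1' : 0 ≤ C1 := Finset.sum_nonneg fun i _ => hc0 _
  have hup : ∀ (j : ℕ) (v : Fin k → ℝ), ‖(A ^ j) v‖ ≤ C1 * ‖z‖ ^ j * ‖v‖ := by
    intro j v
    conv_lhs => rw [pi_eq_sum_univ' v]
    rw [map_sum, hC1, Finset.sum_mul, Finset.sum_mul]
    refine (norm_sum_le _ _).trans (Finset.sum_le_sum fun i _ => ?_)
    rw [map_smul, norm_smul, mul_comm]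
    have h := hc (fun l => ((Pi.single i 1 : Fin k → ℝ) l : ℂ)) j
    rw [hB, complexify_pow_ofReal, norm_ofReal_pi] at h
    exact mul_le_mul h (norm_le_pi_norm v i) (norm_nonneg _)
      (mul_nonneg (hc0 _) (pow_nonneg (norm_nonneg _) _))
  -- the functional
  have hev : Module.End.HasEigenvalue
      (Matrix.toLin' ((LinearMap.toMatrix' A).map (algebraMap ℝ ℂ)).transpose) z := by
    rw [Module.End.hasEigenvalue_iff_isRoot_charpoly,
      ← LinearMap.charpoly_toMatrix _ (Pi.basisFun ℂ (Fin k)),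
      LinearMap.toMatrix_eq_toMatrix', LinearMap.toMatrix'_toLin', Matrix.charpoly_transpose]
    rw [← hcp, ← LinearMap.charpoly_toMatrix _ (Pi.basisFun ℂ (Fin k)),
      LinearMap.toMatrix_eq_toMatrix', hB, complexify, LinearMap.toMatrix'_toLin'] at hzroot
    exact hzroot
  obtain ⟨w, hw, hw0⟩ := hev.exists_hasEigenvector
  rw [Module.End.mem_eigenspace_iff, Matrix.toLin'_apply] at hw
  obtain ⟨i, hi⟩ := Function.ne_iff.1 hw0
  rw [Pi.zero_apply] at hi
  -- The left eigenvector `w` gives a functional that `B` multiplies by `z`. Normalizing it to be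
  -- `1` on the `i`-th basis vector ensures that its real part does not vanish on `ℝᵏ`.
  let f : (Fin k → ℂ) → ℂ := fun v => (w i)⁻¹ * (w ⬝ᵥ v)
  have hf : ∀ (j : ℕ) (v : Fin k → ℂ), f ((B ^ j) v) = z ^ j * f v := by
    have h1 : ∀ v, f (B v) = z * f v := fun v => by
      have : w ⬝ᵥ (B v) = z * (w ⬝ᵥ v) := by
        rw [hB, complexify, Matrix.toLin'_apply, Matrix.dotProduct_mulVec,
          ← Matrix.mulVec_transpose,
          hw, smul_dotProduct, smul_eq_mul]
      simp only [f, this]; ring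
    intro j v
    induction j with
    | zero => simp
    | succ j ih => rw [pow_succ', Module.End.mul_apply, h1, ih]; ring
  set C2 := ‖(w i)⁻¹‖ * ∑ l, ‖w l‖ with hC2
  have hC2' : 0 ≤ C2 := by positivity
  have hfb : ∀ v, ‖f v‖ ≤ C2 * ‖v‖ := by
    intro v
    simp only [f, norm_mul, hC2, mul_assoc]
    gcongr
    rw [dotProduct, Finset.sum_mul]
    refine (norm_sum_le _ _).trans (Finset.sum_le_sum fun l _ => ?_)
    rw [norm_mul]
    gcongr
    exact norm_le_pi_norm v l
  let l0 : (Fin k → ℝ) →ₗ[ℝ] ℝ :=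
    { toFun := fun v => (f fun i => (v i : ℂ)).re
      map_add' := fun u v => by
        simp [f, dotProduct, mul_add, Finset.sum_add_distrib]
      map_smul' := fun t v => by
        have : (f fun i => ((t • v) i : ℂ)) = (t : ℂ) * f fun i => (v i : ℂ) := by
          simp only [f, dotProduct, Pi.smul_apply, smul_eq_mul, Complex.ofReal_mul, Finset.mul_sum]
          exact Finset.sum_congr rfl fun _ _ => by ring
        rw [this, Complex.re_ofReal_mul]; rfl }
  refine ⟨C1 + C2 + 1, by positivity, fun j v => (hup j v).trans ?_,
    LinearMap.toContinuousLinearMap l0, ?_, fun j v => ?_⟩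
  · gcongr; linarith
  · intro h
    have h1 : l0 (Pi.single i 1) = 0 := by
      have := congrArg (fun g : (Fin k → ℝ) →L[ℝ] ℝ => g (Pi.single i 1)) h
      simpa using this
    have h2 : l0 (Pi.single i 1) = 1 := by
      change (f fun l => ((Pi.single i 1 : Fin k → ℝ) l : ℂ)).re = 1
      have : (fun l => ((Pi.single i 1 : Fin k → ℝ) l : ℂ)) = Pi.single i 1 := by
        ext l; by_cases h : l = i <;> simp [h]
      rw [this]
      simp [f, hi]
    rw [h1] at h2
    exact zero_ne_one h2
  · change ‖z‖ ^ j * |(f fun i => (v i : ℂ)).re| ≤ _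
    calc ‖z‖ ^ j * |(f fun i => (v i : ℂ)).re| ≤ ‖z‖ ^ j * ‖f fun i => (v i : ℂ)‖ := by
          gcongr; exact Complex.abs_re_le_norm _
      _ = ‖f ((B ^ j) fun i => (v i : ℂ))‖ := by
          rw [hf, norm_mul (z ^ j), norm_pow]
      _ ≤ C2 * ‖(A ^ j) v‖ := by
          refine (hfb _).trans_eq ?_
          rw [hB, complexify_pow_ofReal, norm_ofReal_pi]
      _ ≤ _ := by gcongr; linarith

/-- The roots of `X ^ m - 1` have modulus one, so this polynomial is coprime to the characteristic
polynomial; apply Bézout and Cayley–Hamilton. -/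
lemma pow_sub_one_injective {A : Module.End ℝ (Fin k → ℝ)}
    (hA : ∀ z : ℂ, (A.charpoly.map (algebraMap ℝ ℂ)).IsRoot z → ‖z‖ ≠ 1) {m : ℕ} (hm : 0 < m)
    {v : Fin k → ℝ} (hv : (A ^ m) v = v) : v = 0 := by
  have hcop : IsCoprime A.charpoly (X ^ m - 1 : ℝ[X]) := by
    rw [isCoprime_iff_aeval_ne_zero_of_isAlgClosed ℝ ℂ]
    intro a
    by_contra! h
    refine hA a ?_ ?_
    · rw [IsRoot, eval_map_algebraMap]; exact h.1
    · have := h.2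
      rw [map_sub, map_pow, aeval_X, map_one, sub_eq_zero] at this
      exact Complex.norm_eq_one_of_pow_eq_one this hm.ne'
  obtain ⟨a, b, hab⟩ := hcop
  have h1 := congrArg (fun p => aeval A p v) hab
  have h2 : ((A ^ m - 1) : Module.End ℝ (Fin k → ℝ)) v = 0 := by
    rw [LinearMap.sub_apply, hv, Module.End.one_apply, sub_self]
  simp only [map_add, map_mul, LinearMap.aeval_self_charpoly, mul_zero, zero_add, map_sub, map_pow,
    aeval_X, map_one, Module.End.mul_apply, h2, Module.End.one_apply, map_zero] at h1
  exact h1.symm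

end LinearAlgebra

/-! ### Homomorphisms on groups with a right invariant length metric -/

section MetricGroup

open Set Filter
open scoped Topology

/-- Any two points are joined by arbitrarily fine chains of total length at most twice their
distance. -/
def HasFineChains (X : Type*) [MetricSpace X] : Prop :=
  ∀ x y : X, x ≠ y → ∀ η : ℝ, 0 < η → ∃ (q : ℕ) (p : ℕ → X), p 0 = x ∧ p q = y ∧
    (∀ i < q, dist (p i) (p (i + 1)) ≤ η) ∧
      ∑ i ∈ Finset.range q, dist (p i) (p (i + 1)) ≤ 2 * dist x y

section

variable {N : Type*} [Group N] {V : Type*} [AddCommGroup V] {f : N → V}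

lemma hom_one (hf : ∀ x y, f (x * y) = f x + f y) : f 1 = 0 := by
  have := hf 1 1
  rwa [one_mul, left_eq_add] at this

lemma hom_inv (hf : ∀ x y, f (x * y) = f x + f y) (x : N) : f x⁻¹ = -f x := by
  rw [eq_neg_iff_add_eq_zero, ← hf, inv_mul_cancel, hom_one hf]

lemma hom_mul_inv (hf : ∀ x y, f (x * y) = f x + f y) (x y : N) : f (x * y⁻¹) = f x - f y := by
  rw [hf, hom_inv hf, sub_eq_add_neg]

lemma hom_pow (hf : ∀ x y, f (x * y) = f x + f y) (x : N) (m : ℕ) : f (x ^ m) = m • f x := by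
  induction m with
  | zero => simp [hom_one hf]
  | succ m ih => rw [pow_succ, hf, ih, succ_nsmul]

end

variable {N : Type*} [Group N] [MetricSpace N] [IsIsometricSMul Nᵐᵒᵖ N]
  {V : Type*} [NormedAddCommGroup V] [NormedSpace ℝ V]

lemma dist_mul_inv_one (x y : N) : dist (x * y⁻¹) 1 = dist x y := by
  have := dist_mul_right (x * y⁻¹) 1 y
  rwa [inv_mul_cancel_right, one_mul, eq_comm] at this

lemma dist_inv_one (x : N) : dist x⁻¹ 1 = dist x 1 := by
  have := dist_mul_inv_one 1 x
  rwa [one_mul, dist_comm 1 x] at this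

lemma dist_pow_one_le (x : N) (m : ℕ) : dist (x ^ m) 1 ≤ m * dist x 1 := by
  induction m with
  | zero => simp
  | succ m ih =>
    have h1 : dist (x ^ (m + 1)) x = dist (x ^ m) 1 := by
      have := dist_mul_right (x ^ m) 1 x
      rwa [one_mul, ← pow_succ] at this
    calc dist (x ^ (m + 1)) 1 ≤ dist (x ^ (m + 1)) x + dist x 1 := dist_triangle _ _ _
      _ ≤ m * dist x 1 + dist x 1 := by rw [h1]; gcongr
      _ = _ := by push_cast; ring

/-- A continuous homomorphism from a group with a right invariant length metric to a normed space is
Lipschitz. -/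
lemma exists_norm_hom_le (hN : HasFineChains N) {f : N → V} (hf : ∀ x y, f (x * y) = f x + f y)
    (hc : Continuous f) : ∃ C > 0, ∀ x, ‖f x‖ ≤ C * dist x 1 := by
  obtain ⟨δ, hδ, hδ'⟩ := Metric.continuous_iff.1 hc 1 1 one_pos
  rw [hom_one hf] at hδ'
  simp only [dist_zero_right] at hδ'
  have hloc : ∀ x, dist x 1 ≤ δ / 2 → ‖f x‖ ≤ 4 / δ * dist x 1 := by
    intro x hx
    rcases eq_or_ne x 1 with rfl | hx1
    · simp [hom_one hf]
    have hd : 0 < dist x 1 := dist_pos.2 hx1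
    -- `m` is the largest number with `m * dist x 1 ≤ δ / 2`. Then `m * ‖f x‖ = ‖f (x ^ m)‖ < 1`,
    -- while `m * dist x 1 ≥ δ / 4`.
    set m := ⌊δ / 2 / dist x 1⌋₊ with hm
    have hm1 : 1 ≤ m := by
      rw [hm, Nat.one_le_floor_iff, le_div_iff₀ hd]; linarith
    have hm1' : (1 : ℝ) ≤ m := by exact_mod_cast hm1
    have hle : (m : ℝ) * dist x 1 ≤ δ / 2 := by
      rw [← le_div_iff₀ hd]; exact Nat.floor_le (by positivity)
    have hlt : δ / 2 < (m + 1) * dist x 1 := by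
      rw [← div_lt_iff₀ hd]; exact Nat.lt_floor_add_one _
    have h1 : ‖f (x ^ m)‖ < 1 := hδ' _ (by linarith [dist_pow_one_le x m])
    rw [hom_pow hf, ← Nat.cast_smul_eq_nsmul ℝ, norm_smul, Real.norm_natCast] at h1
    have h2 : δ / 4 ≤ m * dist x 1 := by nlinarith
    rw [div_mul_eq_mul_div, le_div_iff₀ hδ]
    have h3 : (m : ℝ) * ‖f x‖ * δ ≤ 1 * δ := by gcongr
    have h4 : (m : ℝ) * (‖f x‖ * δ) ≤ m * (4 * dist x 1) := by linarith
    exact le_of_mul_le_mul_left h4 (by linarith)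
  refine ⟨8 / δ, by positivity, fun x => ?_⟩
  rcases eq_or_ne x 1 with rfl | hx1
  · simp [hom_one hf]
  obtain ⟨q, p, hp0, hpq, hstep, hsum⟩ := hN 1 x hx1.symm (δ / 2) (by positivity)
  have h1 : f x = ∑ i ∈ Finset.range q, f (p (i + 1) * (p i)⁻¹) := by
    simp only [hom_mul_inv hf]
    rw [Finset.sum_range_sub (fun i => f (p i)), hp0, hpq, hom_one hf, sub_zero]
  calc ‖f x‖ ≤ ∑ i ∈ Finset.range q, ‖f (p (i + 1) * (p i)⁻¹)‖ := h1 ▸ norm_sum_le _ _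
    _ ≤ ∑ i ∈ Finset.range q, 4 / δ * dist (p i) (p (i + 1)) := by
        refine Finset.sum_le_sum fun i hi => ?_
        have h2 : dist (p (i + 1) * (p i)⁻¹) 1 = dist (p i) (p (i + 1)) := by
          rw [dist_mul_inv_one, dist_comm]
        rw [← h2]
        exact hloc _ (h2 ▸ hstep i (Finset.mem_range.1 hi))
    _ ≤ 4 / δ * (2 * dist 1 x) := by rw [← Finset.mul_sum]; gcongr
    _ = 8 / δ * dist x 1 := by rw [dist_comm]; ring

/-- A nonzero continuous homomorphism `l` to `ℝ` almost attains its Lipschitz constant at all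
scales. -/
lemma exists_lipschitz_constant_attained (hN : HasFineChains N) {l : N → ℝ}
    (hl : ∀ x y, l (x * y) = l x + l y) (hc : Continuous l) (h0 : ∃ x, l x ≠ 0) :
    ∃ L > 0, (∀ x y, |l x - l y| ≤ L * dist x y) ∧
      ∀ ρ > 0, ∃ g, dist g 1 ≤ ρ ∧ L * ρ / 8 ≤ l g := by
  obtain ⟨C, hC, hCl⟩ := exists_norm_hom_le hN hl hc
  set Q : Set ℝ := {t | ∃ x, x ≠ 1 ∧ t = |l x| / dist x 1} with hQ
  have hbdd : BddAbove Q := by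
    refine ⟨C, ?_⟩
    rintro _ ⟨x, hx, rfl⟩
    rw [div_le_iff₀ (dist_pos.2 hx)]
    exact hCl x
  have hle : ∀ x, |l x| ≤ sSup Q * dist x 1 := by
    intro x
    rcases eq_or_ne x 1 with rfl | hx
    · simp [hom_one hl]
    rw [← div_le_iff₀ (dist_pos.2 hx)]
    exact le_csSup hbdd ⟨x, hx, rfl⟩
  obtain ⟨x0, hx0⟩ := h0
  have hx01 : x0 ≠ 1 := fun h => hx0 (h ▸ hom_one hl)
  have hne : Q.Nonempty := ⟨_, x0, hx01, rfl⟩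
  have hpos : 0 < sSup Q := by
    have := (abs_pos.2 hx0).trans_le (hle x0)
    exact pos_of_mul_pos_left this dist_nonneg
  refine ⟨sSup Q, hpos, fun x y => ?_, fun ρ hρ => ?_⟩
  · rw [← hom_mul_inv hl, ← dist_mul_inv_one]
    exact hle _
  obtain ⟨_, ⟨x, hx1, rfl⟩, hx⟩ := exists_lt_of_lt_csSup hne (half_lt_self hpos)
  set L := sSup Q with hL
  rw [lt_div_iff₀ (dist_pos.2 hx1)] at hx
  obtain ⟨y, hy1, hy⟩ : ∃ y, y ≠ 1 ∧ L / 2 * dist y 1 < l y := by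
    rcases le_total 0 (l x) with h | h
    · exact ⟨x, hx1, by rwa [abs_of_nonneg h] at hx⟩
    · refine ⟨x⁻¹, by simpa using hx1, ?_⟩
      rwa [dist_inv_one, hom_inv hl, ← abs_of_nonpos h]
  obtain ⟨q, p, hp0, hpq, hstep, hsum⟩ := hN 1 y hy1.symm (ρ / 2) (by positivity)
  have h1 : l y = ∑ i ∈ Finset.range q, l (p (i + 1) * (p i)⁻¹) := by
    simp only [hom_mul_inv hl]
    rw [Finset.sum_range_sub (fun i => l (p i)), hp0, hpq, hom_one hl, sub_zero]
  have h2 : ∑ i ∈ Finset.range q, L / 4 * dist (p i) (p (i + 1)) <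
      ∑ i ∈ Finset.range q, l (p (i + 1) * (p i)⁻¹) := by
    rw [← h1, ← Finset.mul_sum]
    refine lt_of_le_of_lt ?_ hy
    rw [dist_comm 1 y] at hsum
    have := mul_le_mul_of_nonneg_left hsum (by positivity : 0 ≤ L / 4)
    linarith
  -- The chain is at most twice as long as `dist y 1`, so the slope `L / 2` of `y` forces slope `L /
  -- 4` on some link.
  obtain ⟨i, hi, hlt⟩ := Finset.exists_lt_of_sum_lt h2
  set z := p (i + 1) * (p i)⁻¹ with hz
  have hzd : dist z 1 = dist (p i) (p (i + 1)) := by rw [hz, dist_mul_inv_one, dist_comm]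
  rw [← hzd] at hlt
  have hzρ : dist z 1 ≤ ρ / 2 := hzd ▸ hstep i (Finset.mem_range.1 hi)
  have hz1 : z ≠ 1 := fun h => by
    rw [h, hom_one hl, dist_self, mul_zero] at hlt
    exact lt_irrefl _ hlt
  have hd : 0 < dist z 1 := dist_pos.2 hz1
  -- Powers restore the scale: `m * dist z 1` lies between `ρ / 2` and `ρ`, which with slope `L / 4`
  -- gives `L * ρ / 8`.
  set m := ⌊ρ / dist z 1⌋₊ with hm
  have hmle : (m : ℝ) * dist z 1 ≤ ρ := by
    rw [← le_div_iff₀ hd]; exact Nat.floor_le (by positivity)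
  have hmlt : ρ < (m + 1) * dist z 1 := by
    rw [← div_lt_iff₀ hd]; exact Nat.lt_floor_add_one _
  refine ⟨z ^ m, (dist_pow_one_le z m).trans hmle, ?_⟩
  rw [hom_pow hl, nsmul_eq_mul]
  calc L * ρ / 8 ≤ m * (L / 4 * dist z 1) := by
        have : ρ / 2 ≤ m * dist z 1 := by linarith
        have := mul_le_mul_of_nonneg_left this (by positivity : 0 ≤ L / 4)
        linarith
    _ ≤ m * l z := by gcongr

end MetricGroup

/-! ### The halving strategy of the first player -/

section Strategy

open Set Filter Metric
open scoped Topology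

/-- The elements of `F` that survive when one moves away from the larger part of `F`, as seen
from `c`. -/
def survivors (F : Finset ℝ) (c : ℝ) : Finset ℝ :=
  if F.card ≤ 2 * (F.filter (· ≤ c)).card then F.filter (c < ·) else F.filter (· ≤ c)

lemma two_mul_card_survivors_le (F : Finset ℝ) (c : ℝ) : 2 * (survivors F c).card ≤ F.card := by
  have h := Finset.card_filter_add_card_filter_not (s := F) (· ≤ c)
  simp only [not_le] at h
  unfold survivors
  split_ifs with h1 <;> omega

variable {N : Type*} [Group N] [MetricSpace N]

/-- A representative of the coset `b` at distance less than `ρ` of `a`, if there is one. -/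
def nearLift (Λ : Subgroup N) (a : N) (b : N ⧸ Λ) (ρ : ℝ) : N :=
  open Classical in
  if h : ∃ y : N, (y : N ⧸ Λ) = b ∧ dist a y < ρ then h.choose else b.out

lemma mk_nearLift (Λ : Subgroup N) (a : N) (b : N ⧸ Λ) (ρ : ℝ) :
    ((nearLift Λ a b ρ : N) : N ⧸ Λ) = b := by
  unfold nearLift
  split_ifs with h
  · exact h.choose_spec.1
  · exact QuotientGroup.out_eq' b

/-- The data of the strategy that keeps a homomorphism `l : N → ℝ` away from finite sets:
`push ρ` is an element of size `ρ` on which `l` is large, and at the times divisible by `period`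
the set of numbers to avoid is renewed. -/
structure AvoidanceData (Λ : Subgroup N) where
  l : N → ℝ
  push : ℝ → N
  α : ℝ
  β : ℝ
  period : ℕ
  renew : ℝ → ℕ → N → Finset ℝ

namespace AvoidanceData

variable {Λ : Subgroup N} (D : AvoidanceData Λ)

/-- The radius of the `k`-th ball of the second player. -/
def radius (r : ℝ) (k : ℕ) : ℝ := (D.α * D.β) ^ k * r

/-- The answer of the first player, in `N`. -/
def answer (r : ℝ) (k : ℕ) (s : N × Finset ℝ) : N :=
  if s.2.card ≤ 2 * (s.2.filter (· ≤ D.l s.1)).card then D.push (D.radius r k / 2) * s.1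
  else (D.push (D.radius r k / 2))⁻¹ * s.1

/-- The representative in `N` of the centre of the `k`-th ball of the second player, and the set of
numbers still to be avoided. -/
def state (r : ℝ) (b : ℕ → N ⧸ Λ) : ℕ → N × Finset ℝ
  | 0 => ((b 0).out, ∅)
  | k + 1 =>
    let s := state r b k
    -- The factor `2` is there because the distance of cosets is an infimum that need not be
    -- attained.
    let y := nearLift Λ (D.answer r k s) (b (k + 1)) (2 * (D.α * D.radius r k))
    (y, if D.period ∣ k + 1 then D.renew r (k + 1) y else survivors s.2 (D.l s.1))

/-- The strategy of the first player. -/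
def strategy (r : ℝ) (k : ℕ) (b : Fin (k + 1) → N ⧸ Λ) : N ⧸ Λ :=
  (D.answer r k (D.state r (fun i => b (Fin.ofNat (k + 1) i)) k) : N)

lemma state_congr (r : ℝ) {b b' : ℕ → N ⧸ Λ} (k : ℕ) (h : ∀ i ≤ k, b i = b' i) :
    D.state r b k = D.state r b' k := by
  induction k with
  | zero => simp only [state, h 0 le_rfl]
  | succ k ih =>
    simp only [state, h (k + 1) le_rfl, ih fun i hi => h i (hi.trans k.le_succ)]

lemma strategy_apply (r : ℝ) (b : ℕ → N ⧸ Λ) (k : ℕ) :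
    D.strategy r k (fun i => b i) = (D.answer r k (D.state r b k) : N) := by
  unfold strategy
  rw [D.state_congr r k fun i hi => ?_]
  change b (Fin.ofNat (k + 1) i : Fin (k + 1)) = b i
  rw [Fin.val_ofNat, Nat.mod_eq_of_lt (Nat.lt_succ_of_le hi)]

lemma mk_state (r : ℝ) (b : ℕ → N ⧸ Λ) (k : ℕ) : ((D.state r b k).1 : N ⧸ Λ) = b k := by
  cases k with
  | zero => exact QuotientGroup.out_eq' _
  | succ k => exact mk_nearLift _ _ _ _

/-- The requirements on the data under which the strategy works; `L` is the Lipschitz constant of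
`l`. -/
structure IsValid (L : ℝ) : Prop where
  map_mul : ∀ x y, D.l (x * y) = D.l x + D.l y
  lipschitz : ∀ x y, |D.l x - D.l y| ≤ L * dist x y
  L_pos : 0 < L
  dist_push : ∀ ρ > 0, dist (D.push ρ) 1 ≤ ρ
  le_push : ∀ ρ > 0, L * ρ / 8 ≤ D.l (D.push ρ)
  α_pos : 0 < D.α
  α_le : D.α ≤ 1 / 160
  β_mem : D.β ∈ Ioo (0 : ℝ) 1
  card_renew : ∀ r k y, (D.renew r k y).card < 2 ^ D.period

variable {D} {L : ℝ}

namespace IsValid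

lemma ratio_pos (hD : D.IsValid L) : 0 < D.α * D.β := mul_pos hD.α_pos hD.β_mem.1

lemma ratio_le (hD : D.IsValid L) : D.α * D.β ≤ D.α :=
  mul_le_of_le_one_right hD.α_pos.le hD.β_mem.2.le

lemma radius_pos (hD : D.IsValid L) {r : ℝ} (hr : 0 < r) (k : ℕ) : 0 < D.radius r k :=
  mul_pos (pow_pos hD.ratio_pos _) hr

lemma radius_succ_le (hD : D.IsValid L) {r : ℝ} (hr : 0 < r) (k : ℕ) :
    D.radius r (k + 1) ≤ D.α * D.radius r k := by
  have h : D.radius r (k + 1) = D.α * D.β * D.radius r k := by unfold radius; ring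
  rw [h]
  exact mul_le_mul_of_nonneg_right hD.ratio_le (hD.radius_pos hr k).le

lemma dist_answer [IsIsometricSMul Nᵐᵒᵖ N] (hD : D.IsValid L) {r : ℝ} (hr : 0 < r) (k : ℕ)
    (s : N × Finset ℝ) : dist (D.answer r k s) s.1 ≤ D.radius r k / 2 := by
  have h := hD.dist_push _ (half_pos (hD.radius_pos hr k))
  have key : ∀ g : N, dist (g * s.1) s.1 = dist g 1 := fun g => by
    have := dist_mul_right g 1 s.1
    rwa [one_mul] at this
  unfold answer
  split_ifs
  · rwa [key]
  · rwa [key, dist_inv_one]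

/-- The numbers which do not survive a move are far from the values of `l` close to the answer. -/
lemma far_of_notMem_survivors (hD : D.IsValid L) {r : ℝ} (hr : 0 < r)
    (k : ℕ) (s : N × Finset ℝ) {x : N} (hx : dist (D.answer r k s) x ≤ 5 * (D.α * D.radius r k))
    {c : ℝ} (hc : c ∈ s.2) (hcs : c ∉ survivors s.2 (D.l s.1)) :
    L / 32 * D.radius r k ≤ |D.l x - c| := by
  have hρ := hD.radius_pos hr k
  have h1 := hD.le_push _ (half_pos hρ)
  have h2 := abs_le.1 (hD.lipschitz (D.answer r k s) x)
  -- The push changes `l` by at least `L / 16` times the radius; as `5 / 160 = 1 / 32`, half of this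
  -- remains at every point close to the answer.
  have h3 : L * dist (D.answer r k s) x ≤ L / 32 * D.radius r k := by
    calc L * dist (D.answer r k s) x ≤ L * (5 * (1 / 160 * D.radius r k)) := by
          refine mul_le_mul_of_nonneg_left (hx.trans ?_) hD.L_pos.le
          gcongr
          exact hD.α_le
      _ = L / 32 * D.radius r k := by ring
  unfold answer at h2 h3
  unfold survivors at hcs
  split_ifs at h2 h3 hcs with h
  · have hc' : c ≤ D.l s.1 := by
      by_contra hlt
      exact hcs (Finset.mem_filter.2 ⟨hc, not_le.1 hlt⟩)
    rw [hD.map_mul] at h2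
    exact (by linarith : L / 32 * D.radius r k ≤ D.l x - c).trans (le_abs_self _)
  · have hc' : D.l s.1 < c := by
      by_contra hlt
      exact hcs (Finset.mem_filter.2 ⟨hc, not_lt.1 hlt⟩)
    rw [hD.map_mul, hom_inv hD.map_mul] at h2
    exact (by linarith : L / 32 * D.radius r k ≤ -(D.l x - c)).trans (neg_le_abs _)

/-- Within a period all the numbers to be avoided are discarded. -/
lemma exists_notMem_survivors (hD : D.IsValid L) (r : ℝ) (b : ℕ → N ⧸ Λ) {k : ℕ} (hk : 0 < k)
    (hdvd : D.period ∣ k) {c : ℝ} (hc : c ∈ D.renew r k (D.state r b k).1) :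
    ∃ i < D.period, c ∈ (D.state r b (k + i)).2 ∧
      c ∉ survivors (D.state r b (k + i)).2 (D.l (D.state r b (k + i)).1) := by
  have hF : (D.state r b k).2 = D.renew r k (D.state r b k).1 := by
    obtain ⟨j, rfl⟩ := Nat.exists_eq_succ_of_ne_zero hk.ne'
    simp only [state, Nat.succ_eq_add_one, if_pos hdvd]
  by_contra! hcon
  have hstep : ∀ i, i + 1 < D.period → (D.state r b (k + (i + 1))).2 =
      survivors (D.state r b (k + i)).2 (D.l (D.state r b (k + i)).1) := by
    intro i hi
    have hnd : ¬ D.period ∣ k + i + 1 := by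
      rw [add_assoc, Nat.dvd_add_right hdvd]
      exact Nat.not_dvd_of_pos_of_lt (Nat.succ_pos i) hi
    rw [← add_assoc]
    simp only [state, if_neg hnd]
  have hper : 0 < D.period := Nat.pos_of_ne_zero fun h => by
    rw [h, zero_dvd_iff] at hdvd
    exact hk.ne' hdvd
  -- A number surviving `i` rounds leaves at most `1 / 2 ^ i` of the initial set; with fewer than `2
  -- ^ period` numbers nothing outlives the period.
  have key : ∀ i < D.period, c ∈ (D.state r b (k + i)).2 ∧
      2 ^ i * (D.state r b (k + i)).2.card ≤ (D.state r b k).2.card := by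
    intro i
    induction i with
    | zero => exact fun _ => ⟨by rw [add_zero, hF]; exact hc, by simp⟩
    | succ i ih =>
      intro hi
      obtain ⟨h1, h2⟩ := ih (by omega)
      rw [hstep i hi]
      refine ⟨hcon i (by omega) h1, ?_⟩
      have h3 := two_mul_card_survivors_le (D.state r b (k + i)).2 (D.l (D.state r b (k + i)).1)
      calc _ = 2 ^ i * (2 * _) := by rw [pow_succ, mul_assoc]
        _ ≤ _ := (Nat.mul_le_mul_left _ h3).trans h2
  obtain ⟨h1, h2⟩ := key (D.period - 1) (by omega)
  have h3 := two_mul_card_survivors_le (D.state r b (k + (D.period - 1))).2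
    (D.l (D.state r b (k + (D.period - 1))).1)
  have h4 := Finset.card_pos.2 ⟨c, hcon _ (by omega) h1⟩
  have h5 := hD.card_renew r k (D.state r b k).1
  rw [← hF] at h5
  have h6 : 2 ^ D.period = 2 ^ (D.period - 1) * 2 := by
    rw [← pow_succ, Nat.sub_add_cancel hper]
  have h7 : 2 ^ (D.period - 1) * 2 ≤
      2 ^ (D.period - 1) * (D.state r b (k + (D.period - 1))).2.card :=
    Nat.mul_le_mul_left _ (by omega)
  omega

variable [IsIsometricSMul Nᵐᵒᵖ N] [IsTopologicalGroup N] [DiscreteTopology Λ]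

lemma closedBall_answer_subset (hD : D.IsValid L) {r : ℝ} (hr : 0 < r) (b : ℕ → N ⧸ Λ) (k : ℕ) :
    closedBall (D.answer r k (D.state r b k) : N ⧸ Λ) (D.α * D.radius r k) ⊆
      closedBall (b k) (D.radius r k) := by
  refine closedBall_subset_closedBall' ?_
  have h1 : dist (D.answer r k (D.state r b k) : N ⧸ Λ) (b k) ≤ D.radius r k / 2 := by
    rw [← D.mk_state r b k]
    exact (cosetDist_mk_le Λ _ _).trans (hD.dist_answer hr k _)
  have h2 := mul_le_mul_of_nonneg_right hD.α_le (hD.radius_pos hr k).le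
  have h3 := hD.radius_pos hr k
  linarith

/-- The play is lifted to `N`, where the answers form a Cauchy sequence. Its limit `x` represents
the common point of the balls, and each number imposed at the beginning of a period is left behind
during that period, by a distance comparable to the radius then reached. -/
theorem strategy_spec [CompleteSpace N] (hD : D.IsValid L) {r : ℝ} (hr : 0 < r)
    (b : ℕ → N ⧸ Λ) (hb : ∀ k, closedBall (b (k + 1)) (D.radius r (k + 1)) ⊆
      closedBall (D.answer r k (D.state r b k) : N ⧸ Λ) (D.α * D.radius r k)) :
    ∃ x : N, ⋂ k, closedBall (D.answer r k (D.state r b k) : N ⧸ Λ) (D.α * D.radius r k) =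
        {(x : N ⧸ Λ)} ∧
      (∀ k, dist x (D.state r b k).1 ≤ D.radius r k) ∧
      ∀ k, 0 < k → D.period ∣ k → ∀ c ∈ D.renew r k (D.state r b k).1,
        L / 32 * D.radius r (k + D.period) ≤ |D.l x - c| := by
  set a : ℕ → N := fun k => D.answer r k (D.state r b k) with ha
  have hθ0 := hD.ratio_pos
  have hθ1 : D.α * D.β ≤ 1 / 2 := by linarith [hD.ratio_le, hD.α_le]
  have hα := hD.α_pos
  have hlift : ∀ k, dist (a k) (D.state r b (k + 1)).1 ≤ 2 * (D.α * D.radius r k) := by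
    intro k
    have hρ := mul_pos hα (hD.radius_pos hr k)
    have hmem : b (k + 1) ∈ closedBall (a k : N ⧸ Λ) (D.α * D.radius r k) :=
      hb k (mem_closedBall_self (hD.radius_pos hr _).le)
    rw [mem_closedBall'] at hmem
    have hex : ∃ y : N, (y : N ⧸ Λ) = b (k + 1) ∧ dist (a k) y < 2 * (D.α * D.radius r k) :=
      exists_of_cosetDist_lt Λ (lt_of_le_of_lt hmem (by linarith))
    simp only [state, nearLift]
    rw [dif_pos hex]
    exact hex.choose_spec.2.le
  -- The lifted centre is within `2` units `α * radius` of the answer, and the next answer within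
  -- half a unit of that centre. Summing with ratio at most `1 / 2` doubles `5 / 2` to `5`.
  have hstep : ∀ k, dist (a k) (a (k + 1)) ≤ 5 / 2 * (D.α * r) * (D.α * D.β) ^ k := by
    intro k
    have h1 := hD.dist_answer hr (k + 1) (D.state r b (k + 1))
    rw [dist_comm] at h1
    have h2 := hD.radius_succ_le hr k
    have h3 : 5 / 2 * (D.α * r) * (D.α * D.β) ^ k = 5 / 2 * (D.α * D.radius r k) := by
      unfold radius; ring
    rw [h3]
    linarith [dist_triangle (a k) (D.state r b (k + 1)).1 (a (k + 1)), hlift k]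
  have hcau := cauchySeq_of_le_geometric _ _ (by linarith) hstep
  obtain ⟨x, hx⟩ := cauchySeq_tendsto_of_complete hcau
  have hax : ∀ k, dist (a k) x ≤ 5 * (D.α * D.radius r k) := by
    intro k
    refine (dist_le_of_le_geometric_of_tendsto _ _ (by linarith) hstep hx k).trans ?_
    rw [div_le_iff₀ (by linarith)]
    have : 5 / 2 * (D.α * r) * (D.α * D.β) ^ k = 5 / 2 * (D.α * D.radius r k) := by
      unfold radius; ring
    rw [this]
    nlinarith [mul_pos hα (hD.radius_pos hr k)]
  have hanti : Antitone fun k => closedBall (a k : N ⧸ Λ) (D.α * D.radius r k) :=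
    antitone_nat_of_succ_le fun k => (hD.closedBall_answer_subset hr b (k + 1)).trans (hb k)
  have hmk : Tendsto (fun k => (a k : N ⧸ Λ)) atTop (𝓝 (x : N ⧸ Λ)) :=
    (continuous_quot_mk.tendsto x).comp hx
  refine ⟨x, ?_, fun k => ?_, fun k hk hdvd c hc => ?_⟩
  · refine Subset.antisymm (fun y hy => ?_) (singleton_subset_iff.2 (mem_iInter.2 fun k => ?_))
    · rw [mem_iInter] at hy
      have hlim : Tendsto (fun k => D.α * D.radius r k) atTop (𝓝 0) := by
        have := (tendsto_pow_atTop_nhds_zero_of_lt_one hθ0.le (by linarith :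
          D.α * D.β < 1)).mul_const r |>.const_mul D.α
        simpa [radius] using this
      have : Tendsto (fun k => (a k : N ⧸ Λ)) atTop (𝓝 y) :=
        tendsto_iff_dist_tendsto_zero.2 (squeeze_zero (fun _ => dist_nonneg)
          (fun k => by rw [dist_comm]; exact mem_closedBall.1 (hy k)) hlim)
      exact tendsto_nhds_unique this hmk
    · refine isClosed_closedBall.mem_of_tendsto hmk ?_
      filter_upwards [eventually_ge_atTop k] with j hj
      exact hanti hj (mem_closedBall_self (mul_pos hα (hD.radius_pos hr j)).le)
  · have h1 := hD.dist_answer hr k (D.state r b k)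
    have h2 := hax k
    rw [dist_comm] at h2
    have h3 := dist_triangle x (a k) (D.state r b k).1
    have h4 := mul_le_mul_of_nonneg_right hD.α_le (hD.radius_pos hr k).le
    have h5 := hD.radius_pos hr k
    linarith
  · obtain ⟨i, hi, hci, hcs⟩ := hD.exists_notMem_survivors r b hk hdvd hc
    refine le_trans ?_ (hD.far_of_notMem_survivors hr (k + i) _ (hax _) hci hcs)
    have hL := hD.L_pos
    unfold radius
    have : (D.α * D.β) ^ (k + D.period) ≤ (D.α * D.β) ^ (k + i) :=
      pow_le_pow_of_le_one hθ0.le (by linarith) (by omega)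
    gcongr

end IsValid
end AvoidanceData

end Strategy

/-! ### Winning against one periodic vector -/

section Target

open Set Filter Metric
open scoped Topology

variable {N : Type*} [Group N] [MetricSpace N] {V : Type*} [NormedAddCommGroup V] [NormedSpace ℝ V]

/-- The cosets whose orbit, read in `V` through `f`, finally stays away from `p + Γ`. -/
def avoidingSet (Λ : Subgroup N) (f : N → V) (A : Module.End ℝ V) (Γ : AddSubgroup V) (p : V) :
    Set (N ⧸ Λ) :=
  {x | ∃ y : N, (y : N ⧸ Λ) = x ∧
    ∃ ε > 0, ∀ᶠ j : ℕ in atTop, ∀ γ ∈ Γ, ε ≤ ‖(A ^ j) (f y) - p - γ‖}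

lemma exists_mul_lt_two_pow (m : ℕ) : ∃ t, 0 < t ∧ m * t < 2 ^ t := by
  have h := tendsto_pow_const_div_const_pow_of_one_lt 1 (one_lt_two : (1 : ℝ) < 2)
  have h1 : ∀ᶠ t : ℕ in atTop, (t : ℝ) ^ 1 / 2 ^ t < 1 / (m + 1) :=
    h.eventually (gt_mem_nhds (by positivity))
  obtain ⟨t, ht, ht0⟩ := (h1.and (eventually_gt_atTop 0)).exists
  refine ⟨t, ht0, ?_⟩
  rw [pow_one, div_lt_div_iff₀ (by positivity) (by positivity), one_mul] at ht
  have : (m * t : ℝ) < 2 ^ t := by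
    have : (0 : ℝ) ≤ t := by positivity
    linarith
  exact_mod_cast this

/-- At a scale where `Aʲ ∘ f` maps balls to sets small compared with `δ₀`, the dangerous points for
`j` nearly share one value of `l ∘ f`. So one number per exponent `j` has to be avoided, and the
halving strategy does it. -/
theorem isAlphaWinning_avoidingSet [IsIsometricSMul Nᵐᵒᵖ N] [IsTopologicalGroup N]
    [CompleteSpace N] {Λ : Subgroup N} [DiscreteTopology Λ] (hN : HasFineChains N)
    {f : N → V} (hf : ∀ x y, f (x * y) = f x + f y) (hfc : Continuous f)
    {A : Module.End ℝ V} {Γ : AddSubgroup V} {δ₀ : ℝ} (hδ₀ : 0 < δ₀)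
    (hΓ : ∀ γ ∈ Γ, ‖γ‖ < δ₀ → γ = 0) {R C : ℝ} (hR : 1 < R) (hC : 0 < C)
    (hA : ∀ (j : ℕ) (v : V), ‖(A ^ j) v‖ ≤ C * R ^ j * ‖v‖) {l : V →L[ℝ] ℝ}
    (hl : ∀ (j : ℕ) (v : V), R ^ j * |l v| ≤ C * ‖(A ^ j) v‖) (h0 : ∃ x, l (f x) ≠ 0) (p : V)
    {α : ℝ} (hα0 : 0 < α) (hα : α ≤ 1 / 160) :
    IsAlphaWinning α (avoidingSet Λ f A Γ p) := by
  intro β hβ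
  obtain ⟨Cf, hCf, hCf'⟩ := exists_norm_hom_le hN hf hfc
  have hfl : ∀ x y, ‖f x - f y‖ ≤ Cf * dist x y := fun x y => by
    rw [← hom_mul_inv hf, ← dist_mul_inv_one]
    exact hCf' _
  have hlf : ∀ x y, l (f (x * y)) = l (f x) + l (f y) := fun x y => by rw [hf, map_add]
  obtain ⟨L, hL, hLip, hpush⟩ := exists_lipschitz_constant_attained hN (l := fun x => l (f x)) hlf
    (l.continuous.comp hfc) h0
  have hpush' : ∀ ρ : ℝ, ∃ g : N, 0 < ρ → dist g 1 ≤ ρ ∧ L * ρ / 8 ≤ l (f g) := fun ρ => by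
    by_cases hρ : 0 < ρ
    · obtain ⟨g, hg⟩ := hpush ρ hρ
      exact ⟨g, fun _ => hg⟩
    · exact ⟨1, fun h => absurd h hρ⟩
  choose push hpush using hpush'
  set θ := α * β with hθ
  have hθ0 : 0 < θ := mul_pos hα0 hβ.1
  have hθ1 : θ < 1 := by
    have : θ ≤ α := mul_le_of_le_one_right hα0.le hβ.2.le
    linarith
  -- While the radius shrinks by `θ ^ t`, at most `m * t` exponents enter, and `t` makes this less
  -- than `2 ^ t`.
  obtain ⟨m, hm⟩ := pow_unbounded_of_one_lt θ⁻¹ hR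
  obtain ⟨t, ht0, ht⟩ := exists_mul_lt_two_pow m
  -- If `R ^ j` times the radius is at most `δ`, then `Aʲ ∘ f` moves points at distance twice the
  -- radius by at most `δ₀ / 8`.
  set δ := δ₀ / (16 * C * Cf) with hδ
  have hδ0 : 0 < δ := by positivity
  have hδC : C * (Cf * 2) * δ = δ₀ / 8 := by rw [hδ]; field_simp; norm_num
  -- The first bound makes the nearby element of `Γ` unique; the second makes the spread of `l ∘ f`
  -- over dangerous points smaller than the gap won by the strategy.
  set ε := min (δ₀ / 8) (L / 32 * θ ^ (2 * t) * δ / (2 * C)) with hε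
  have hε0 : 0 < ε := lt_min (by positivity) (by positivity)
  have hε1 : ε ≤ δ₀ / 8 := min_le_left _ _
  have hε2 : 2 * C * ε ≤ L / 32 * θ ^ (2 * t) * δ := by
    have := min_le_right (δ₀ / 8) (L / 32 * θ ^ (2 * t) * δ / (2 * C))
    rw [← hε, le_div_iff₀ (by positivity)] at this
    linarith
  -- A block starting at time `k` treats the `j` with `δ * θ ^ t < R ^ j * (θ ^ k * r) ≤ δ`; the
  -- search finds where this window opens. The alternative `r ≤ 0` only makes it total.
  have hex : ∀ (r : ℝ) (k : ℕ), ∃ j : ℕ, δ * θ ^ t < R ^ j * (θ ^ k * r) ∨ r ≤ 0 := by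
    intro r k
    rcases le_or_gt r 0 with hr | hr
    · exact ⟨0, Or.inr hr⟩
    · obtain ⟨j, hj⟩ := pow_unbounded_of_one_lt (δ * θ ^ t / (θ ^ k * r)) hR
      exact ⟨j, Or.inl (by rwa [div_lt_iff₀ (by positivity)] at hj)⟩
  classical
  let first : ℝ → ℕ → ℕ := fun r k => Nat.find (hex r k)
  have hpt : ∀ (r : ℝ) (k : ℕ) (y : N) (j : ℕ), ∃ z : N,
      (∃ z', dist z' y ≤ θ ^ k * r ∧ ∃ γ ∈ Γ, ‖(A ^ j) (f z') - p - γ‖ < ε) →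
      dist z y ≤ θ ^ k * r ∧ ∃ γ ∈ Γ, ‖(A ^ j) (f z) - p - γ‖ < ε := by
    intro r k y j
    by_cases h : ∃ z', dist z' y ≤ θ ^ k * r ∧ ∃ γ ∈ Γ, ‖(A ^ j) (f z') - p - γ‖ < ε
    · obtain ⟨z, hz⟩ := h
      exact ⟨z, fun _ => hz⟩
    · exact ⟨1, fun h' => absurd h' h⟩
  choose pt hpt using hpt
  let D : AvoidanceData Λ :=
    { l := fun x => l (f x)
      push := push
      α := α
      β := β
      period := t
      renew := fun r k y => (Finset.Ico (first r k) (first r k + m * t)).image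
        fun j => l (f (pt r k y j)) }
  have hrad : ∀ r k, D.radius r k = θ ^ k * r := fun _ _ => rfl
  have hD : D.IsValid L :=
    { map_mul := hlf
      lipschitz := hLip
      L_pos := hL
      dist_push := fun ρ hρ => (hpush ρ hρ).1
      le_push := fun ρ hρ => (hpush ρ hρ).2
      α_pos := hα0
      α_le := hα
      β_mem := hβ
      card_renew := fun r k y => by
        refine Finset.card_image_le.trans_lt ?_
        rw [Nat.card_Ico, Nat.add_sub_cancel_left]
        exact ht }
  refine ⟨D.strategy, fun r hr b => ?_⟩
  simp only [D.strategy_apply]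
  refine ⟨fun k _ => hD.closedBall_answer_subset hr b k, fun hb => ?_⟩
  obtain ⟨x, hx, hxd, hfar⟩ := hD.strategy_spec hr b hb
  refine ⟨x, ⟨x, rfl, ε, hε0, ?_⟩, hx⟩
  -- For these `j` the window comes after round `0`, where no numbers have been imposed yet.
  have hlarge : ∀ᶠ j : ℕ in atTop, δ < R ^ j * r := by
    have := (tendsto_pow_atTop_atTop_of_one_lt hR).atTop_mul_const hr
    exact this.eventually_gt_atTop δ
  filter_upwards [hlarge] with j hj γ hγ
  by_contra! hlt
  have hRj : 0 < R ^ j := pow_pos (by linarith) j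
  -- the block in which the `j`-th obstacle is treated
  have hexs : ∃ s : ℕ, R ^ j * (θ ^ (s * t) * r) ≤ δ := by
    obtain ⟨s, hs⟩ := exists_pow_lt_of_lt_one (by positivity : 0 < δ / (R ^ j * r)) hθ1
    refine ⟨s, ?_⟩
    have h1 : θ ^ (s * t) ≤ θ ^ s :=
      pow_le_pow_of_le_one hθ0.le hθ1.le (Nat.le_mul_of_pos_right s ht0)
    have h2 := h1.trans hs.le
    rw [le_div_iff₀ (by positivity)] at h2
    linarith
  obtain ⟨s, hs⟩ : ∃ s, Nat.find hexs = s + 1 := by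
    refine Nat.exists_eq_succ_of_ne_zero fun h => ?_
    have := Nat.find_spec hexs
    rw [h, zero_mul, pow_zero, one_mul] at this
    linarith
  have hs1 : R ^ j * (θ ^ ((s + 1) * t) * r) ≤ δ := by rw [← hs]; exact Nat.find_spec hexs
  have hs2 : δ < R ^ j * (θ ^ (s * t) * r) := not_le.1 (Nat.find_min hexs (by omega))
  set k := (s + 1) * t with hk
  have hθk : θ ^ k = θ ^ (s * t) * θ ^ t := by rw [hk, add_mul, one_mul, pow_add]
  have hjmem : j ∈ Finset.Ico (first r k) (first r k + m * t) := by
    rw [Finset.mem_Ico]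
    constructor
    · refine Nat.find_min' (hex r k) (Or.inl ?_)
      have := mul_lt_mul_of_pos_right hs2 (pow_pos hθ0 t)
      rw [hθk]
      linarith
    · by_contra! hge
      have hf : δ * θ ^ t < R ^ first r k * (θ ^ k * r) :=
        (Nat.find_spec (hex r k)).resolve_right (not_le.2 hr)
      have h1 : (θ ^ t)⁻¹ ≤ R ^ (m * t) := by
        rw [pow_mul, ← inv_pow]
        exact pow_le_pow_left₀ (by positivity) hm.le t
      have h2 : R ^ first r k * R ^ (m * t) ≤ R ^ j := by
        rw [← pow_add]
        exact pow_le_pow_right₀ hR.le hge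
      have h3 : δ < R ^ j * (θ ^ k * r) := by
        calc δ = δ * θ ^ t * (θ ^ t)⁻¹ := by field_simp
          _ < R ^ first r k * (θ ^ k * r) * (θ ^ t)⁻¹ := by gcongr
          _ ≤ R ^ first r k * (θ ^ k * r) * R ^ (m * t) := by gcongr
          _ = R ^ first r k * R ^ (m * t) * (θ ^ k * r) := by ring
          _ ≤ R ^ j * (θ ^ k * r) := by gcongr
      linarith
  set y := (D.state r b k).1 with hy
  have hxy : dist x y ≤ θ ^ k * r := hxd k
  obtain ⟨hz, γ', hγ', hzγ⟩ := hpt r k y j ⟨x, hxy, γ, hγ, hlt⟩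
  set z := pt r k y j with hzdef
  have hkpos : 0 < k := by positivity
  have hfar' := hfar k hkpos (Dvd.intro_left _ rfl) (l (f z))
    (Finset.mem_image_of_mem (fun j => l (f (pt r k y j))) hjmem)
  have hdist : dist x z ≤ 2 * (θ ^ k * r) := by
    have := dist_triangle_right x z y
    linarith
  have hAd : ‖(A ^ j) (f x - f z)‖ ≤ δ₀ / 8 := by
    calc ‖(A ^ j) (f x - f z)‖ ≤ C * R ^ j * ‖f x - f z‖ := hA _ _
      _ ≤ C * R ^ j * (Cf * (2 * (θ ^ k * r))) := by
          gcongr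
          exact (hfl x z).trans (by gcongr)
      _ = C * (Cf * 2) * (R ^ j * (θ ^ k * r)) := by ring
      _ ≤ C * (Cf * 2) * δ := by gcongr
      _ = δ₀ / 8 := hδC
  -- The two lattice vectors differ by at most `2 * ε + δ₀ / 8 < δ₀`, so `x` and the chosen
  -- dangerous point `z` approach the same target. The values of `l ∘ f` at `x` and `z` are then too
  -- close.
  have hγγ : γ' = γ := by
    refine sub_eq_zero.1 (hΓ _ (sub_mem hγ' hγ) ?_)
    have e : γ' - γ = ((A ^ j) (f x) - p - γ) - ((A ^ j) (f z) - p - γ') - (A ^ j) (f x - f z) := by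
      rw [map_sub]; abel
    calc ‖γ' - γ‖ ≤ ‖(A ^ j) (f x) - p - γ‖ + ‖(A ^ j) (f z) - p - γ'‖ + ‖(A ^ j) (f x - f z)‖ := by
          rw [e]
          exact (norm_sub_le _ _).trans (add_le_add_left (norm_sub_le _ _) _)
      _ < δ₀ := by linarith
  rw [hγγ] at hzγ
  have h1 : R ^ j * |l (f x) - l (f z)| < 2 * C * ε := by
    have h3 : ‖(A ^ j) (f x - f z)‖ < 2 * ε := by
      have e : (A ^ j) (f x - f z) = ((A ^ j) (f x) - p - γ) - ((A ^ j) (f z) - p - γ) := by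
        rw [map_sub]; abel
      rw [e]
      linarith [norm_sub_le ((A ^ j) (f x) - p - γ) ((A ^ j) (f z) - p - γ)]
    have := hl j (f x - f z)
    rw [map_sub] at this
    calc _ ≤ C * ‖(A ^ j) (f x - f z)‖ := this
      _ < C * (2 * ε) := by gcongr
      _ = 2 * C * ε := by ring
  have h2 : L / 32 * θ ^ (2 * t) * δ ≤ R ^ j * |l (f x) - l (f z)| := by
    have e : D.radius r (k + D.period) = θ ^ (2 * t) * (θ ^ (s * t) * r) := by
      rw [hrad, show k + D.period = 2 * t + s * t by rw [hk]; change (s + 1) * t + t = _; ring,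
        pow_add, mul_assoc]
    rw [e] at hfar'
    calc L / 32 * θ ^ (2 * t) * δ ≤ L / 32 * θ ^ (2 * t) * (R ^ j * (θ ^ (s * t) * r)) := by gcongr
      _ = R ^ j * (L / 32 * (θ ^ (2 * t) * (θ ^ (s * t) * r))) := by ring
      _ ≤ R ^ j * |l (f x) - l (f z)| := by gcongr
  linarith

end Target

/-! ### Dimension of winning sets -/

section Dimension

open Set Filter Metric
open scoped Topology NNReal ENNReal

section

variable {X : Type*}

/-- The centres chosen by the second player when he answers according to `next` and the digits
`u`. -/
def playOfDigits {m : ℕ} (next : (k : ℕ) → (Fin (k + 1) → X) → Fin m → X) (x₀ : X)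
    (u : ℕ → Fin m) : ℕ → ℕ → X
  | 0 => fun _ => x₀
  | k + 1 => Function.update (playOfDigits next x₀ u k) (k + 1)
      (next k (fun i => playOfDigits next x₀ u k i) (u k))

lemma playOfDigits_of_le {m : ℕ} (next : (k : ℕ) → (Fin (k + 1) → X) → Fin m → X) (x₀ : X)
    (u : ℕ → Fin m) {i k : ℕ} (h : i ≤ k) :
    playOfDigits next x₀ u k i = playOfDigits next x₀ u i i := by
  induction k, h using Nat.le_induction with
  | base => rfl
  | succ k hk ih =>
    rw [playOfDigits, Function.update_of_ne (by omega), ih]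

lemma playOfDigits_congr {m : ℕ} (next : (k : ℕ) → (Fin (k + 1) → X) → Fin m → X) (x₀ : X)
    {u u' : ℕ → Fin m} {k : ℕ} (h : ∀ i < k, u i = u' i) :
    playOfDigits next x₀ u k = playOfDigits next x₀ u' k := by
  induction k with
  | zero => rfl
  | succ k ih =>
    rw [playOfDigits, playOfDigits, ih fun i hi => h i (by omega), h k (by omega)]

lemma playOfDigits_succ {m : ℕ} (next : (k : ℕ) → (Fin (k + 1) → X) → Fin m → X) (x₀ : X)
    (u : ℕ → Fin m) (k : ℕ) : playOfDigits next x₀ u (k + 1) (k + 1) =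
      next k (fun i => playOfDigits next x₀ u i i) (u k) := by
  rw [playOfDigits, Function.update_self]
  congr 1
  funext i
  exact playOfDigits_of_le next x₀ u (Nat.lt_succ_iff.1 i.2)

end

variable {X : Type*} [MetricSpace X]

/-- Small balls of radius `r` contain `q ^ n` points with mutual distances at least a constant
times `r / q`. -/
def HasPacking (X : Type*) [MetricSpace X] (n : ℕ) : Prop :=
  ∃ κ > 0, ∃ r₀ > 0, ∀ q : ℕ, 0 < q → ∀ (x : X) (r : ℝ), 0 < r → r ≤ r₀ →
    ∃ y : Fin (q ^ n) → X, (∀ i, dist (y i) x ≤ r / 2) ∧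
      ∀ i j, i ≠ j → κ * r / q ≤ dist (y i) (y j)

/-- A set parametrized by the sequences of `m` digits, with points at distance at least
`c * θ ^ k` when the sequences differ at the `k`-th digit, has dimension at least
`log m / log θ⁻¹`. -/
lemma le_dimH_of_digits {m : ℕ} (hm : 1 < m) {θ : ℝ} (hθ0 : 0 < θ) (hθ1 : θ < 1) {c : ℝ}
    (hc : 0 < c) {x : (ℕ → Fin m) → X} {T : Set X} (hT : ∀ u, x u ∈ T)
    (hx : ∀ u u' k, (∀ i < k, u i = u' i) → u k ≠ u' k → c * θ ^ k ≤ dist (x u) (x u')) :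
    ENNReal.ofReal (Real.log m / Real.log θ⁻¹) ≤ dimH T := by
  have hm' : (1 : ℝ) < m := by exact_mod_cast hm
  have hlogm : 0 < Real.log m := Real.log_pos hm'
  have hlogθ : 0 < Real.log θ⁻¹ := Real.log_pos ((one_lt_inv₀ hθ0).2 hθ1)
  set s : ℝ := Real.log m / Real.log θ⁻¹ with hs
  have hs0 : 0 < s := div_pos hlogm hlogθ
  have hθs : θ ^ s = (m : ℝ)⁻¹ := by
    rw [Real.rpow_def_of_pos hθ0, ← Real.exp_log (by positivity : (0 : ℝ) < (m : ℝ)⁻¹),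
      Real.log_inv, hs]
    rw [Real.log_inv] at hlogθ ⊢
    congr 1
    have : Real.log θ ≠ 0 := by linarith
    field_simp
  have hfirst : ∀ u u' : ℕ → Fin m, u ≠ u' → ∃ k, (∀ i < k, u i = u' i) ∧ u k ≠ u' k := by
    intro u u' h
    have hex := Function.ne_iff.1 h
    classical
    exact ⟨Nat.find hex, fun i hi => not_not.1 (Nat.find_min hex hi), Nat.find_spec hex⟩
  have hinj : Function.Injective x := by
    intro u u' h
    by_contra hne
    obtain ⟨k, h1, h2⟩ := hfirst u u' hne
    have := hx u u' k h1 h2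
    rw [h, dist_self] at this
    exact absurd this (not_le.2 (by positivity))
  have hne : Nonempty (ℕ → Fin m) := ⟨fun _ => ⟨0, by omega⟩⟩
  -- Reading the digits in base `m` maps the set onto `[0, 1]`, and since `θ ^ s = 1 / m` this map
  -- is Hölder of exponent `s`.
  let g : X → ℝ := fun z => Real.ofDigits (Function.invFun x z)
  have hg : ∀ u, g (x u) = Real.ofDigits u := fun u => by
    simp only [g, Function.leftInverse_invFun hinj u]
  have hC0 : 0 ≤ (c ^ s)⁻¹ := by positivity
  have hhold : HolderOnWith (Real.toNNReal (c ^ s)⁻¹) (Real.toNNReal s) g (range x) := by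
    rintro _ ⟨u, rfl⟩ _ ⟨u', rfl⟩
    rw [hg, hg, edist_dist, edist_dist, Real.coe_toNNReal _ hs0.le,
      ENNReal.ofReal_rpow_of_nonneg dist_nonneg hs0.le, ← ENNReal.ofReal.eq_1,
      ← ENNReal.ofReal_mul hC0]
    refine ENNReal.ofReal_le_ofReal ?_
    rcases eq_or_ne u u' with rfl | hne
    · rw [dist_self]; positivity
    obtain ⟨k, h1, h2⟩ := hfirst u u' hne
    have h3 := Real.rpow_le_rpow (by positivity) (hx u u' k h1 h2) hs0.le
    rw [Real.mul_rpow hc.le (by positivity), ← Real.rpow_natCast, ← Real.rpow_mul hθ0.le,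
      mul_comm (k : ℝ) s, Real.rpow_mul hθ0.le, hθs, Real.rpow_natCast, inv_pow] at h3
    rw [Real.dist_eq]
    calc _ ≤ ((m : ℝ) ^ k)⁻¹ := Real.abs_ofDigits_sub_ofDigits_le h1
      _ = (c ^ s)⁻¹ * (c ^ s * ((m : ℝ) ^ k)⁻¹) := by
          have : c ^ s ≠ 0 := (Real.rpow_pos_of_pos hc s).ne'
          field_simp
      _ ≤ _ := by gcongr
  have h1 := hhold.dimH_image_le (Real.toNNReal_pos.2 hs0)
  have h2 : Icc (0 : ℝ) 1 ⊆ g '' range x := by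
    intro t ht
    obtain ⟨u, -, hu⟩ := Real.ofDigits_SurjOn hm ht
    exact ⟨x u, ⟨u, rfl⟩, (hg u).trans hu⟩
  have h3 : dimH (Icc (0 : ℝ) 1) = 1 := by
    rw [Real.dimH_of_nonempty_interior (by rw [interior_Icc]; exact nonempty_Ioo.2 one_pos)]
    simp
  have h4 : (1 : ℝ≥0∞) ≤ dimH (range x) / Real.toNNReal s := by
    rw [← h3]; exact (dimH_mono h2).trans h1
  rw [ENNReal.le_div_iff_mul_le (Or.inl (by simpa using hs0)) (Or.inl ENNReal.coe_ne_top),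
    one_mul] at h4
  exact h4.trans (dimH_mono (range_subset_iff.2 hT))

lemma tendsto_dimension_bound (n : ℕ) (c : ℝ) :
    Tendsto (fun q : ℕ => n * Real.log q / (Real.log q + c)) atTop (𝓝 n) := by
  have h1 : Tendsto (fun q : ℕ => Real.log q + c) atTop atTop :=
    tendsto_atTop_add_const_right _ _ (Real.tendsto_log_atTop.comp tendsto_natCast_atTop_atTop)
  have h2 : Tendsto (fun q : ℕ => (n : ℝ) - n * (c / (Real.log q + c))) atTop
      (𝓝 (n - n * 0)) := ((h1.const_div_atTop c).const_mul _).const_sub _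
  rw [mul_zero, sub_zero] at h2
  refine h2.congr' ?_
  filter_upwards [h1.eventually_gt_atTop 0] with q hq
  field_simp
  ring

/-- A winning set has full dimension in every open set. -/
theorem le_dimH_of_isAlphaWinning {n : ℕ} (hn : 0 < n) (hX : HasPacking X n) {α : ℝ}
    (hα : α ∈ Ioo (0 : ℝ) 1) {S : Set X} (hS : IsAlphaWinning α S) {U : Set X} (hU : IsOpen U)
    (hUne : U.Nonempty) : (n : ℝ≥0∞) ≤ dimH (S ∩ U) := by
  obtain ⟨κ, hκ, r₀, hr₀, hpack⟩ := hX
  obtain ⟨x₀, hx₀⟩ := hUne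
  obtain ⟨r₁, hr₁, hball⟩ := Metric.nhds_basis_closedBall.mem_iff.1 (hU.mem_nhds hx₀)
  set r := min r₀ r₁ with hr
  have hr0 : 0 < r := lt_min hr₀ hr₁
  have hα0 := hα.1
  have hlim : Tendsto (fun q : ℕ => ENNReal.ofReal
      (n * Real.log q / (Real.log q + Real.log (3 / (α * κ))))) atTop (𝓝 (n : ℝ≥0∞)) := by
    rw [← ENNReal.ofReal_natCast]
    exact (ENNReal.continuous_ofReal.tendsto _).comp (tendsto_dimension_bound n _)
  refine le_of_tendsto hlim ?_
  have hlarge : ∀ᶠ q : ℕ in atTop, κ < (q : ℝ) :=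
    tendsto_natCast_atTop_atTop.eventually_gt_atTop κ
  filter_upwards [hlarge, eventually_gt_atTop 1] with q hqκ hq1
  have hq0 : (0 : ℝ) < q := by positivity
  -- With this `β`, points of the packing are at least three of the next radii apart.
  set β := κ / (3 * q) with hβ
  have hβ0 : 0 < β := by positivity
  have hβ1 : β ≤ 1 / 3 := by
    rw [hβ, div_le_div_iff₀ (by positivity) (by norm_num)]; linarith
  set θ := α * β with hθ
  have hθ0 : 0 < θ := mul_pos hα0 hβ0
  have hθ1 : θ < 1 := by nlinarith [hα.2]
  obtain ⟨σ, hσ⟩ := hS β ⟨hβ0, by linarith⟩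
  have hρ : ∀ k : ℕ, 0 < θ ^ k * r := fun k => by positivity
  have hρ' : ∀ k : ℕ, α * (θ ^ k * r) ≤ r₀ := fun k => by
    calc α * (θ ^ k * r) ≤ 1 * (1 * r) := by
          gcongr
          · exact hα.2.le
          · exact pow_le_one₀ hθ0.le hθ1.le
      _ ≤ r₀ := by rw [one_mul, one_mul]; exact min_le_left _ _
  have hnext : ∀ (k : ℕ) (a : X), ∃ y : Fin (q ^ n) → X,
      (∀ i, dist (y i) a ≤ α * (θ ^ k * r) / 2) ∧
        ∀ i j, i ≠ j → κ * (α * (θ ^ k * r)) / q ≤ dist (y i) (y j) := fun k a =>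
    hpack q (by omega) a _ (mul_pos hα0 (hρ k)) (hρ' k)
  choose y hy1 hy2 using hnext
  let next : (k : ℕ) → (Fin (k + 1) → X) → Fin (q ^ n) → X := fun k h => y k (σ r k h)
  let b : (ℕ → Fin (q ^ n)) → ℕ → X := fun u k => playOfDigits next x₀ u k k
  have hb : ∀ u k, b u (k + 1) = y k (σ r k fun i => b u i) (u k) := fun u k =>
    playOfDigits_succ next x₀ u k
  have hlegal : ∀ u k, closedBall (b u (k + 1)) (θ ^ (k + 1) * r) ⊆
      closedBall (σ r k fun i => b u i) (α * (θ ^ k * r)) := by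
    intro u k
    refine closedBall_subset_closedBall' ?_
    have h1 := hy1 k (σ r k fun i => b u i) (u k)
    rw [← hb] at h1
    have h2 : θ ^ (k + 1) * r = β * (α * (θ ^ k * r)) := by rw [pow_succ, hθ]; ring
    have h3 : β * (α * (θ ^ k * r)) ≤ 1 / 3 * (α * (θ ^ k * r)) :=
      mul_le_mul_of_nonneg_right hβ1 (mul_pos hα0 (hρ k)).le
    have := mul_pos hα0 (hρ k)
    linarith
  have hwin : ∀ u, ∃ x ∈ S, ⋂ k, closedBall (σ r k fun i => b u i) (α * (θ ^ k * r)) = {x} :=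
    fun u => (hσ r hr0 (b u)).2 (hlegal u)
  choose x hxS hx using hwin
  have hxB : ∀ u k, dist (x u) (b u k) ≤ θ ^ k * r := by
    intro u k
    have h1 : x u ∈ closedBall (σ r k fun i => b u i) (α * (θ ^ k * r)) :=
      mem_iInter.1 (by rw [hx u]; rfl) k
    exact (hσ r hr0 (b u)).1 k (fun j _ => hlegal u j) h1
  have hmain := le_dimH_of_digits (m := q ^ n) (Nat.one_lt_pow hn.ne' hq1) hθ0 hθ1
    (mul_pos hθ0 hr0) (x := x) (T := S ∩ U) (fun u => ⟨hxS u, hball ?_⟩) ?_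
  · have h1 : θ⁻¹ = q * (3 / (α * κ)) := by rw [hθ, hβ]; field_simp
    rwa [h1, Real.log_mul hq0.ne' (by positivity), Nat.cast_pow, Real.log_pow] at hmain
  · have := hxB u 0
    rw [pow_zero, one_mul] at this
    exact mem_closedBall.2 (this.trans (min_le_right _ _))
  · intro u u' k hagree hne
    have hbi : ∀ i ≤ k, b u i = b u' i := fun i hi => by
      have := playOfDigits_congr next x₀ (k := i) fun j hj => hagree j (by omega)
      exact congrFun this i
    have h1 : (fun i : Fin (k + 1) => b u i) = fun i : Fin (k + 1) => b u' i := by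
      funext i
      exact hbi i (Nat.lt_succ_iff.1 i.2)
    -- Both plays have met the same answer so far; the `k`-th digits choose centres three radii
    -- apart, and each limit stays within one radius of its centre.
    have h2 := hy2 k (σ r k fun i => b u i) (u k) (u' k) hne
    rw [← hb, h1, ← hb] at h2
    have h3 := hxB u (k + 1)
    have h4 := hxB u' (k + 1)
    have h5 : κ * (α * (θ ^ k * r)) / q = 3 * (θ ^ (k + 1) * r) := by
      have : θ ^ (k + 1) = θ ^ k * (α * (κ / (3 * q))) := by rw [pow_succ]
      rw [this]
      field_simp
    have h6 := dist_triangle4 (b u (k + 1)) (x u) (x u') (b u' (k + 1))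
    rw [dist_comm (b u (k + 1)) (x u)] at h6
    rw [h5] at h2
    have h7 : θ * r * θ ^ k = θ ^ (k + 1) * r := by ring
    rw [h7]
    linarith

end Dimension

/-! ### Local geometry of the nilmanifold -/

section Geometry

open Set Filter Metric
open scoped Topology NNReal ENNReal

/-- A neighbourhood of `x` is bilipschitz equivalent to a ball of `E`. -/
def HasBilipschitzChart (E : Type*) [NormedAddCommGroup E] {X : Type*} [MetricSpace X] (x : X) :
    Prop :=
  ∃ (g : E → X) (c : E) (ρ C : ℝ), 0 < ρ ∧ 0 < C ∧ g c = x ∧ g '' ball c ρ ∈ 𝓝 x ∧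
    (∀ u ∈ ball c ρ, ∀ v ∈ ball c ρ, dist (g u) (g v) ≤ C * dist u v) ∧
    ∀ u ∈ ball c ρ, ∀ v ∈ ball c ρ, dist u v ≤ C * dist (g u) (g v)

lemma hasBilipschitzChart_of_isRiemannianManifold {E : Type*} [NormedAddCommGroup E]
    [NormedSpace ℝ E] {H : Type*} [TopologicalSpace H] (I : ModelWithCorners ℝ E H)
    [I.Boundaryless] {M : Type*} [MetricSpace M] [ChartedSpace H M] [IsManifold I 1 M]
    [Bundle.RiemannianBundle (fun x : M => TangentSpace I x)]
    [IsContinuousRiemannianBundle E (fun x : M => TangentSpace I x)] [IsRiemannianManifold I M]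
    (x : M) : HasBilipschitzChart E x := by
  obtain ⟨C₁, hC₁, r₁, hr₁, htar, h1⟩ := exists_edist_le_extChartAt I x
  obtain ⟨C₂, hC₂, r₂, hr₂, hsrc, h2⟩ := exists_edist_extChartAt_le I x
  set ψ := extChartAt I x with hψ
  have h1' : ∀ u ∈ ball (ψ x) r₁, ∀ v ∈ ball (ψ x) r₁,
      dist (ψ.symm u) (ψ.symm v) ≤ C₁ * dist u v := fun u hu v hv => by
    have := h1 u hu v hv
    rw [edist_nndist, edist_nndist, ← ENNReal.coe_mul, ENNReal.coe_le_coe] at this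
    exact_mod_cast this
  have h2' : ∀ y ∈ ball x r₂, ∀ z ∈ ball x r₂, dist (ψ y) (ψ z) ≤ C₂ * dist y z :=
    fun u hu v hv => by
    have := h2 u hu v hv
    rw [edist_nndist, edist_nndist, ← ENNReal.coe_mul, ENNReal.coe_le_coe] at this
    exact_mod_cast this
  have hC₁' : (0 : ℝ) < C₁ := hC₁
  have hC₂' : (0 : ℝ) < C₂ := hC₂
  have hxx : ψ.symm (ψ x) = x := extChartAt_to_inv x
  set ρ := min r₁ (r₂ / C₁) with hρ
  have hρ0 : 0 < ρ := lt_min hr₁ (by positivity)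
  have hsub : ball (ψ x) ρ ⊆ ball (ψ x) r₁ := ball_subset_ball (min_le_left _ _)
  have hmem : ∀ u ∈ ball (ψ x) ρ, ψ.symm u ∈ ball x r₂ := fun u hu => by
    have h3 := h1' u (hsub hu) (ψ x) (mem_ball_self hr₁)
    rw [hxx] at h3
    rw [mem_ball]
    have h4 : dist u (ψ x) < r₂ / C₁ := lt_of_lt_of_le (mem_ball.1 hu) (min_le_right _ _)
    rw [lt_div_iff₀ hC₁'] at h4
    linarith
  refine ⟨ψ.symm, ψ x, ρ, C₁ + C₂, hρ0, by positivity, hxx, ?_, fun u hu v hv => ?_,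
    fun u hu v hv => ?_⟩
  · have h5 : ψ ⁻¹' ball (ψ x) ρ ∈ 𝓝 x :=
      (continuousAt_extChartAt x).preimage_mem_nhds (ball_mem_nhds _ hρ0)
    filter_upwards [h5, ball_mem_nhds x hr₂] with y hy hy2
    exact ⟨ψ y, hy, ψ.left_inv (hsrc hy2)⟩
  · refine (h1' u (hsub hu) v (hsub hv)).trans ?_
    gcongr
    linarith
  · have h6 := h2' _ (hmem u hu) _ (hmem v hv)
    rw [ψ.right_inv (htar (hsub hu)), ψ.right_inv (htar (hsub hv))] at h6
    refine h6.trans ?_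
    gcongr
    linarith

/-- The grid points `h * i / q` of a cube of side `h` in Euclidean space. -/
lemma exists_grid {n : ℕ} : ∃ K > 0, ∀ (c : EuclideanSpace ℝ (Fin n)) (q : ℕ), 0 < q →
    ∀ h : ℝ, 0 < h → ∃ u : Fin (q ^ n) → EuclideanSpace ℝ (Fin n),
      (∀ i, dist (u i) c ≤ K * h) ∧ ∀ i j, i ≠ j → h / q ≤ dist (u i) (u j) := by
  let e := EuclideanSpace.equiv (Fin n) ℝ
  refine ⟨‖(e.symm : (Fin n → ℝ) →L[ℝ] EuclideanSpace ℝ (Fin n))‖ + 1, by positivity,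
    fun c q hq h hh => ?_⟩
  have hq' : (0 : ℝ) < q := by exact_mod_cast hq
  let w : (Fin n → Fin q) → (Fin n → ℝ) := fun a l => h * (a l : ℝ) / q
  have hw : ∀ a, ‖w a‖ ≤ h := fun a => by
    refine (pi_norm_le_iff_of_nonneg hh.le).2 fun l => ?_
    have : ((a l : ℕ) : ℝ) ≤ q := by exact_mod_cast (a l).2.le
    rw [Real.norm_of_nonneg (by positivity), div_le_iff₀ hq']
    gcongr
  refine ⟨fun i => c + e.symm (w (finFunctionFinEquiv.symm i)), fun i => ?_, fun i j hij => ?_⟩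
  · rw [dist_eq_norm, add_sub_cancel_left]
    calc _ ≤ ‖(e.symm : (Fin n → ℝ) →L[ℝ] EuclideanSpace ℝ (Fin n))‖ *
          ‖w (finFunctionFinEquiv.symm i)‖ :=
          (e.symm : (Fin n → ℝ) →L[ℝ] EuclideanSpace ℝ (Fin n)).le_opNorm _
      _ ≤ _ := by
          gcongr
          · linarith
          · exact hw _
  · have hne : finFunctionFinEquiv.symm i ≠ finFunctionFinEquiv.symm j :=
      fun h => hij (finFunctionFinEquiv.symm.injective h)
    obtain ⟨l, hl⟩ := Function.ne_iff.1 hne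
    set a := finFunctionFinEquiv.symm i
    set b := finFunctionFinEquiv.symm j
    rw [dist_add_left, dist_eq_norm, ← map_sub]
    refine le_trans ?_ (PiLp.norm_apply_le (e.symm (w a - w b)) l)
    change h / q ≤ ‖h * (a l : ℝ) / q - h * (b l : ℝ) / q‖
    have e1 : h * (a l : ℝ) / q - h * (b l : ℝ) / q = h / q * ((a l : ℝ) - (b l : ℝ)) := by ring
    rw [e1, norm_mul, Real.norm_of_nonneg (by positivity : 0 ≤ h / q)]
    refine le_mul_of_one_le_right (by positivity) ?_
    have h1 : ((a l : ℕ) : ℤ) - ((b l : ℕ) : ℤ) ≠ 0 := by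
      rw [sub_ne_zero]
      exact fun h => hl (Fin.ext (by exact_mod_cast h))
    have h2 := Int.one_le_abs h1
    rw [Real.norm_eq_abs]
    exact_mod_cast h2

section Group

variable {N : Type*} [Group N] [MetricSpace N] [IsIsometricSMul Nᵐᵒᵖ N]

lemma dist_mul_self_right (g x : N) : dist (g * x) x = dist g 1 := by
  have := dist_mul_right g 1 x
  rwa [one_mul] at this

/-- A locally compact group with a right invariant metric is complete. -/
lemma completeSpace_of_locallyCompact [IsTopologicalGroup N] [LocallyCompactSpace N] :
    CompleteSpace N := by
  obtain ⟨K, hK, hKn⟩ := exists_compact_mem_nhds (1 : N)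
  obtain ⟨ε, hε, hεK⟩ := Metric.mem_nhds_iff.1 hKn
  refine Metric.complete_of_cauchySeq_tendsto fun u hu => ?_
  obtain ⟨m, hm⟩ := Metric.cauchySeq_iff.1 hu ε hε
  -- Right translation carries the tail of the sequence into the compact neighbourhood of `1`.
  have hmem : ∀ k, u (m + k) * (u m)⁻¹ ∈ K := fun k => hεK (by
    rw [mem_ball, dist_mul_inv_one]
    exact hm _ (by omega) _ le_rfl)
  obtain ⟨a, -, φ, hφ, ha⟩ := hK.tendsto_subseq hmem
  refine ⟨a * u m, tendsto_nhds_of_cauchySeq_of_subseq hu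
    (tendsto_atTop_mono (fun k => Nat.le_add_left (φ k) m) hφ.tendsto_atTop) ?_⟩
  have := ha.mul_const (u m)
  simpa [Function.comp_def] using this

variable [IsTopologicalGroup N] {Λ : Subgroup N} [DiscreteTopology Λ]

lemma exists_mem_nhds_one_of_discrete {G : Type*} [Group G] [TopologicalSpace G]
    (Λ : Subgroup G) [DiscreteTopology Λ] : ∃ U ∈ 𝓝 (1 : G), ∀ g ∈ Λ, g ∈ U → g = 1 := by
  obtain ⟨W, hW, hWΛ⟩ := isOpen_induced_iff.1 (isOpen_discrete ({1} : Set Λ))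
  refine ⟨W, hW.mem_nhds ?_, fun g hg hgW => ?_⟩
  · have : (1 : Λ) ∈ Subtype.val ⁻¹' W := by rw [hWΛ]; rfl
    exact this
  · have : (⟨g, hg⟩ : Λ) ∈ Subtype.val ⁻¹' W := hgW
    rw [hWΛ] at this
    exact congrArg Subtype.val this

/-- The injectivity radius of the quotient is positive. -/
lemma exists_injectivity_radius (Λ : Subgroup N) [DiscreteTopology Λ] [CompactSpace (N ⧸ Λ)] :
    ∃ ρ > 0, ∀ x : N, ∀ g ∈ Λ, dist x (x * g) < ρ → g = 1 := by
  obtain ⟨U, hU, hUΛ⟩ := exists_mem_nhds_one_of_discrete Λ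
  have key : ∃ ρ > 0, ∀ x : N, (x : N ⧸ Λ) ∈ (univ : Set (N ⧸ Λ)) → ∀ g ∈ Λ,
      dist x (x * g) < ρ → g = 1 := by
    refine isCompact_univ.induction_on (p := fun t : Set (N ⧸ Λ) => ∃ ρ > 0, ∀ x : N,
      (x : N ⧸ Λ) ∈ t → ∀ g ∈ Λ, dist x (x * g) < ρ → g = 1) ⟨1, one_pos, by simp⟩ ?_ ?_ ?_
    · rintro s t hst ⟨ρ, hρ, h⟩
      exact ⟨ρ, hρ, fun x hx => h x (hst hx)⟩
    · rintro s t ⟨ρ, hρ, h⟩ ⟨ρ', hρ', h'⟩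
      refine ⟨min ρ ρ', lt_min hρ hρ', fun x hx g hg hd => ?_⟩
      rcases hx with hx | hx
      · exact h x hx g hg (hd.trans_le (min_le_left _ _))
      · exact h' x hx g hg (hd.trans_le (min_le_right _ _))
    · intro a _
      obtain ⟨c, rfl⟩ := QuotientGroup.mk_surjective a
      have hcont : ContinuousAt (fun z : N × N => z.1⁻¹ * z.2) (c, c) := by fun_prop
      have hpre : (fun z : N × N => z.1⁻¹ * z.2) ⁻¹' U ∈ 𝓝 (c, c) :=
        hcont.preimage_mem_nhds (by simpa using hU)
      obtain ⟨ε, hε, hεU⟩ := Metric.mem_nhds_iff.1 hpre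
      refine ⟨ball (c : N ⧸ Λ) (ε / 2), mem_nhdsWithin_of_mem_nhds (ball_mem_nhds _ (half_pos hε)),
        ε / 2, half_pos hε, fun x hx g hg hd => ?_⟩
      obtain ⟨y, hyx, hcy⟩ := exists_of_cosetDist_lt Λ (mem_ball'.1 hx)
      -- Passing from `x` to the representative `y = x * k` near `c` replaces `g` by its conjugate
      -- `k⁻¹ * g * k`, without changing the displacement.
      have hk : x⁻¹ * y ∈ Λ := QuotientGroup.eq.1 hyx.symm
      set k := x⁻¹ * y with hkdef
      have hy : y = x * k := by rw [hkdef, mul_inv_cancel_left]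
      have hd2 : dist y (x * g * k) < ε / 2 := by
        rw [hy, dist_mul_right]; exact hd
      have h3 : y⁻¹ * (x * g * k) = k⁻¹ * g * k := by rw [hy]; group
      have h4 : k⁻¹ * g * k = 1 := by
        refine hUΛ _ (mul_mem (mul_mem (inv_mem hk) hg) hk) ?_
        rw [← h3]
        refine hεU (show (y, x * g * k) ∈ ball (c, c) ε from ?_)
        rw [← ball_prod_same]
        constructor
        · exact mem_ball'.2 (by linarith)
        · refine mem_ball'.2 ?_
          change dist c (x * g * k) < ε
          linarith [dist_triangle c y (x * g * k)]
      have h5 : g = k * (k⁻¹ * g * k) * k⁻¹ := by group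
      rw [h5, h4]
      group
  obtain ⟨ρ, hρ, h⟩ := key
  exact ⟨ρ, hρ, fun x => h x (mem_univ _)⟩

/-- A representative of `yΛ` closer to `x` than `y` would differ from `y` by a lattice element of
displacement less than `ρ`. -/
lemma dist_mk_eq {ρ : ℝ} (hρ : ∀ x : N, ∀ g ∈ Λ, dist x (x * g) < ρ → g = 1) {x y : N}
    (hxy : dist x y ≤ ρ / 2) : dist (x : N ⧸ Λ) (y : N ⧸ Λ) = dist x y := by
  refine le_antisymm (cosetDist_mk_le Λ x y) (le_of_not_gt fun hlt => ?_)
  obtain ⟨z, hz, hd⟩ := exists_of_cosetDist_lt Λ hlt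
  have hg : y⁻¹ * z ∈ Λ := QuotientGroup.eq.1 hz.symm
  have h1 : dist y (y * (y⁻¹ * z)) < ρ := by
    rw [mul_inv_cancel_left]
    linarith [dist_triangle_left y z x]
  have h2 := hρ y _ hg h1
  rw [inv_mul_eq_one] at h2
  rw [h2] at hd
  exact lt_irrefl _ hd

/-- A Euclidean grid is carried by the chart at `1`, translated isometrically to `x` and projected
below the injectivity radius. -/
lemma hasPacking_quotient [CompactSpace (N ⧸ Λ)] {n : ℕ}
    (h : HasBilipschitzChart (EuclideanSpace ℝ (Fin n)) (1 : N)) :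
    HasPacking (N ⧸ Λ) n := by
  obtain ⟨g, c, ρ, C, hρ, hC, hgc, -, h1, h2⟩ := h
  obtain ⟨K, hK, hgrid⟩ := exists_grid (n := n)
  obtain ⟨ρ₀, hρ₀, hinj⟩ := exists_injectivity_radius Λ
  refine ⟨1 / (2 * K * C * C), by positivity, min (ρ₀ / 2) (ρ * C), by positivity,
    fun q hq x r hr hr' => ?_⟩
  obtain ⟨x, rfl⟩ := QuotientGroup.mk_surjective x
  obtain ⟨u, hu1, hu2⟩ := hgrid c q hq (r / (2 * K * C)) (by positivity)
  have hr1 := hr'.trans (min_le_left _ _)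
  have hr2 := hr'.trans (min_le_right _ _)
  have hKh : K * (r / (2 * K * C)) = r / (2 * C) := by field_simp
  have hub : ∀ i, u i ∈ ball c ρ := fun i => by
    refine mem_ball.2 ((hu1 i).trans_lt ?_)
    rw [hKh, div_lt_iff₀ (by positivity)]
    nlinarith [mul_pos hρ hC]
  have hd1 : ∀ i, dist (g (u i)) 1 ≤ r / 2 := fun i => by
    have := h1 (u i) (hub i) c (mem_ball_self hρ)
    rw [hgc] at this
    calc _ ≤ C * (r / (2 * C)) := this.trans (by gcongr; rw [← hKh]; exact hu1 i)
      _ = r / 2 := by field_simp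
  refine ⟨fun i => ((g (u i) * x : N) : N ⧸ Λ), fun i => ?_, fun i j hij => ?_⟩
  · exact (cosetDist_mk_le Λ _ _).trans ((dist_mul_self_right _ _).trans_le (hd1 i))
  · have h3 : dist (g (u i) * x) (g (u j) * x) ≤ ρ₀ / 2 := by
      rw [dist_mul_right]
      linarith [dist_triangle_right (g (u i)) (g (u j)) 1, hd1 i, hd1 j]
    rw [dist_mk_eq hinj h3, dist_mul_right]
    have h4 := (hu2 i j hij).trans (h2 _ (hub i) _ (hub j))
    have hq' : (0 : ℝ) < q := by exact_mod_cast hq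
    have h5 : 1 / (2 * K * C * C) * r / q = r / (2 * K * C) / q / C := by field_simp
    rw [h5, div_le_iff₀ hC]
    linarith

/-- Dimension is local, and every point has a neighbourhood that is a Lipschitz image of a Euclidean
ball. -/
lemma dimH_quotient_le [CompactSpace (N ⧸ Λ)] {n : ℕ}
    (h : HasBilipschitzChart (EuclideanSpace ℝ (Fin n)) (1 : N))
    (T : Set (N ⧸ Λ)) : dimH T ≤ n := by
  obtain ⟨g, c, ρ, C, hρ, hC, hgc, hnhds, h1, -⟩ := h
  by_contra! hlt
  obtain ⟨x, -, hx⟩ := exists_mem_nhdsWithin_lt_dimH_of_lt_dimH hlt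
  obtain ⟨x, rfl⟩ := QuotientGroup.mk_surjective x
  let f : EuclideanSpace ℝ (Fin n) → N ⧸ Λ := fun u => ((g u * x : N) : N ⧸ Λ)
  have hlip : LipschitzOnWith C.toNNReal f (ball c ρ) := by
    refine LipschitzOnWith.of_dist_le_mul fun u hu v hv => ?_
    rw [Real.coe_toNNReal _ hC.le]
    refine (cosetDist_mk_le Λ _ _).trans ?_
    rw [dist_mul_right]
    exact h1 u hu v hv
  have himg : f '' ball c ρ ∈ 𝓝 (x : N ⧸ Λ) := by
    have h2 : (fun y : N => y * x) '' (g '' ball c ρ) ∈ 𝓝 x := by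
      have := (isOpenMap_mul_right x).image_mem_nhds hnhds
      rwa [one_mul] at this
    have h3 := (QuotientGroup.isOpenMap_coe (N := Λ)).image_mem_nhds h2
    rwa [image_image, image_image] at h3
  refine absurd (hx _ (mem_nhdsWithin_of_mem_nhds himg)) (not_lt.2 ?_)
  calc dimH (f '' ball c ρ) ≤ dimH (ball c ρ) := hlip.dimH_image_le
    _ ≤ dimH (univ : Set (EuclideanSpace ℝ (Fin n))) := dimH_mono (subset_univ _)
    _ = n := by rw [Real.dimH_univ_eq_finrank]; simp

end Group

end Geometry

/-! ### The abelianization as a vector group -/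

section VectorQuotient

open Set Filter Metric
open scoped Topology

/-- `f` is an open continuous homomorphism onto a vector group whose kernel is the commutator
subgroup. -/
structure IsVectorAbelianization {N : Type*} [Group N] [TopologicalSpace N] {V : Type*}
    [NormedAddCommGroup V] (f : N → V) : Prop where
  map_mul : ∀ x y, f (x * y) = f x + f y
  continuous : Continuous f
  isOpenMap : IsOpenMap f
  surjective : Function.Surjective f
  eq_zero_iff : ∀ x, f x = 0 ↔ x ∈ commutator N

lemma isVectorAbelianization_of_equiv {N : Type*} [Group N] [TopologicalSpace N]
    [IsTopologicalGroup N] {k : ℕ}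
    (φ : (N ⧸ commutator N) ≃ₜ* Multiplicative (Fin k → ℝ)) :
    IsVectorAbelianization fun x : N => (φ (x : N ⧸ commutator N)).toAdd where
  map_mul x y := by rw [QuotientGroup.mk_mul, map_mul, toAdd_mul]
  continuous := continuous_toAdd.comp (φ.continuous.comp continuous_quot_mk)
  isOpenMap := by
    have h1 : IsOpenMap (Multiplicative.toAdd : Multiplicative (Fin k → ℝ) → (Fin k → ℝ)) :=
      fun U hU => by
        rw [Equiv.image_eq_preimage_symm]
        exact hU.preimage continuous_ofAdd
    exact h1.comp (φ.toHomeomorph.isOpenMap.comp QuotientGroup.isOpenMap_coe)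
  surjective := Multiplicative.toAdd.surjective.comp
    (φ.surjective.comp QuotientGroup.mk_surjective)
  eq_zero_iff x := by
    rw [toAdd_eq_zero, map_eq_one_iff φ φ.injective, QuotientGroup.eq_one_iff]

section Compact

variable {N : Type*} [Group N] [TopologicalSpace N] [IsTopologicalGroup N]
  [LocallyCompactSpace N]

lemma exists_compact_cover (Λ : Subgroup N) [CompactSpace (N ⧸ Λ)] :
    ∃ C : Set N, IsCompact C ∧ ∀ g : N, ∃ c ∈ C, ∃ l ∈ Λ, g = c * l := by
  have key : ∃ C : Set N, IsCompact C ∧ (univ : Set (N ⧸ Λ)) ⊆ (fun x : N => (x : N ⧸ Λ)) '' C := by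
    refine isCompact_univ.induction_on (p := fun t : Set (N ⧸ Λ) => ∃ C : Set N, IsCompact C ∧
      t ⊆ (fun x : N => (x : N ⧸ Λ)) '' C) ⟨∅, isCompact_empty, empty_subset _⟩ ?_ ?_ ?_
    · rintro s t hst ⟨C, hC, h⟩
      exact ⟨C, hC, hst.trans h⟩
    · rintro s t ⟨C, hC, h⟩ ⟨C', hC', h'⟩
      exact ⟨C ∪ C', hC.union hC', by rw [image_union]; exact union_subset_union h h'⟩
    · intro a _
      obtain ⟨x, rfl⟩ := QuotientGroup.mk_surjective a
      obtain ⟨K, hK, hKx⟩ := exists_compact_mem_nhds x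
      exact ⟨_, mem_nhdsWithin_of_mem_nhds
        ((QuotientGroup.isOpenMap_coe (N := Λ)).image_mem_nhds hKx), K, hK, Subset.rfl⟩
  obtain ⟨C, hC, h⟩ := key
  refine ⟨C, hC, fun g => ?_⟩
  obtain ⟨c, hc, hcg⟩ := h (mem_univ (g : N ⧸ Λ))
  exact ⟨c, hc, c⁻¹ * g, QuotientGroup.eq.1 hcg, by group⟩

end Compact

/-- The vectors with a positive integer multiple in the group generated by a spanning set are
dense. -/
lemma dense_setOf_nsmul_mem {V : Type*} [NormedAddCommGroup V] [NormedSpace ℝ V] {t : Set V}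
    (ht : Submodule.span ℝ t = ⊤) :
    Dense {v : V | ∃ q : ℕ, 0 < q ∧ q • v ∈ AddSubgroup.closure t} := by
  set D := {v : V | ∃ q : ℕ, 0 < q ∧ q • v ∈ AddSubgroup.closure t} with hD
  have hadd : ∀ u ∈ D, ∀ v ∈ D, u + v ∈ D := by
    rintro u ⟨q, hq, hu⟩ v ⟨q', hq', hv⟩
    refine ⟨q * q', Nat.mul_pos hq hq', ?_⟩
    rw [smul_add]
    refine add_mem ?_ ?_
    · rw [mul_comm, mul_smul]; exact nsmul_mem hu q'
    · rw [mul_smul]; exact nsmul_mem hv q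
  have hsmul : ∀ (a : ℚ), ∀ v ∈ D, (a : ℝ) • v ∈ D := by
    rintro a v ⟨q, hq, hv⟩
    refine ⟨a.den * q, Nat.mul_pos a.den_pos hq, ?_⟩
    have h1 : (a.den * q) • ((a : ℝ) • v) = a.num • (q • v) := by
      rw [← Nat.cast_smul_eq_nsmul ℝ, ← Nat.cast_smul_eq_nsmul ℝ, ← Int.cast_smul_eq_zsmul ℝ,
        smul_smul, smul_smul]
      congr 1
      have h2 : ((a.num : ℚ) : ℝ) = ((a * a.den : ℚ) : ℝ) := by rw [Rat.mul_den_eq_num]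
      push_cast at h2 ⊢
      rw [h2]; ring
    rw [h1]
    exact zsmul_mem hv _
  intro v
  have hv : v ∈ Submodule.span ℝ t := by rw [ht]; trivial
  induction hv using Submodule.span_induction with
  | mem v hv => exact subset_closure ⟨1, one_pos, by simpa using AddSubgroup.subset_closure hv⟩
  | zero => exact subset_closure ⟨1, one_pos, by simp⟩
  | add u v _ _ hu hv => exact map_mem_closure₂ continuous_add hu hv hadd
  | smul a v _ hv =>
    exact map_mem_closure₂ continuous_smul (Rat.denseRange_cast (𝕜 := ℝ) a) hv
      (by rintro _ ⟨b, rfl⟩ w hw; exact hsmul b w hw)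

lemma exists_finite_span {N V : Type*} [NormedAddCommGroup V] [NormedSpace ℝ V]
    [FiniteDimensional ℝ V] {f : N → V} {Λ : Set N}
    (hspan : Submodule.span ℝ (f '' Λ) = ⊤) :
    ∃ s : Set N, s.Finite ∧ s ⊆ Λ ∧ Submodule.span ℝ (f '' s) = ⊤ := by
  obtain ⟨b, hb, hbs, hli⟩ := exists_linearIndependent ℝ (f '' Λ)
  choose g hg using fun v : b => hb v.2
  have := hli.setFinite.to_subtype
  refine ⟨range g, finite_range g, ?_, ?_⟩
  · rintro _ ⟨v, rfl⟩
    exact (hg v).1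
  · have : f '' range g = b := by
      rw [← range_comp, show f ∘ g = Subtype.val from funext fun v => (hg v).2, Subtype.range_coe]
    rw [this, hbs, hspan]

namespace IsVectorAbelianization

section

variable {N : Type*} [Group N] [TopologicalSpace N] {V : Type*} [NormedAddCommGroup V]
  {f : N → V}

/-- The image of a subgroup. -/
def imageSubgroup (hf : IsVectorAbelianization f) (Λ : Subgroup N) : AddSubgroup V where
  carrier := f '' Λ
  add_mem' := by
    rintro _ _ ⟨x, hx, rfl⟩ ⟨y, hy, rfl⟩
    exact ⟨x * y, mul_mem hx hy, hf.map_mul x y⟩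
  zero_mem' := ⟨1, one_mem _, hom_one hf.map_mul⟩
  neg_mem' := by
    rintro _ ⟨x, hx, rfl⟩
    exact ⟨x⁻¹, inv_mem hx, hom_inv hf.map_mul x⟩

lemma eq_iff (hf : IsVectorAbelianization f) (x y : N) :
    f x = f y ↔ x⁻¹ * y ∈ commutator N := by
  rw [← hf.eq_zero_iff, hf.map_mul, hom_inv hf.map_mul, neg_add_eq_zero]

variable [NormedSpace ℝ V]

/-- A functional vanishing on `f '' Λ` takes on all of `V` only its values on the compact set `f ''
C`; being bounded above, it is zero. -/
lemma span_eq_top [FiniteDimensional ℝ V] (hf : IsVectorAbelianization f) {Λ : Subgroup N}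
    {C : Set N} (hC : IsCompact C) (hCΛ : ∀ g : N, ∃ c ∈ C, ∃ l ∈ Λ, g = c * l) :
    Submodule.span ℝ (f '' Λ) = ⊤ := by
  by_contra hne
  obtain ⟨g, hg0, hg⟩ := Submodule.exists_le_ker_of_lt_top _ (lt_top_iff_ne_top.2 hne)
  have hcont : Continuous g := g.continuous_of_finiteDimensional
  obtain ⟨v, hv⟩ : ∃ v, g v ≠ 0 := by
    by_contra! h
    exact hg0 (LinearMap.ext h)
  obtain ⟨b, hb⟩ := (hC.image (hcont.comp hf.continuous)).bddAbove
  obtain ⟨x, hx⟩ := hf.surjective (((b + 1) / g v) • v)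
  obtain ⟨c, hc, l, hl, rfl⟩ := hCΛ x
  have h1 : g (f c) ≤ b := hb ⟨c, hc, rfl⟩
  have h2 : g (f l) = 0 := hg (Submodule.subset_span ⟨l, hl, rfl⟩)
  have h3 := congrArg g hx
  rw [hf.map_mul, map_add, h2, add_zero, map_smul, smul_eq_mul, div_mul_cancel₀ _ hv] at h3
  linarith

/-- A real vector space is divisible, and the rational combinations of a spanning set are dense;
both facts are pulled back through the open map `f`. -/
lemma hasDenseRoots (hf : IsVectorAbelianization f) {s : Set N}
    (hs : Submodule.span ℝ (f '' s) = ⊤) : HasDenseRoots s := by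
  constructor
  · intro g q hq
    obtain ⟨h, hh⟩ := hf.surjective ((q : ℝ)⁻¹ • f g)
    refine ⟨h, (h ^ q)⁻¹ * g, ?_, by group⟩
    rw [← hf.eq_iff, hom_pow hf.map_mul, hh, ← Nat.cast_smul_eq_nsmul ℝ, smul_smul,
      mul_inv_cancel₀ (by positivity), one_smul]
  · refine ((dense_setOf_nsmul_mem hs).preimage hf.isOpenMap).mono ?_
    rintro x ⟨q, hq, hx⟩
    refine ⟨q, hq, ?_⟩
    have hlift : ∀ v ∈ AddSubgroup.closure (f '' s), ∃ y ∈ Subgroup.closure s, f y = v := by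
      intro v hv
      induction hv using AddSubgroup.closure_induction with
      | mem v hv =>
        obtain ⟨y, hy, rfl⟩ := hv
        exact ⟨y, Subgroup.subset_closure hy, rfl⟩
      | zero => exact ⟨1, one_mem _, hom_one hf.map_mul⟩
      | add u v _ _ hu hv =>
        obtain ⟨y, hy, rfl⟩ := hu
        obtain ⟨z, hz, rfl⟩ := hv
        exact ⟨y * z, mul_mem hy hz, hf.map_mul y z⟩
      | neg v _ hv =>
        obtain ⟨y, hy, rfl⟩ := hv
        exact ⟨y⁻¹, inv_mem hy, hom_inv hf.map_mul y⟩
    obtain ⟨y, hy, hyx⟩ := hlift _ hx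
    rw [← hom_pow hf.map_mul, hf.eq_iff] at hyx
    have e : x ^ q = y * (y⁻¹ * x ^ q) := by group
    rw [e]
    exact mul_mem (Subgroup.mem_sup_left hy) (Subgroup.mem_sup_right hyx)

end

variable {N : Type*} [Group N] [TopologicalSpace N] [IsTopologicalGroup N] [T2Space N]
  [LocallyCompactSpace N] [Group.IsNilpotent N] {V : Type*} [NormedAddCommGroup V]
  [NormedSpace ℝ V] [FiniteDimensional ℝ V] {f : N → V}

/-- The image of a lattice in the abelianization is discrete. -/
lemma exists_separation (hf : IsVectorAbelianization f) (Λ : Subgroup N) [DiscreteTopology Λ]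
    [CompactSpace (N ⧸ Λ)] :
    ∃ δ > 0, ∀ v ∈ hf.imageSubgroup Λ, ‖v‖ < δ → v = 0 := by
  obtain ⟨C, hC, hCΛ⟩ := exists_compact_cover Λ
  obtain ⟨s, hsf, hsΛ, hs⟩ := exists_finite_span (hf.span_eq_top hC hCΛ)
  obtain ⟨m, hm⟩ := Subgroup.nilpotent_iff_lowerCentralSeries.1 ‹Group.IsNilpotent N›
  have hm' : lcs N (m + 1) = ⊥ :=
    le_bot_iff.1 ((Subgroup.lowerCentralSeries_antitone _ m.le_succ).trans_eq hm)
  obtain ⟨U, hU, h⟩ := discrete_in_abelianization m N Λ (hf.hasDenseRoots hs) hsf hsΛ hC hCΛ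
    (exists_mem_nhds_one_of_discrete Λ) hm'
  have himg := hf.isOpenMap.image_mem_nhds hU
  rw [hom_one hf.map_mul] at himg
  obtain ⟨δ, hδ, hball⟩ := Metric.mem_nhds_iff.1 himg
  refine ⟨δ, hδ, ?_⟩
  rintro _ ⟨l, hl, rfl⟩ hlt
  obtain ⟨u, hu, hul⟩ := hball (mem_ball_zero_iff.2 hlt)
  rw [hf.eq_iff] at hul
  have := h u hu _ hul (by rwa [mul_inv_cancel_left])
  rw [mul_inv_cancel_left] at this
  exact (hf.eq_zero_iff l).2 this

lemma countable_imageSubgroup (hf : IsVectorAbelianization f) (Λ : Subgroup N)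
    [DiscreteTopology Λ] [CompactSpace (N ⧸ Λ)] : (hf.imageSubgroup Λ : Set V).Countable := by
  obtain ⟨δ, hδ, h⟩ := hf.exists_separation Λ
  have : ProperSpace V := FiniteDimensional.proper ℝ V
  have hd : DiscreteTopology (hf.imageSubgroup Λ) := by
    refine discreteTopology_of_isOpen_singleton_zero ?_
    rw [Metric.isOpen_singleton_iff]
    refine ⟨δ, hδ, fun y hy => Subtype.ext (h y y.2 ?_)⟩
    simpa using hy
  exact countable_coe_iff.1 (TopologicalSpace.separableSpace_iff_countable.1 inferInstance)

end IsVectorAbelianization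
end VectorQuotient

/-! ### From avoidance to exceptional sets -/

section Exceptional

open Set Filter Metric
open scoped Topology

/-- This covers the intersection of an empty family. The first player keeps the centre, and
compactness provides the common point. -/
lemma isAlphaWinning_univ {X : Type*} [MetricSpace X] [CompactSpace X] {α : ℝ}
    (hα : α ∈ Ioo (0 : ℝ) 1) : IsAlphaWinning α (univ : Set X) := by
  intro β hβ
  have hθ0 : 0 < α * β := mul_pos hα.1 hβ.1
  have hθ1 : α * β < 1 := mul_lt_one_of_nonneg_of_lt_one_left hα.1.le hα.2 hβ.2.le
  refine ⟨fun _ k b => b (Fin.last k), fun r hr b => ?_⟩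
  intro B A
  have hAB : ∀ k, A k ⊆ B k := fun k =>
    closedBall_subset_closedBall (mul_le_of_le_one_left (by positivity) hα.2.le)
  refine ⟨fun m _ => hAB m, fun h => ?_⟩
  obtain ⟨x, hx⟩ := IsCompact.nonempty_iInter_of_sequence_nonempty_isCompact_isClosed A
    (fun k => (hAB (k + 1)).trans (h k))
    (fun k => nonempty_closedBall.2 (by have := hα.1; positivity))
    isClosed_closedBall.isCompact (fun k => isClosed_closedBall)
  refine ⟨x, mem_univ _, Subset.antisymm (fun y hy => ?_) (singleton_subset_iff.2 hx)⟩
  have hd : ∀ k, dist y x ≤ 2 * (α * ((α * β) ^ k * r)) := fun k => by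
    have h1 : dist y (b k) ≤ _ := mem_closedBall.1 (mem_iInter.1 hy k)
    have h2 : dist x (b k) ≤ _ := mem_closedBall.1 (mem_iInter.1 hx k)
    linarith [dist_triangle_right y x (b k)]
  have hlim : Tendsto (fun k : ℕ => 2 * (α * ((α * β) ^ k * r))) atTop (𝓝 0) := by
    have := (((tendsto_pow_atTop_nhds_zero_of_lt_one hθ0.le hθ1).mul_const r).const_mul
      α).const_mul 2
    simpa using this
  exact dist_le_zero.1 (ge_of_tendsto' hlim hd)

lemma isAlphaWinning_sInter {X : Type*} [MetricSpace X] [CompactSpace X] {α : ℝ}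
    (hα : α ∈ Ioo (0 : ℝ) 1) {𝒮 : Set (Set X)} (hc : 𝒮.Countable)
    (h : ∀ T ∈ 𝒮, IsAlphaWinning α T) : IsAlphaWinning α (⋂₀ 𝒮) := by
  rcases 𝒮.eq_empty_or_nonempty with rfl | hne
  · rw [sInter_empty]
    exact isAlphaWinning_univ hα
  · obtain ⟨T, rfl⟩ := hc.exists_eq_range hne
    rw [sInter_range]
    exact IsAlphaWinning.iInter hα fun i => h _ (mem_range_self i)

/-- Either the orbit hits `y` and returns to it periodically, or any finite part of the orbit can be
removed from a neighbourhood of `y`. -/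
lemma frequently_mem_of_mem_closure_orbit {X : Type*} [TopologicalSpace X] [T1Space X] {g : X → X}
    {x y : X} (hy : y ∈ closure (range fun k : ℕ => g^[k] x)) (hp : y ∈ Function.periodicPts g)
    {W : Set X} (hW : W ∈ 𝓝 y) : ∃ᶠ j : ℕ in atTop, g^[j] x ∈ W := by
  refine frequently_atTop.2 fun a => ?_
  by_cases hmem : ∃ k : ℕ, g^[k] x = y
  · obtain ⟨k, hk⟩ := hmem
    obtain ⟨m, hm, hper⟩ := Function.mem_periodicPts.1 hp
    refine ⟨m * a + k, le_add_right (Nat.le_mul_of_pos_left a hm), ?_⟩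
    rw [Function.iterate_add_apply, hk, (hper.mul_const a).eq]
    exact mem_of_mem_nhds hW
  · have hF : ((fun k : ℕ => g^[k] x) '' Iio a)ᶜ ∈ 𝓝 y :=
      ((finite_Iio a).image _).isClosed.isOpen_compl.mem_nhds
        fun ⟨k, _, hk⟩ => hmem ⟨k, hk⟩
    obtain ⟨_, ⟨hw, hnot⟩, ⟨j, rfl⟩⟩ := mem_closure_iff_nhds.1 hy _ (inter_mem hW hF)
    exact ⟨j, not_lt.1 fun hj => hnot ⟨j, hj, rfl⟩, hw⟩

/-- The vectors whose images in `V / Γ` are periodic under `A`. -/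
def periodicVectors {V : Type*} [AddCommGroup V] [Module ℝ V] (A : Module.End ℝ V)
    (Γ : AddSubgroup V) : Set V :=
  {p | ∃ m : ℕ, 0 < m ∧ (A ^ m) p - p ∈ Γ}

lemma countable_periodicVectors {k : ℕ} {A : Module.End ℝ (Fin k → ℝ)}
    (hA : ∀ z : ℂ, (A.charpoly.map (algebraMap ℝ ℂ)).IsRoot z → ‖z‖ ≠ 1)
    {Γ : AddSubgroup (Fin k → ℝ)} (hΓ : (Γ : Set (Fin k → ℝ)).Countable) :
    (periodicVectors A Γ).Countable := by
  have h : periodicVectors A Γ ⊆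
      ⋃ m : {m : ℕ // 0 < m}, (fun p => (A ^ (m : ℕ)) p - p) ⁻¹' (Γ : Set (Fin k → ℝ)) := by
    rintro p ⟨m, hm, hp⟩
    exact mem_iUnion.2 ⟨⟨m, hm⟩, hp⟩
  refine (countable_iUnion fun m => hΓ.preimage_of_injOn fun p _ q _ hpq => ?_).mono h
  rw [← sub_eq_zero]
  refine pow_sub_one_injective hA m.2 ?_
  rw [map_sub, sub_eq_sub_iff_sub_eq_sub]
  exact hpq

lemma map_iterate {N V : Type*} [AddCommGroup V] [Module ℝ V] {f : N → V} {R : N → N}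
    {A : Module.End ℝ V} (hR : ∀ x, f (R x) = A (f x)) (j : ℕ) (x : N) :
    f (R^[j] x) = (A ^ j) (f x) := by
  induction j with
  | zero => rfl
  | succ j ih => rw [Function.iterate_succ_apply', hR, ih, pow_succ', Module.End.mul_apply]

namespace IsVectorAbelianization

section

variable {N : Type*} [Group N] [TopologicalSpace N] {V : Type*} [NormedAddCommGroup V]
  {f : N → V}

/-- The abelianization is universal among the continuous homomorphisms to vector spaces. -/
lemma exists_linear_factor [NormedSpace ℝ V] (hf : IsVectorAbelianization f) {W : Type*}
    [NormedAddCommGroup W] [NormedSpace ℝ W] {g : N → W} (hg : ∀ x y, g (x * y) = g x + g y)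
    (hgc : Continuous g) : ∃ L : V →L[ℝ] W, ∀ x, g x = L (f x) := by
  have hcomm : ∀ x ∈ commutator N, g x = 0 := fun x hx => by
    have h := commutator_map_le (MonoidHom.mk' (fun x => Multiplicative.ofAdd (g x))
      fun x y => by rw [hg, ofAdd_add]) ⟨x, hx, rfl⟩
    rw [(commutator_eq_bot_iff_center_eq_top _).2 (CommGroup.center_eq_top), Subgroup.mem_bot] at h
    exact ofAdd_eq_one.1 h
  have hfac : ∀ x, g (Function.surjInv hf.surjective (f x)) = g x := fun x => by
    have h := (hf.eq_iff _ _).1 (Function.surjInv_eq hf.surjective (f x))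
    have h' := hcomm _ h
    rwa [hg, hom_inv hg, neg_add_eq_zero] at h'
  let L : V →+ W := AddMonoidHom.mk' (fun v => g (Function.surjInv hf.surjective v)) fun u v => by
    obtain ⟨x, rfl⟩ := hf.surjective u
    obtain ⟨y, rfl⟩ := hf.surjective v
    rw [← hf.map_mul, hfac, hfac, hfac, hg]
  have hL : Continuous L := by
    refine (hf.isOpenMap.isQuotientMap hf.continuous hf.surjective).continuous_iff.2 ?_
    exact hgc.congr fun x => (hfac x).symm
  exact ⟨L.toRealLinearMap hL, fun x => (hfac x).symm⟩

lemma abelianizedMap_eq_iff (hf : IsVectorAbelianization f) {R R' : N ≃ₜ* N} :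
    abelianizedMap R = abelianizedMap R' ↔ ∀ x, f (R x) = f (R' x) := by
  constructor
  · intro h x
    have hx : ((R x : N) : N ⧸ commutator N) = (R' x : N) :=
      DFunLike.congr_fun h (x : N ⧸ commutator N)
    exact (hf.eq_iff _ _).2 (QuotientGroup.eq.1 hx)
  · intro h
    refine MonoidHom.ext fun v => ?_
    obtain ⟨x, rfl⟩ := QuotientGroup.mk_surjective v
    exact QuotientGroup.eq.2 ((hf.eq_iff _ _).1 (h x))

/-- A periodic `bΛ` gives `p = f b`. Returns of the orbit near `bΛ` bring `Aʲ (f a)` near `p + Γ`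
for arbitrarily large `j`. -/
lemma notMem_periodicPts [NormedSpace ℝ V] [IsTopologicalGroup N] (hf : IsVectorAbelianization f)
    {Λ : Subgroup N} [T1Space (N ⧸ Λ)] {R : N ≃ₜ* N} {A : Module.End ℝ V}
    (hR : ∀ x, f (R x) = A (f x)) {ρ : N ⧸ Λ → N ⧸ Λ}
    (hρ : ∀ x : N, ρ (x : N ⧸ Λ) = (R x : N ⧸ Λ)) {x : N ⧸ Λ}
    (hx : ∀ p ∈ periodicVectors A (hf.imageSubgroup Λ), ∃ a : N, (a : N ⧸ Λ) = x ∧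
      ∃ ε > 0, ∀ᶠ j : ℕ in atTop, ∀ γ ∈ hf.imageSubgroup Λ, ε ≤ ‖(A ^ j) (f a) - p - γ‖)
    {y : N ⧸ Λ} (hy : y ∈ closure (range fun k : ℕ => ρ^[k] x)) :
    y ∉ Function.periodicPts ρ := by
  intro hp
  have hmk : ∀ (x : N) (l : N), (x : N ⧸ Λ) = l → f l - f x ∈ hf.imageSubgroup Λ :=
    fun x l h => ⟨x⁻¹ * l, QuotientGroup.eq.1 h, by
      rw [hf.map_mul, hom_inv hf.map_mul]; abel⟩
  have hit : ∀ (j : ℕ) (x : N), ρ^[j] (x : N ⧸ Λ) = (R^[j] x : N) := by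
    intro j
    induction j with
    | zero => exact fun x => rfl
    | succ j ih =>
      intro x
      rw [Function.iterate_succ_apply', ih, hρ, Function.iterate_succ_apply']
  obtain ⟨b, rfl⟩ := QuotientGroup.mk_surjective y
  obtain ⟨m, hm, hper⟩ := Function.mem_periodicPts.1 hp
  have hper' : ((b : N) : N ⧸ Λ) = (R^[m] b : N) := (hper.eq.symm.trans (hit m b))
  have hbP : f b ∈ periodicVectors A (hf.imageSubgroup Λ) := by
    refine ⟨m, hm, ?_⟩
    rw [← map_iterate hR]
    exact hmk _ _ hper'
  obtain ⟨a, rfl, ε, hε, hev⟩ := hx _ hbP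
  have hW : (fun z : N => (z : N ⧸ Λ)) '' (f ⁻¹' ball (f b) ε) ∈ 𝓝 (b : N ⧸ Λ) :=
    (QuotientGroup.isOpenMap_coe (N := Λ)).image_mem_nhds
      (hf.continuous.continuousAt.preimage_mem_nhds (ball_mem_nhds _ hε))
  obtain ⟨j, ⟨z, hz, hzj⟩, hj⟩ :=
    ((frequently_mem_of_mem_closure_orbit hy hp hW).and_eventually hev).exists
  rw [hit] at hzj
  have h1 := hj _ (hmk _ _ hzj)
  rw [map_iterate hR, show (A ^ j) (f a) - f b - ((A ^ j) (f a) - f z) = f z - f b by abel] at h1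
  exact absurd (mem_ball_iff_norm.1 hz) (not_lt.2 h1)

end

section

variable {N : Type*} [Group N] [TopologicalSpace N] [IsTopologicalGroup N] [T2Space N]
  [LocallyCompactSpace N] [Group.IsNilpotent N] {V : Type*} [NormedAddCommGroup V]
  [NormedSpace ℝ V] [FiniteDimensional ℝ V] {f : N → V}

/-- An endomorphism of a lattice is determined on the abelianization by its values on finitely
many lattice elements. -/
lemma countable_abelianizedMap (hf : IsVectorAbelianization f) (Λ : Subgroup N)
    [DiscreteTopology Λ] [CompactSpace (N ⧸ Λ)] :
    {a | ∃ R : N ≃ₜ* N, (∀ x ∈ Λ, R x ∈ Λ) ∧ abelianizedMap R = a}.Countable := by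
  obtain ⟨C, hC, hCΛ⟩ := exists_compact_cover Λ
  obtain ⟨s, hsf, hsΛ, hs⟩ := exists_finite_span (hf.span_eq_top hC hCΛ)
  have := hsf.to_subtype
  have hout : ∀ y : N, f (Quotient.out (y : N ⧸ commutator N)) = f y := fun y =>
    (hf.eq_iff _ _).2 (QuotientGroup.eq.1 (QuotientGroup.out_eq' _))
  let F : (N ⧸ commutator N →* N ⧸ commutator N) → s → V := fun a x =>
    f (Quotient.out (a ((x : N) : N ⧸ commutator N)))
  have hF : ∀ (R : N ≃ₜ* N) (x : s), F (abelianizedMap R) x = f (R x) := fun R x => hout (R x)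
  refine MapsTo.countable_of_injOn (f := F)
    (t := pi univ fun _ => (hf.imageSubgroup Λ : Set V)) ?_ ?_
    (countable_univ_pi fun _ => hf.countable_imageSubgroup Λ)
  · rintro _ ⟨R, hR, rfl⟩ x -
    rw [hF]
    exact ⟨R x, hR _ (hsΛ x.2), rfl⟩
  -- Both `f ∘ R` and `f ∘ R'` factor linearly through `f`, and `f '' s` spans.
  · rintro _ ⟨R, -, rfl⟩ _ ⟨R', -, rfl⟩ h
    have hlin : ∀ R : N ≃ₜ* N, ∃ L : V →L[ℝ] V, ∀ x, f (R x) = L (f x) := fun R =>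
      hf.exists_linear_factor (g := fun x => f (R x))
        (fun x y => by rw [_root_.map_mul, hf.map_mul])
        (hf.continuous.comp R.continuous)
    obtain ⟨L, hL⟩ := hlin R
    obtain ⟨L', hL'⟩ := hlin R'
    have hLL : (L : V →ₗ[ℝ] V) = L' := by
      refine LinearMap.ext_on hs ?_
      rintro _ ⟨x, hx, rfl⟩
      have := congrFun h ⟨x, hx⟩
      rw [hF, hF] at this
      exact (hL x).symm.trans (this.trans (hL' x))
    refine hf.abelianizedMap_eq_iff.2 fun x => ?_
    rw [hL, hL']
    exact LinearMap.congr_fun hLL (f x)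

end

section

variable {N : Type*} [Group N] [MetricSpace N] [IsIsometricSMul Nᵐᵒᵖ N] [IsTopologicalGroup N]
  [LocallyCompactSpace N] [Group.IsNilpotent N] [Nontrivial N] {k : ℕ} {f : N → Fin k → ℝ}

theorem isAlphaWinning_avoidingSet (hf : IsVectorAbelianization f) (hN : HasFineChains N)
    {Λ : Subgroup N} [DiscreteTopology Λ] [CompactSpace (N ⧸ Λ)] {R : N ≃ₜ* N}
    (hRΛ : ∀ x ∈ Λ, R x ∈ Λ) {A : Module.End ℝ (Fin k → ℝ)} (hR : ∀ x, f (R x) = A (f x))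
    (hA : A.IsSemisimple)
    (hroot : ∀ z : ℂ, (A.charpoly.map (algebraMap ℝ ℂ)).IsRoot z → ‖z‖ ≠ 1) (p : Fin k → ℝ)
    {α : ℝ} (hα : α ∈ Ioc (0 : ℝ) (1 / 160)) :
    IsAlphaWinning α (avoidingSet Λ f A (hf.imageSubgroup Λ) p) := by
  have hcomm := Group.IsSolvable.commutator_lt_top_of_nontrivial N
  have hk : 0 < k := by
    by_contra hk
    obtain rfl : k = 0 := by omega
    exact hcomm.ne (eq_top_iff.2 fun x _ => (hf.eq_zero_iff x).1 (Subsingleton.elim _ _))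
  obtain ⟨z, hz, C, hC, hupper, l, hl0, hlower⟩ := exists_dominant_functional hk hA
  obtain ⟨δ, hδ, hsep⟩ := hf.exists_separation Λ
  have hinj : ∀ x, A (f x) = 0 → f x = 0 := fun x hx => by
    rw [← hR, hf.eq_zero_iff] at hx
    have := commutator_map_le (R.symm : N →* N) ⟨R x, hx, rfl⟩
    rw [hf.eq_zero_iff]
    simpa using this
  have hpow : ∀ (j : ℕ) x, (A ^ j) (f x) = 0 → f x = 0 := by
    intro j
    induction j with
    | zero => exact fun x hx => hx
    | succ j ih =>
      intro x hx
      rw [pow_succ, Module.End.mul_apply, ← hR] at hx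
      exact hinj x ((hR x).symm.trans (ih _ hx))
  obtain ⟨y, hyΛ, hy⟩ : ∃ y ∈ Λ, f y ≠ 0 := by
    by_contra! h
    obtain ⟨K, hK, hKΛ⟩ := exists_compact_cover Λ
    have hspan := hf.span_eq_top hK hKΛ
    have hbot : Submodule.span ℝ (f '' Λ) = ⊥ := by
      rw [Submodule.span_eq_bot]
      rintro _ ⟨x, hx, rfl⟩
      exact h x hx
    have : Nonempty (Fin k) := ⟨⟨0, hk⟩⟩
    exact bot_ne_top (hbot.symm.trans hspan)
  -- If `‖z‖ < 1`, some `Aʲ (f y)` would be a vector of `Γ` shorter than `δ`, hence zero, against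
  -- the injectivity of `A`.
  have hz1 : 1 < ‖z‖ := by
    refine lt_of_le_of_ne (not_lt.1 fun hlt => ?_) (hroot z hz).symm
    have hlim : Tendsto (fun j : ℕ => C * ‖z‖ ^ j * ‖f y‖) atTop (𝓝 0) := by
      simpa using ((tendsto_pow_atTop_nhds_zero_of_lt_one (norm_nonneg z) hlt).const_mul
        C).mul_const ‖f y‖
    obtain ⟨j, hj⟩ := (hlim.eventually (gt_mem_nhds hδ)).exists
    have hmem : ∀ i : ℕ, R^[i] y ∈ Λ := fun i => by
      induction i with
      | zero => exact hyΛ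
      | succ i ih => rw [Function.iterate_succ_apply']; exact hRΛ _ ih
    refine hy (hpow j y (hsep _ ⟨R^[j] y, hmem j, map_iterate hR j y⟩ ?_))
    exact (hupper j _).trans_lt hj
  have hl : ∃ x, l (f x) ≠ 0 := by
    by_contra! h
    refine hl0 (ContinuousLinearMap.ext fun v => ?_)
    obtain ⟨x, rfl⟩ := hf.surjective v
    exact h x
  have : CompleteSpace N := completeSpace_of_locallyCompact
  exact Nilmanifold.isAlphaWinning_avoidingSet hN hf.map_mul hf.continuous hδ hsep hz1 hC hupper
    hlower hl p hα.1 hα.2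

end

end IsVectorAbelianization

variable {N : Type*} [Group N] [MetricSpace N] [IsIsometricSMul Nᵐᵒᵖ N] [IsTopologicalGroup N]
  [LocallyCompactSpace N] [Group.IsNilpotent N] [Nontrivial N]

/-- The avoiding sets depend on `R₀` only through its linear map, so they serve all automorphisms
with the same action on the abelianization. -/
lemma exists_countable_winning_of_abelianizedMap (hN : HasFineChains N) {Λ : Subgroup N}
    [DiscreteTopology Λ] [CompactSpace (N ⧸ Λ)] {R₀ : N ≃ₜ* N} (hR₀ : ∀ x ∈ Λ, R₀ x ∈ Λ)
    (h₀ : IsHyperbolicSemisimple R₀) :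
    ∃ 𝒮 : Set (Set (N ⧸ Λ)), 𝒮.Countable ∧
      (∀ T ∈ 𝒮, ∀ α ∈ Ioc (0 : ℝ) (1 / 160), IsAlphaWinning α T) ∧
      ∀ x ∈ ⋂₀ 𝒮, ∀ R : N ≃ₜ* N, abelianizedMap R = abelianizedMap R₀ → ∀ ρ : N ⧸ Λ → N ⧸ Λ,
        (∀ z : N, ρ (z : N ⧸ Λ) = (R z : N ⧸ Λ)) →
        ∀ y ∈ closure (range fun k : ℕ => ρ^[k] x), y ∉ Function.periodicPts ρ := by
  obtain ⟨k, φ, A, hφA, hA, hroot⟩ := h₀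
  have hf := isVectorAbelianization_of_equiv φ
  set f : N → Fin k → ℝ := fun x => (φ (x : N ⧸ commutator N)).toAdd with hfdef
  have hfR₀ : ∀ x, f (R₀ x) = A (f x) := fun x => hφA (x : N ⧸ commutator N)
  refine ⟨avoidingSet Λ f A (hf.imageSubgroup Λ) '' periodicVectors A (hf.imageSubgroup Λ),
    (countable_periodicVectors hroot (hf.countable_imageSubgroup Λ)).image _, ?_, ?_⟩
  · rintro _ ⟨p, -, rfl⟩ α hα
    exact hf.isAlphaWinning_avoidingSet hN hR₀ hfR₀ hA hroot p hα
  · intro x hx R hR ρ hρ y hy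
    have hfR : ∀ x, f (R x) = A (f x) := fun x =>
      (hf.abelianizedMap_eq_iff.1 hR x).trans (hfR₀ x)
    exact hf.notMem_periodicPts hfR hρ (fun p hp => hx _ ⟨p, hp, rfl⟩) hy

theorem exists_countable_winning (hN : HasFineChains N) (Λ : Subgroup N) [DiscreteTopology Λ]
    [CompactSpace (N ⧸ Λ)] :
    ∃ 𝒮 : Set (Set (N ⧸ Λ)), 𝒮.Countable ∧
      (∀ T ∈ 𝒮, ∀ α ∈ Ioc (0 : ℝ) (1 / 160), IsAlphaWinning α T) ∧
      ∀ x ∈ ⋂₀ 𝒮, ∀ ρ ∈ hyperbolicEndomorphisms Λ,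
        ∀ y ∈ closure (range fun k : ℕ => ρ^[k] x), y ∉ Function.periodicPts ρ := by
  let 𝒜 : Set (N ⧸ commutator N →* N ⧸ commutator N) :=
    {a | ∃ R : N ≃ₜ* N, (∀ x ∈ Λ, R x ∈ Λ) ∧ IsHyperbolicSemisimple R ∧ abelianizedMap R = a}
  have hc : 𝒜.Countable := by
    rcases 𝒜.eq_empty_or_nonempty with h | ⟨_, R₀, -, ⟨k, φ, -⟩, -⟩
    · rw [h]; exact countable_empty
    · refine ((isVectorAbelianization_of_equiv φ).countable_abelianizedMap Λ).mono ?_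
      rintro a ⟨R, hR, -, ha⟩
      exact ⟨R, hR, ha⟩
  have hex : ∀ a : 𝒜, ∃ 𝒮 : Set (Set (N ⧸ Λ)), 𝒮.Countable ∧
      (∀ T ∈ 𝒮, ∀ α ∈ Ioc (0 : ℝ) (1 / 160), IsAlphaWinning α T) ∧
      ∀ x ∈ ⋂₀ 𝒮, ∀ R : N ≃ₜ* N, abelianizedMap R = a → ∀ ρ : N ⧸ Λ → N ⧸ Λ,
        (∀ z : N, ρ (z : N ⧸ Λ) = (R z : N ⧸ Λ)) →
        ∀ y ∈ closure (range fun k : ℕ => ρ^[k] x), y ∉ Function.periodicPts ρ := by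
    rintro ⟨_, R, hR, hyp, rfl⟩
    exact exists_countable_winning_of_abelianizedMap hN hR hyp
  choose 𝒮 h𝒮c h𝒮w h𝒮 using hex
  have := hc.to_subtype
  refine ⟨⋃ a, 𝒮 a, countable_iUnion h𝒮c, fun T hT => ?_, fun x hx ρ hρ => ?_⟩
  · obtain ⟨a, ha⟩ := mem_iUnion.1 hT
    exact h𝒮w a T ha
  · obtain ⟨-, R, hR, hρR, hyp⟩ := hρ
    exact h𝒮 ⟨_, R, hR, hyp, rfl⟩ x (fun T hT => hx T (mem_iUnion.2 ⟨_, hT⟩)) R rfl ρ hρR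

end Exceptional

/-! ### Assembly of the theorem -/

lemma isContinuousRiemannianBundle_of_contMDiff {EB : Type*} [NormedAddCommGroup EB]
    [NormedSpace ℝ EB] {HB : Type*} [TopologicalSpace HB] (IB : ModelWithCorners ℝ EB HB) (n : ℕ∞ω)
    {B : Type*} [TopologicalSpace B] [ChartedSpace HB B] {F : Type*} [NormedAddCommGroup F]
    [NormedSpace ℝ F] {E : B → Type*} [TopologicalSpace (Bundle.TotalSpace F E)]
    [∀ x, NormedAddCommGroup (E x)] [∀ x, InnerProductSpace ℝ (E x)] [FiberBundle F E]
    [VectorBundle ℝ F E] [h : IsContMDiffRiemannianBundle IB n F E] :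
    IsContinuousRiemannianBundle F E := by
  obtain ⟨g, hg, h⟩ := h.exists_contMDiff
  exact ⟨g, hg.continuous, h⟩

end Nilmanifold

end

theorem theorem2 (n : ℕ) (hn : 0 < n) {N : Type*} [Group N] [MetricSpace N]
    [ChartedSpace (EuclideanSpace ℝ (Fin n)) N] [LieGroup (𝓡 n) ∞ N] [IsTopologicalGroup N]
    [SimplyConnectedSpace N] [Group.IsNilpotent N]
    [Bundle.RiemannianBundle (fun x : N => TangentSpace (𝓡 n) x)]
    [IsContMDiffRiemannianBundle (𝓡 n) ∞ (EuclideanSpace ℝ (Fin n))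
      (fun x : N => TangentSpace (𝓡 n) x)]
    [IsRiemannianManifold (𝓡 n) N] [IsIsometricSMul Nᵐᵒᵖ N]
    (Λ : Subgroup N) [DiscreteTopology Λ] [CompactSpace (N ⧸ Λ)] :
    ∃ μ : ℝ, 0 < μ ∧ μ ≤ 1 / 2 ∧ ∃ S : Set (N ⧸ Λ),
      Nilmanifold.IsExceptional (Nilmanifold.hyperbolicEndomorphisms Λ) S ∧
      (∀ α ∈ Set.Ioc 0 μ, Nilmanifold.IsAlphaWinning α S) ∧
      ∀ U : Set (N ⧸ Λ), IsOpen U → U.Nonempty → dimH (S ∩ U) = n := by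
  have : LocallyCompactSpace N := Manifold.locallyCompact_of_finiteDimensional (𝓡 n)
  have : IsManifold (𝓡 n) 1 N := IsManifold.of_le (n := ∞) (by simp)
  have : IsContinuousRiemannianBundle (EuclideanSpace ℝ (Fin n))
      (fun x : N => TangentSpace (𝓡 n) x) :=
    Nilmanifold.isContinuousRiemannianBundle_of_contMDiff (𝓡 n) ∞
  have hchart := Nilmanifold.hasBilipschitzChart_of_isRiemannianManifold (𝓡 n) (1 : N)
  have hpack := Nilmanifold.hasPacking_quotient (Λ := Λ) hchart
  have hN : Nilmanifold.HasFineChains N := Nilmanifold.exists_chain (𝓡 n)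
  -- For `q = 2` and `n > 0` the packing has two distinct points.
  have : Nontrivial N := by
    obtain ⟨κ, hκ, r₀, hr₀, h⟩ := hpack
    obtain ⟨y, -, hy⟩ := h 2 two_pos ((1 : N) : N ⧸ Λ) r₀ hr₀ le_rfl
    have h2 : 1 < 2 ^ n := Nat.one_lt_two_pow hn.ne'
    have h01 := hy ⟨0, by omega⟩ ⟨1, h2⟩ (by simp)
    have hne : y ⟨0, by omega⟩ ≠ y ⟨1, h2⟩ := dist_pos.1 (lt_of_lt_of_le (by positivity) h01)
    have : Nontrivial (N ⧸ Λ) := ⟨_, _, hne⟩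
    exact (QuotientGroup.mk_surjective (s := Λ)).nontrivial
  obtain ⟨𝒮, hc, hwin, hexc⟩ := Nilmanifold.exists_countable_winning hN Λ
  have hS : ∀ α ∈ Set.Ioc (0 : ℝ) (1 / 160), Nilmanifold.IsAlphaWinning α (⋂₀ 𝒮) := fun α hα =>
    Nilmanifold.isAlphaWinning_sInter ⟨hα.1, by linarith [hα.2]⟩ hc fun T hT => hwin T hT α hα
  have hdim : ∀ U : Set (N ⧸ Λ), IsOpen U → U.Nonempty → dimH (⋂₀ 𝒮 ∩ U) = n :=
    fun U hU hUne => le_antisymm (Nilmanifold.dimH_quotient_le hchart _)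
      (Nilmanifold.le_dimH_of_isAlphaWinning hn hpack (α := 1 / 160) (by norm_num)
        (hS _ (by norm_num)) hU hUne)
  refine ⟨1 / 160, by norm_num, by norm_num, ⋂₀ 𝒮, ⟨?_, fun ρ hρ x hx => hexc x hx ρ hρ⟩, hS, hdim⟩
  -- The empty set has dimension `0`, not `n`.
  by_contra hne
  have h := hdim Set.univ isOpen_univ ⟨((1 : N) : N ⧸ Λ), trivial⟩
  rw [Set.not_nonempty_iff_eq_empty.1 hne, Set.empty_inter, dimH_empty] at h
  exact hn.ne (by exact_mod_cast h)
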